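/- For $1\le p\le\infty$ and $\sigma>0$ let $PW^p_\sigma$ be the Paley–Wiener space of all functions $f(z)=\frac1{2\pi}\int_{-\sigma}^{\sigma}\widehat f(\omega)e^{i\omega z}\,d\omega$, $z\in\mathbb C$, with $\widehat f\in L^p([-\sigma,\sigma])$, normed by $\|f\|_{PW^p_\sigma}=\|\widehat f\|_{L^p([-\sigma,\sigma])}$, where $[-\sigma,\sigma]$ carries the normalized Lebesgue measure $d\omega/(2\sigma)$. A stable LTI system on $PW^1_\pi$ is a bounded linear operator $H:PW^1_\pi\to PW^1_\pi$ that commutes with all translations $f\mapsto f(\cdot-a)$, $a\in\mathbb R$. Let $\Lambda=\{\lambda_n\}_{n\in\mathbb Z}\subset\mathbb C$ be a complete interpolating sequence for $PW^2_\pi$, i.e. $f\mapsto\{f(\lambda_n)\}_{n\in\mathbb Z}$ is a bijection of $PW^2_\pi$ onto $\ell^2(\mathbb Z)$. Put $$\varphi(z)=z^{\delta_\Lambda}\lim_{R\to\infty}\prod_{|\lambda_n|<R,\ \lambda_n\ne0}\Bigl(1-\frac z{\lambda_n}\Bigr),\qquad \delta_\Lambda=\begin{cases}1,&0\in\Lambda,\\0,&0\notin\Lambda,\end{cases}\qquad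 \varphi_n(z)=\frac{\varphi(z)}{\varphi'(\lambda_n)(z-\lambda_n)},$$ with the removable singularity of $\varphi_n$ at $\lambda_n$ filled in. Then the limit defining $\varphi$ exists for every $z\in\mathbb C$, every $\varphi_n$ belongs to $PW^1_\pi$, and the following holds. For every $t\in\mathbb R$ there is a stable LTI system $H:PW^1_\pi\to PW^1_\pi$ such that for every $0<\beta<1$ there is an $f\in PW^1_{\beta\pi}$ with $$\limsup_{N\to\infty}\Bigl|\sum_{n=-N}^{N}f(\lambda_n)\,(H\varphi_n)(t)\Bigr|=\infty .$$ -/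

import Mathlib

open MeasureTheory Filter Topology

noncomputable section

/-- The function `z ↦ (2π)⁻¹ ∫_{-σ}^{σ} g(ω) e^{iωz} dω` on the complex plane. -/
def fourierSynthesis (σ : ℝ) (g : ℝ → ℂ) (z : ℂ) : ℂ :=
  (1 / (2 * (Real.pi : ℂ))) *
    ∫ ω in Set.Icc (-σ) σ, g ω * Complex.exp (Complex.I * (ω : ℂ) * z)

/-- `g` is a spectrum of `f`: it is in `L^p([-σ, σ])` and `f` is its inverse Fourier transform. -/
def IsSpectrum (p : ENNReal) (σ : ℝ) (f : ℂ → ℂ) (g : ℝ → ℂ) : Prop :=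
  MemLp g p (volume.restrict (Set.Icc (-σ) σ)) ∧ ∀ z : ℂ, f z = fourierSynthesis σ g z

theorem integrable_synthesis {p : ENNReal} [hp : Fact (1 ≤ p)] {σ : ℝ} {g : ℝ → ℂ}
    (hg : MemLp g p (volume.restrict (Set.Icc (-σ) σ))) (z : ℂ) :
    Integrable (fun ω : ℝ => g ω * Complex.exp (Complex.I * (ω : ℂ) * z))
      (volume.restrict (Set.Icc (-σ) σ)) := by
  have h1 : IntegrableOn g (Set.Icc (-σ) σ) volume := hg.integrable hp.out
  exact h1.mul_continuousOn (by fun_prop) isCompact_Icc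

/-- The Paley-Wiener space `PW^p_σ` (for `1 ≤ p ≤ ∞`), as a space of functions on `ℂ`. -/
def PaleyWiener (p : ENNReal) [Fact (1 ≤ p)] (σ : ℝ) : Submodule ℂ (ℂ → ℂ) where
  carrier := {f | ∃ g : ℝ → ℂ, IsSpectrum p σ f g}
  zero_mem' := ⟨0, MemLp.zero, fun z => by simp [fourierSynthesis]⟩
  add_mem' := by
    rintro f₁ f₂ ⟨g₁, h₁, e₁⟩ ⟨g₂, h₂, e₂⟩
    refine ⟨g₁ + g₂, h₁.add h₂, fun z => ?_⟩
    simp only [Pi.add_apply, e₁ z, e₂ z, fourierSynthesis, add_mul]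
    rw [integral_add (integrable_synthesis h₁ z) (integrable_synthesis h₂ z)]
    ring
  smul_mem' := by
    rintro c f ⟨g, h, e⟩
    refine ⟨c • g, h.const_smul c, fun z => ?_⟩
    simp only [Pi.smul_apply, smul_eq_mul, e z, fourierSynthesis, mul_assoc]
    rw [integral_const_mul]
    ring

/-- The norm `‖f‖_{PW^p_σ} = ‖f̂‖_{L^p([-σ, σ])}`, where `L^p([-σ, σ])` carries the normalized
Lebesgue measure `dω / (2σ)`. (The spectrum is unique up to null sets, so that the infimum runs
over a single value.) -/
def pwNorm (p : ENNReal) [Fact (1 ≤ p)] (σ : ℝ) (f : PaleyWiener p σ) : ℝ :=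
  ⨅ g : {g : ℝ → ℂ // IsSpectrum p σ (f : ℂ → ℂ) g},
    (eLpNorm g.1 p ((ENNReal.ofReal (2 * σ))⁻¹ • volume.restrict (Set.Icc (-σ) σ))).toReal

/-- The translation `(T_a f)(z) = f(z - a)`, `a` real, on `PW^p_σ`. -/
def pwTranslate (p : ENNReal) [Fact (1 ≤ p)] (σ a : ℝ) (f : PaleyWiener p σ) :
    PaleyWiener p σ :=
  ⟨fun z => (f : ℂ → ℂ) (z - (a : ℂ)), by
    obtain ⟨g, hg, e⟩ := f.2
    refine ⟨fun ω => Complex.exp (Complex.I * (ω : ℂ) * (-(a : ℂ))) * g ω, ?_, fun z => ?_⟩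
    · refine hg.of_le (AEStronglyMeasurable.mul (Continuous.aestronglyMeasurable (by fun_prop))
        hg.1) (Eventually.of_forall fun ω => ?_)
      have h : Complex.I * (ω : ℂ) * (-(a : ℂ)) = ((-(ω * a) : ℝ) : ℂ) * Complex.I := by
        push_cast; ring
      rw [norm_mul, h, Complex.norm_exp_ofReal_mul_I, one_mul]
    · rw [show (fun z : ℂ => (f : ℂ → ℂ) (z - (a : ℂ))) z = _ from e (z - (a : ℂ))]
      simp only [fourierSynthesis]
      congr 1
      refine integral_congr_ae (Eventually.of_forall fun ω => ?_)
      have h : Complex.I * (ω : ℂ) * (z - (a : ℂ))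
          = Complex.I * (ω : ℂ) * (-(a : ℂ)) + Complex.I * (ω : ℂ) * z := by ring
      simp only [h, Complex.exp_add]
      ring⟩

/-- A stable linear time-invariant system on `PW^1_π`: a bounded linear operator that commutes
with all real translations. -/
structure IsStableLTI (H : PaleyWiener 1 Real.pi →ₗ[ℂ] PaleyWiener 1 Real.pi) : Prop where
  stable : BddAbove {r : ℝ | ∃ f : PaleyWiener 1 Real.pi,
    pwNorm 1 Real.pi f ≤ 1 ∧ r = pwNorm 1 Real.pi (H f)}
  time_invariant : ∀ (a : ℝ) (f : PaleyWiener 1 Real.pi),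
    H (pwTranslate 1 Real.pi a f) = pwTranslate 1 Real.pi a (H f)

/-- `Λ` is complete interpolating for `PW^2_π`: the sampling operator `f ↦ (f(λ_n))_n` is a
(well defined) bijection from `PW^2_π` onto `ℓ²(ℤ)`. -/
def IsCompleteInterpolating (Λ : ℤ → ℂ) : Prop :=
  Set.BijOn (fun (f : ℂ → ℂ) (n : ℤ) => f (Λ n)) (PaleyWiener 2 Real.pi : Set (ℂ → ℂ))
    {c : ℤ → ℂ | Memℓp c 2}

open Classical in
/-- The truncated product `z^δ ∏_{|λ_n| < R, λ_n ≠ 0} (1 - z / λ_n)`, with `δ = 1` if `0` is in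
the sequence and `δ = 0` otherwise. -/
def generatingProduct (Λ : ℤ → ℂ) (R : ℝ) (z : ℂ) : ℂ :=
  z ^ (if ∃ n, Λ n = 0 then 1 else 0 : ℕ) *
    ∏ᶠ n ∈ {n : ℤ | ‖Λ n‖ < R ∧ Λ n ≠ 0}, (1 - z / Λ n)

/-- The generating function of `Λ`, the limit of the truncated products as `R → ∞`. -/
def generatingFunction (Λ : ℤ → ℂ) (z : ℂ) : ℂ :=
  limUnder atTop fun R : ℝ => generatingProduct Λ R z

/-- The interpolation kernel `φ_n(z) = φ(z) / (φ'(λ_n) (z - λ_n))`, with the removable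
singularity at `z = λ_n` filled in (`dslope φ a z` is `(φ z - φ a) / (z - a)` for `z ≠ a` and
`φ' a` for `z = a`; here `φ(λ_n) = 0`). -/
def interpolationKernel (Λ : ℤ → ℂ) (n : ℤ) (z : ℂ) : ℂ :=
  dslope (generatingFunction Λ) (Λ n) z / deriv (generatingFunction Λ) (Λ n)

end

/-!
Sampling at a complete interpolating sequence is an isomorphism `T` from the square-integrable
spectra on `[-π, π]` onto `ℓ²(ℤ)`, by the closed graph theorem. Everything rests on this isomorphism
and on the system dual to the sampling functionals, the functions `fₙ` with `fₙ(λₘ) = δₙₘ`, whose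
spectra are `dualSpectrum T n`.

*The generating function.* Let `φ(z) = (z - λ₀) f₀(z)` (`canonicalFunction`). Division by linear
factors stays inside `PW²_π`, so the completeness of the sequence shows that `φ` has simple zeros
exactly at the sampling points and that `φ(z) / (z - λₙ)` is a multiple of `fₙ`. The inequality
`|φ(z)| ≤ C (1 + |z|) e^{π|Im z|}` is immediate. The stability of interpolation, applied to
reproducing kernels, gives a lower bound of the same exponential type, with a polynomial loss, at
points that keep a distance from the zeros (`exists_canonicalFunction_lower`). By the
Borel-Carathéodory theorem the logarithmic derivative `φ'/φ` is therefore `∓iπ + O(log ρ / √ρ)` on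
most of the upper and the lower half of circles of radius `ρ` that avoid the zeros, and `O(log ρ)` on
the rest. The main terms of the two half circles cancel in the Cauchy integral of `φ'/φ`, so the
quotient of `φ` by the product over the zeros inside the circle is asymptotically constant. Annuli
of unit width contain a bounded number of sampling points, so suitable circles exist near every
radius and the products converge along all radii (`exists_tendsto_generatingProduct`). Consequently
the interpolation kernels are the functions `fₙ`.

*The divergence.* The `L¹` norms of the symmetric partial sums `s_N` of the dual spectra are
unbounded (`not_exists_bound_integral_norm_sum_dualSpectrum`). Otherwise, by duality with the
exponentials at the sampling points, each difference `s_{N+L} - s_N` would be of size at least `c L`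
on a set of measure at least `c' / L`. So one of `s_N`, `s_{N+L}` would have size at least `c L / 2`
on a set of measure at least `c' / (2 L)`, and averaging over `N` gives for every dyadic `L` the same
contribution to `∫ ‖s_N‖`, which is absurd. By the uniform boundedness principle there is a bounded
multiplier `m` for which the values at `t` of the functions with spectra `m s_N` are unbounded;
multiplication of spectra by `m` is the system `H`. With `cₙ = (H φₙ)(t)` the sums
`∑_{|n| ≤ N} cₙ` are thus unbounded. Since constants are pointwise limits of functions of arbitrarily
small bandwidth with bounded norms, a second application of the uniform boundedness principle, now
to `f ↦ ∑_{|n| ≤ N} f(λₙ) cₙ` on `PW¹_{βπ}`, yields `f`.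
-/

/-! ### Spectra on a band -/

/-- Lebesgue measure on the band `[-σ, σ]`. -/
noncomputable abbrev bandMeasure (σ : ℝ) : Measure ℝ := volume.restrict (Set.Icc (-σ) σ)

theorem norm_exp_I_mul (ω : ℝ) (z : ℂ) :
    ‖Complex.exp (Complex.I * (ω : ℂ) * z)‖ = Real.exp (-(ω * z.im)) := by
  rw [Complex.norm_exp]
  congr 1
  simp [Complex.mul_re, Complex.mul_im]

theorem norm_exp_I_mul_le {σ ω : ℝ} (hω : ω ∈ Set.Icc (-σ) σ) (z : ℂ) :
    ‖Complex.exp (Complex.I * (ω : ℂ) * z)‖ ≤ Real.exp (σ * |z.im|) := by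
  rw [norm_exp_I_mul]
  apply Real.exp_le_exp.2
  calc -(ω * z.im) ≤ |ω * z.im| := neg_le_abs _
    _ = |ω| * |z.im| := abs_mul _ _
    _ ≤ σ * |z.im| := by
      gcongr
      exact abs_le.2 hω

theorem fourierSynthesis_congr {σ : ℝ} {g h : ℝ → ℂ} (H : g =ᵐ[bandMeasure σ] h) (z : ℂ) :
    fourierSynthesis σ g z = fourierSynthesis σ h z := by
  unfold fourierSynthesis
  congr 1
  exact integral_congr_ae (H.mono fun ω hω => by simp only [hω])

theorem integrable_mul_exp {σ : ℝ} {g : ℝ → ℂ} (hg : Integrable g (bandMeasure σ)) (z : ℂ) :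
    Integrable (fun ω : ℝ => g ω * Complex.exp (Complex.I * (ω : ℂ) * z)) (bandMeasure σ) :=
  haveI : Fact ((1 : ENNReal) ≤ 1) := ⟨le_rfl⟩
  integrable_synthesis (p := 1) (memLp_one_iff_integrable.2 hg) z

theorem fourierSynthesis_add {σ : ℝ} {g h : ℝ → ℂ} (hg : Integrable g (bandMeasure σ))
    (hh : Integrable h (bandMeasure σ)) (z : ℂ) :
    fourierSynthesis σ (g + h) z = fourierSynthesis σ g z + fourierSynthesis σ h z := by
  simp only [fourierSynthesis, Pi.add_apply, add_mul]
  rw [integral_add (integrable_mul_exp hg z) (integrable_mul_exp hh z)]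
  ring

theorem fourierSynthesis_smul {σ : ℝ} (c : ℂ) (g : ℝ → ℂ) (z : ℂ) :
    fourierSynthesis σ (c • g) z = c * fourierSynthesis σ g z := by
  simp only [fourierSynthesis, Pi.smul_apply, smul_eq_mul, mul_assoc]
  rw [integral_const_mul]
  ring

theorem norm_fourierSynthesis_le {σ : ℝ} {g : ℝ → ℂ} (hg : Integrable g (bandMeasure σ)) (z : ℂ) :
    ‖fourierSynthesis σ g z‖ ≤
      Real.exp (σ * |z.im|) * ∫ ω, ‖g ω‖ ∂(bandMeasure σ) := by
  have h1 : ‖(1 / (2 * (Real.pi : ℂ)))‖ ≤ 1 := by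
    simp only [one_div, norm_inv, norm_mul, Complex.norm_ofNat, Complex.norm_real,
      Real.norm_eq_abs, abs_of_pos Real.pi_pos]
    apply inv_le_one_of_one_le₀
    linarith [Real.pi_gt_three]
  unfold fourierSynthesis
  rw [norm_mul]
  refine (mul_le_of_le_one_left (norm_nonneg _) h1).trans ?_
  rw [← integral_const_mul]
  refine (norm_integral_le_integral_norm _).trans ?_
  refine integral_mono_ae (integrable_mul_exp hg z).norm (hg.norm.const_mul _) ?_
  refine (ae_restrict_iff' measurableSet_Icc).2 (Eventually.of_forall fun ω hω => ?_)
  simp only [norm_mul]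
  rw [mul_comm]
  gcongr
  exact norm_exp_I_mul_le hω z

theorem differentiable_fourierSynthesis {σ : ℝ} {g : ℝ → ℂ} (hg : Integrable g (bandMeasure σ)) :
    Differentiable ℂ (fourierSynthesis σ g) := by
  intro z₀
  unfold fourierSynthesis
  refine DifferentiableAt.const_mul ?_ _
  have key := hasDerivAt_integral_of_dominated_loc_of_deriv_le (𝕜 := ℂ) (μ := bandMeasure σ)
    (F := fun z ω => g ω * Complex.exp (Complex.I * (ω : ℂ) * z))
    (F' := fun z ω => g ω * (Complex.exp (Complex.I * (ω : ℂ) * z) * (Complex.I * (ω : ℂ))))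
    (x₀ := z₀) (s := Metric.ball z₀ 1)
    (bound := fun ω => ‖g ω‖ * (Real.exp (|σ| * (|z₀.im| + 1)) * |σ|))
    (Metric.ball_mem_nhds _ one_pos)
    (Eventually.of_forall fun z => (integrable_mul_exp hg z).1)
    (integrable_mul_exp hg z₀)
    (hg.1.mul (Continuous.aestronglyMeasurable (by fun_prop)))
    ?_ (hg.norm.mul_const _) ?_
  · exact key.2.differentiableAt
  · refine (ae_restrict_iff' measurableSet_Icc).2 (Eventually.of_forall fun ω hω z hz => ?_)
    have hωσ : |ω| ≤ |σ| := (abs_le.2 hω).trans (le_abs_self σ)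
    have hz' : |z.im| ≤ |z₀.im| + 1 := by
      have h1 : |(z - z₀).im| ≤ 1 := (Complex.abs_im_le_norm _).trans
        (by rw [← dist_eq_norm]; exact (Metric.mem_ball.1 hz).le)
      rw [Complex.sub_im] at h1
      have := abs_sub_abs_le_abs_sub z.im z₀.im
      linarith
    rw [norm_mul, norm_mul, norm_mul]
    simp only [Complex.norm_I, one_mul, Complex.norm_real, Real.norm_eq_abs]
    gcongr
    refine (norm_exp_I_mul_le hω z).trans (Real.exp_le_exp.2 ?_)
    gcongr
    exact le_abs_self σ
  · refine Eventually.of_forall fun ω z _ => ?_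
    have h := ((hasDerivAt_id z).const_mul (Complex.I * (ω : ℂ))).cexp
    simpa using h.const_mul (g ω)

/-- Uniqueness of the spectrum: Fourier inversion turns the vanishing of the transform into
orthogonality to every test function. -/
theorem ae_eq_zero_of_fourierSynthesis_eq_zero {σ : ℝ} {g : ℝ → ℂ}
    (hg : Integrable g (bandMeasure σ)) (h0 : ∀ z, fourierSynthesis σ g z = 0) :
    g =ᵐ[bandMeasure σ] 0 := by
  have hint : Integrable ((Set.Icc (-σ) σ).indicator g) volume :=
    (integrable_indicator_iff measurableSet_Icc).2 hg
  have hF : ∀ y : ℝ, FourierTransform.fourier ((Set.Icc (-σ) σ).indicator g) y = 0 := by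
    intro y
    have h1 := h0 (-(2 * Real.pi * y : ℝ))
    unfold fourierSynthesis at h1
    have h2 : (1 / (2 * (Real.pi : ℂ))) ≠ 0 := by
      simp [Real.pi_ne_zero]
    have h3 := (mul_eq_zero.1 h1).resolve_left h2
    rw [Real.fourier_real_eq_integral_exp_smul, ← h3, ← integral_indicator measurableSet_Icc]
    refine integral_congr_ae (Eventually.of_forall fun ω => ?_)
    by_cases hω : ω ∈ Set.Icc (-σ) σ
    · simp only [Set.indicator_of_mem hω, smul_eq_mul]
      rw [mul_comm]
      congr 2
      push_cast
      ring
    · simp [Set.indicator_of_notMem hω]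
  have key : ∀ᵐ x ∂(volume : Measure ℝ), (Set.Icc (-σ) σ).indicator g x = 0 := by
    refine ae_eq_zero_of_integral_contDiff_smul_eq_zero hint.locallyIntegrable ?_
    intro φ hφ hφc
    have hφ' : ContDiff ℝ (⊤ : ℕ∞) (fun x => (φ x : ℂ)) :=
      Complex.ofRealCLM.contDiff.comp hφ
    have hφc' : HasCompactSupport (fun x => (φ x : ℂ)) :=
      hφc.comp_left (g := fun x : ℝ => (x : ℂ)) (by simp)
    let S : SchwartzMap ℝ ℂ := hφc'.toSchwartzMap hφ'
    let R : SchwartzMap ℝ ℂ := FourierTransformInv.fourierInv S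
    have hS : ∀ x, (φ x : ℂ) = FourierTransform.fourier (R : ℝ → ℂ) x := by
      intro x
      rw [← SchwartzMap.fourier_coe]
      simp [R, S]
    have h4 := VectorFourier.integral_fourierIntegral_smul_eq_flip (L := innerₗ ℝ)
      (μ := volume) (ν := volume) Real.continuous_fourierChar continuous_inner hint R.integrable
    have h5 : ∀ y, VectorFourier.fourierIntegral Real.fourierChar volume (innerₗ ℝ)
      ((Set.Icc (-σ) σ).indicator g) y = 0 := hF
    simp only [h5, zero_smul, integral_zero] at h4
    rw [flip_innerₗ] at h4
    rw [h4]
    refine integral_congr_ae (Eventually.of_forall fun x => ?_)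
    have := hS x
    simp only [Complex.real_smul, smul_eq_mul]
    rw [this, mul_comm]
    rfl
  refine (ae_restrict_iff' measurableSet_Icc).2 (key.mono fun x hx hx' => ?_)
  rwa [Set.indicator_of_mem hx'] at hx

/-- Division by a linear factor in `PW^2_σ`: the quotient has the spectrum
`ω ↦ -i e^{-iωμ} ∫_{-σ}^ω g(s) e^{isμ} ds`, as Fubini's theorem on the triangle `s ≤ ω` shows. -/
theorem exists_fourierSynthesis_div_sub {σ : ℝ} {g : ℝ → ℂ} (hg : MemLp g 2 (bandMeasure σ))
    {μ : ℂ} (h0 : fourierSynthesis σ g μ = 0) :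
    ∃ h : ℝ → ℂ, MemLp h 2 (bandMeasure σ) ∧
      ∀ z, (z - μ) * fourierSynthesis σ h z = fourierSynthesis σ g z := by
  have hg1 : Integrable g (bandMeasure σ) := hg.integrable (by norm_num)
  set k : ℝ → ℂ := fun s => g s * Complex.exp (Complex.I * (s : ℂ) * μ) with hk
  have hk1 : Integrable k (bandMeasure σ) := integrable_mul_exp hg1 μ
  have hk0 : ∫ s, k s ∂(bandMeasure σ) = 0 := by
    have h2 : (1 / (2 * (Real.pi : ℂ))) ≠ 0 := by
      simp [Real.pi_ne_zero]
    exact (mul_eq_zero.1 h0).resolve_left h2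
  have htri : MeasurableSet {p : ℝ × ℝ | p.2 ≤ p.1} := measurableSet_le measurable_snd measurable_fst
  have hprod : ∀ E : ℝ → ℂ, Integrable E (bandMeasure σ) →
      Integrable (fun p : ℝ × ℝ => E p.1 * (Set.Iic p.1).indicator k p.2)
        ((bandMeasure σ).prod (bandMeasure σ)) := by
    intro E hE
    refine ((hE.mul_prod hk1).indicator htri).congr (Eventually.of_forall fun p => ?_)
    dsimp only
    by_cases hp : p.2 ≤ p.1
    · rw [Set.indicator_of_mem (show p ∈ {p : ℝ × ℝ | p.2 ≤ p.1} from hp),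
        Set.indicator_of_mem (show p.2 ∈ Set.Iic p.1 from hp)]
    · rw [Set.indicator_of_notMem (show p ∉ {p : ℝ × ℝ | p.2 ≤ p.1} from hp),
        Set.indicator_of_notMem (show p.2 ∉ Set.Iic p.1 from hp), mul_zero]
  set G : ℝ → ℂ := fun ω => ∫ s, (Set.Iic ω).indicator k s ∂(bandMeasure σ) with hG
  have hGm : AEStronglyMeasurable G (bandMeasure σ) := by
    have := (hprod (fun _ => 1) (integrable_const _)).1.integral_prod_right'
    simpa using this
  have hGb : ∀ ω, ‖G ω‖ ≤ ∫ s, ‖k s‖ ∂(bandMeasure σ) := by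
    intro ω
    refine (norm_integral_le_integral_norm _).trans ?_
    refine integral_mono (hk1.indicator measurableSet_Iic).norm hk1.norm fun s => ?_
    exact norm_indicator_le_norm_self _ _
  refine ⟨fun ω => -Complex.I * Complex.exp (Complex.I * (ω : ℂ) * (-μ)) * G ω, ?_, fun z => ?_⟩
  · refine MemLp.of_bound ((Continuous.aestronglyMeasurable (by fun_prop)).mul hGm)
      (Real.exp (σ * |(-μ).im|) * ∫ s, ‖k s‖ ∂(bandMeasure σ)) ?_
    refine (ae_restrict_iff' measurableSet_Icc).2 (Eventually.of_forall fun ω hω => ?_)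
    rw [norm_mul, norm_mul, norm_neg, Complex.norm_I, one_mul]
    gcongr
    · exact norm_exp_I_mul_le hω _
    · exact hGb ω
  · rcases eq_or_ne z μ with rfl | hz
    · rw [sub_self, zero_mul, h0]
    have hz' : z - μ ≠ 0 := sub_ne_zero.2 hz
    set E : ℝ → ℂ := fun ω => Complex.exp (Complex.I * (z - μ) * (ω : ℂ)) with hE
    have hEi : Integrable E (bandMeasure σ) :=
      (Continuous.continuousOn (by fun_prop)).integrableOn_compact isCompact_Icc
    have hinner : ∀ s ∈ Set.Icc (-σ) σ, ∫ ω, E ω * (Set.Iic ω).indicator k s ∂(bandMeasure σ)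
        = k s * ((E σ - E s) / (Complex.I * (z - μ))) := by
      intro s hs
      have e1 : ∀ ω, E ω * (Set.Iic ω).indicator k s = k s * (Set.Ici s).indicator E ω := by
        intro ω
        by_cases hp : s ≤ ω
        · rw [Set.indicator_of_mem (show s ∈ Set.Iic ω from hp),
            Set.indicator_of_mem (show ω ∈ Set.Ici s from hp), mul_comm]
        · rw [Set.indicator_of_notMem (show s ∉ Set.Iic ω from hp),
            Set.indicator_of_notMem (show ω ∉ Set.Ici s from hp), mul_zero, mul_zero]
      simp_rw [e1]
      rw [integral_const_mul, integral_indicator measurableSet_Ici,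
        Measure.restrict_restrict measurableSet_Ici]
      have e2 : Set.Ici s ∩ Set.Icc (-σ) σ = Set.Icc s σ := by
        ext x
        simp only [Set.mem_inter_iff, Set.mem_Ici, Set.mem_Icc]
        exact ⟨fun h => ⟨h.1, h.2.2⟩, fun h => ⟨h.1, hs.1.trans h.1, h.2⟩⟩
      rw [e2, integral_Icc_eq_integral_Ioc, ← intervalIntegral.integral_of_le hs.2,
        integral_exp_mul_complex (mul_ne_zero Complex.I_ne_zero hz')]
    have h1 : ∫ ω, G ω * E ω ∂(bandMeasure σ) =
        -(Complex.I * (z - μ))⁻¹ * ∫ s, g s * Complex.exp (Complex.I * (s : ℂ) * z)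
          ∂(bandMeasure σ) := by
      calc ∫ ω, G ω * E ω ∂(bandMeasure σ)
          = ∫ ω, ∫ s, E ω * (Set.Iic ω).indicator k s ∂(bandMeasure σ) ∂(bandMeasure σ) := by
            refine integral_congr_ae (Eventually.of_forall fun ω => ?_)
            simp only [hG]
            rw [integral_const_mul, mul_comm]
        _ = ∫ s, ∫ ω, E ω * (Set.Iic ω).indicator k s ∂(bandMeasure σ) ∂(bandMeasure σ) :=
            integral_integral_swap (hprod E hEi)
        _ = ∫ s, k s * ((E σ - E s) / (Complex.I * (z - μ))) ∂(bandMeasure σ) :=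
            setIntegral_congr_fun measurableSet_Icc hinner
        _ = ∫ s, ((E σ / (Complex.I * (z - μ))) * k s -
              (Complex.I * (z - μ))⁻¹ * (g s * Complex.exp (Complex.I * (s : ℂ) * z)))
              ∂(bandMeasure σ) := by
            refine integral_congr_ae (Eventually.of_forall fun s => ?_)
            have e3 : Complex.exp (Complex.I * (s : ℂ) * z) =
                Complex.exp (Complex.I * (s : ℂ) * μ) * E s := by
              simp only [hE]
              rw [← Complex.exp_add]
              congr 1
              ring
            simp only [hk, e3]
            ring
        _ = _ := by
            rw [integral_sub (hk1.const_mul _) ((integrable_mul_exp hg1 z).const_mul _),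
              integral_const_mul, integral_const_mul, hk0]
            ring
    have h2 : ∫ ω, (-Complex.I * Complex.exp (Complex.I * (ω : ℂ) * (-μ)) * G ω) *
        Complex.exp (Complex.I * (ω : ℂ) * z) ∂(bandMeasure σ) =
        -Complex.I * ∫ ω, G ω * E ω ∂(bandMeasure σ) := by
      rw [← integral_const_mul]
      refine integral_congr_ae (Eventually.of_forall fun ω => ?_)
      have e3 : E ω = Complex.exp (Complex.I * (ω : ℂ) * (-μ)) *
          Complex.exp (Complex.I * (ω : ℂ) * z) := by
        simp only [hE]
        rw [← Complex.exp_add]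
        congr 1
        ring
      simp only [e3]
      ring
    unfold fourierSynthesis
    rw [h2, h1]
    have hI : Complex.I * (Complex.I * (z - μ))⁻¹ * (z - μ) = 1 := by
      field_simp
    linear_combination ((1 / (2 * (Real.pi : ℂ))) *
      ∫ s, g s * Complex.exp (Complex.I * (s : ℂ) * z) ∂(bandMeasure σ)) * hI

/-! ### The sampling isomorphism -/

theorem integral_norm_le_norm_Lp {σ : ℝ} (g : Lp ℂ 2 (bandMeasure σ)) :
    ∫ ω, ‖g ω‖ ∂(bandMeasure σ) ≤ Real.sqrt (2 * |σ|) * ‖g‖ := by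
  have h1 : ∫ ω, ‖g ω‖ ∂(bandMeasure σ) = (eLpNorm g 1 (bandMeasure σ)).toReal := by
    rw [eLpNorm_one_eq_lintegral_enorm, integral_norm_eq_lintegral_enorm (Lp.aestronglyMeasurable g)]
  have h2 := eLpNorm_le_eLpNorm_mul_rpow_measure_univ (p := 1) (q := 2) (μ := bandMeasure σ)
    (f := (g : ℝ → ℂ)) (by norm_num) (Lp.aestronglyMeasurable g)
  have hu : (bandMeasure σ) Set.univ = ENNReal.ofReal (σ + σ) := by
    simp
  have h3 : (eLpNorm g 2 (bandMeasure σ) * (bandMeasure σ) Set.univ ^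
      (1 / (1 : ENNReal).toReal - 1 / (2 : ENNReal).toReal)) ≠ ⊤ := by
    refine ENNReal.mul_ne_top (Lp.eLpNorm_ne_top g) (ENNReal.rpow_ne_top_of_nonneg ?_ ?_)
    · norm_num
    · rw [hu]; exact ENNReal.ofReal_ne_top
  rw [h1, mul_comm, Lp.norm_def]
  refine (ENNReal.toReal_mono h3 h2).trans ?_
  rw [ENNReal.toReal_mul]
  gcongr
  rw [← ENNReal.toReal_rpow, hu, Real.sqrt_eq_rpow]
  norm_num
  refine Real.rpow_le_rpow ENNReal.toReal_nonneg ?_ (by norm_num)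
  rw [ENNReal.toReal_ofReal', ← two_mul]
  refine max_le (by gcongr; exact le_abs_self σ) (by positivity)

theorem integrable_Lp_two {σ : ℝ} (g : Lp ℂ 2 (bandMeasure σ)) : Integrable g (bandMeasure σ) :=
  (Lp.memLp g).integrable (by norm_num)

theorem norm_fourierSynthesis_Lp_le {σ : ℝ} (g : Lp ℂ 2 (bandMeasure σ)) (z : ℂ) :
    ‖fourierSynthesis σ g z‖ ≤ Real.sqrt (2 * |σ|) * Real.exp (σ * |z.im|) * ‖g‖ := by
  refine (norm_fourierSynthesis_le (integrable_Lp_two g) z).trans ?_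
  rw [mul_comm (Real.sqrt _), mul_assoc]
  gcongr
  exact integral_norm_le_norm_Lp g

/-- Evaluation at a point of the plane, as a continuous functional of the `L²` spectrum. -/
noncomputable def evalSpectrum (σ : ℝ) (z : ℂ) : Lp ℂ 2 (bandMeasure σ) →L[ℂ] ℂ :=
  LinearMap.mkContinuous
    { toFun := fun g => fourierSynthesis σ g z
      map_add' := fun g h => by
        rw [fourierSynthesis_congr (Lp.coeFn_add g h),
          fourierSynthesis_add (integrable_Lp_two g) (integrable_Lp_two h)]
      map_smul' := fun c g => by
        rw [fourierSynthesis_congr (Lp.coeFn_smul c g), fourierSynthesis_smul]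
        rfl }
    (Real.sqrt (2 * |σ|) * Real.exp (σ * |z.im|)) (fun g => norm_fourierSynthesis_Lp_le g z)

theorem evalSpectrum_apply (σ : ℝ) (z : ℂ) (g : Lp ℂ 2 (bandMeasure σ)) :
    evalSpectrum σ z g = fourierSynthesis σ g z := rfl

theorem eq_zero_of_fourierSynthesis_Lp {σ : ℝ} {g : Lp ℂ 2 (bandMeasure σ)}
    (h : ∀ z, fourierSynthesis σ g z = 0) : g = 0 := by
  refine Lp.ext ?_
  filter_upwards [ae_eq_zero_of_fourierSynthesis_eq_zero (integrable_Lp_two g) h,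
    Lp.coeFn_zero ℂ 2 (bandMeasure σ)] with ω h1 h2
  rw [h1, h2]

theorem fourierSynthesis_toLp {σ : ℝ} {g : ℝ → ℂ} (hg : MemLp g 2 (bandMeasure σ)) (z : ℂ) :
    fourierSynthesis σ (hg.toLp g) z = fourierSynthesis σ g z :=
  fourierSynthesis_congr hg.coeFn_toLp z

/-- For a complete interpolating sequence, sampling is an isomorphism from spectra onto `ℓ²`;
its continuity follows from the closed graph theorem. -/
theorem IsCompleteInterpolating.exists_samplingEquiv {Λ : ℤ → ℂ}
    (hΛ : IsCompleteInterpolating Λ) :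
    ∃ T : Lp ℂ 2 (bandMeasure Real.pi) ≃L[ℂ] lp (fun _ : ℤ => ℂ) 2,
      ∀ g n, T g n = fourierSynthesis Real.pi g (Λ n) := by
  have hmem : ∀ g : Lp ℂ 2 (bandMeasure Real.pi),
      (fun z => fourierSynthesis Real.pi g z) ∈ PaleyWiener 2 Real.pi :=
    fun g => ⟨g, Lp.memLp g, fun z => rfl⟩
  let S : Lp ℂ 2 (bandMeasure Real.pi) →ₗ[ℂ] lp (fun _ : ℤ => ℂ) 2 :=
    { toFun := fun g => ⟨fun n => fourierSynthesis Real.pi g (Λ n), hΛ.mapsTo (hmem g)⟩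
      map_add' := fun g h => by
        ext n
        exact map_add (evalSpectrum Real.pi (Λ n)) g h
      map_smul' := fun c g => by
        ext n
        exact map_smul (evalSpectrum Real.pi (Λ n)) c g }
  have hS : ∀ g n, S g n = evalSpectrum Real.pi (Λ n) g := fun g n => rfl
  let S' : Lp ℂ 2 (bandMeasure Real.pi) →L[ℂ] lp (fun _ : ℤ => ℂ) 2 :=
    ContinuousLinearMap.ofSeqClosedGraph (g := S) (by
      intro u x y hu hy
      ext n
      have h1 : Tendsto (fun k => S (u k) n) atTop (𝓝 (y n)) :=
        (tendsto_pi_nhds.1 ((lp.uniformContinuous_coe).continuous.tendsto y |>.comp hy)) n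
      have h2 : Tendsto (fun k => S (u k) n) atTop (𝓝 (S x n)) :=
        ((evalSpectrum Real.pi (Λ n)).continuous.tendsto x).comp hu
      exact tendsto_nhds_unique h1 h2)
  refine ⟨ContinuousLinearEquiv.ofBijective S' ?_ ?_, fun g n => rfl⟩
  · refine LinearMap.ker_eq_bot'.2 fun g hg => ?_
    refine eq_zero_of_fourierSynthesis_Lp fun z => ?_
    have h1 := hΛ.injOn (hmem g) (PaleyWiener 2 Real.pi).zero_mem (by
      ext n
      exact congrFun (congrArg (fun y : lp (fun _ : ℤ => ℂ) 2 => (y : ℤ → ℂ)) hg) n)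
    exact congrFun h1 z
  · refine LinearMap.range_eq_top.2 fun y => ?_
    obtain ⟨f, ⟨g, hg, e⟩, hf⟩ := hΛ.surjOn (show (y : ℤ → ℂ) ∈ {c : ℤ → ℂ | Memℓp c 2} from y.2)
    refine ⟨hg.toLp g, ?_⟩
    ext n
    have h1 := congrFun hf n
    simp only at h1
    rw [← h1, e, ← fourierSynthesis_toLp hg]
    rfl

/-! ### Sequences of functions with large differences -/

theorem norm_sq_eq_integral_Lp {α : Type*} [MeasurableSpace α] {ν : Measure α} (g : Lp ℂ 2 ν) :
    ‖g‖ ^ 2 = ∫ x, ‖g x‖ ^ 2 ∂ν := by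
  have h := @inner_self_eq_norm_sq ℂ _ _ _ _ g
  rw [← h, L2.inner_def]
  have : ∀ x, inner ℂ (g x) (g x) = ((‖g x‖ ^ 2 : ℝ) : ℂ) := fun x => by
    rw [inner_self_eq_norm_sq_to_K]; norm_cast
  rw [integral_congr_ae (Eventually.of_forall this)]
  exact congrArg Complex.re (integral_ofReal (f := fun x => ‖g x‖ ^ 2))

/-- If `D` is bounded in `L¹`, has `‖D‖₂² ≲ L`, and correlates with a function `E` such that
`|E| ≲ L` and `‖E‖₂² ≲ L`, then `|D|` is of size `L` on a set of measure at least of order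
`1 / L`. -/
theorem measureReal_large_ge {α : Type*} [MeasurableSpace α] {ν : Measure α} [IsFiniteMeasure ν]
    {D E : α → ℂ} {C M c₀ L : ℝ} (hC : 0 < C) (hM : 0 < M) (hc₀ : 0 < c₀) (hL : 0 < L)
    (hD : MemLp D 2 ν) (hE : MemLp E 2 ν) (hDs : StronglyMeasurable D)
    (hEb : ∀ᵐ x ∂ν, ‖E x‖ ≤ C * L) (hE2 : ∫ x, ‖E x‖ ^ 2 ∂ν ≤ C * L)
    (hD2 : ∫ x, ‖D x‖ ^ 2 ∂ν ≤ C * L) (hD1 : ∫ x, ‖D x‖ ∂ν ≤ M)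
    (hDE : c₀ * L ≤ ‖∫ x, D x * E x ∂ν‖) :
    c₀ ^ 2 / (2 * C ^ 3) / L ≤ ν.real {x | c₀ ^ 2 / (16 * M * C) * L ≤ ‖D x‖} := by
  set c := c₀ ^ 2 / (16 * M * C) with hc
  set G : Set α := {x | c * L ≤ ‖D x‖} with hG
  have hGm : MeasurableSet G := measurableSet_le measurable_const hDs.norm.measurable
  -- the weights `η` and `τ` and the level `c` leave at most half of `c₀ * L` for the part of
  -- `∫ ‖D‖ ‖E‖` that does not come from `G`
  set η := c₀ / (4 * C ^ 2 * L) with hη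
  set τ := c₀ / (8 * C) with hτ
  have hηpos : 0 < η := by positivity
  have hτpos : 0 < τ := by positivity
  have hcpos : 0 < c := by positivity
  have hpt : ∀ᵐ x ∂ν, ‖D x‖ * ‖E x‖ ≤ C * L * η * ‖D x‖ ^ 2 + C * L / (4 * η) * G.indicator 1 x
      + τ * ‖E x‖ ^ 2 + c * L / (4 * τ) * ‖D x‖ := by
    filter_upwards [hEb] with x hx
    have hd := norm_nonneg (D x)
    have he := norm_nonneg (E x)
    by_cases hxG : x ∈ G
    · rw [Set.indicator_of_mem hxG]
      have h1 : ‖D x‖ ≤ η * ‖D x‖ ^ 2 + 1 / (4 * η) := by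
        have h : 0 ≤ (2 * η * ‖D x‖ - 1) ^ 2 / (4 * η) := by positivity
        have h' : (2 * η * ‖D x‖ - 1) ^ 2 / (4 * η) = η * ‖D x‖ ^ 2 + 1 / (4 * η) - ‖D x‖ := by
          field_simp; ring
        linarith
      have h2 : ‖D x‖ * ‖E x‖ ≤ (η * ‖D x‖ ^ 2 + 1 / (4 * η)) * (C * L) := by gcongr
      have h3 : 0 ≤ τ * ‖E x‖ ^ 2 + c * L / (4 * τ) * ‖D x‖ := by positivity
      have h4 : (η * ‖D x‖ ^ 2 + 1 / (4 * η)) * (C * L) =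
        C * L * η * ‖D x‖ ^ 2 + C * L / (4 * η) * 1 := by ring
      simp only [Pi.one_apply]
      linarith
    · rw [Set.indicator_of_notMem hxG]
      have hxc : ‖D x‖ ≤ c * L := (not_le.1 hxG).le
      have h1 : ‖D x‖ * ‖E x‖ ≤ τ * ‖E x‖ ^ 2 + ‖D x‖ ^ 2 / (4 * τ) := by
        have h : 0 ≤ (2 * τ * ‖E x‖ - ‖D x‖) ^ 2 / (4 * τ) := by positivity
        have h' : (2 * τ * ‖E x‖ - ‖D x‖) ^ 2 / (4 * τ) =
          τ * ‖E x‖ ^ 2 + ‖D x‖ ^ 2 / (4 * τ) - ‖D x‖ * ‖E x‖ := by field_simp; ring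
        linarith
      have h2 : ‖D x‖ ^ 2 / (4 * τ) ≤ c * L / (4 * τ) * ‖D x‖ := by
        rw [div_mul_eq_mul_div, sq]
        gcongr
      have h3 : 0 ≤ C * L * η * ‖D x‖ ^ 2 := by positivity
      simp only [mul_zero, add_zero]
      linarith
  have hiD2 : Integrable (fun x => ‖D x‖ ^ 2) ν := hD.integrable_norm_pow (by norm_num)
  have hiE2 : Integrable (fun x => ‖E x‖ ^ 2) ν := hE.integrable_norm_pow (by norm_num)
  have hiD : Integrable (fun x => ‖D x‖) ν := (hD.integrable (by norm_num)).norm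
  have hiG : Integrable (G.indicator (1 : α → ℝ)) ν :=
    (integrable_const (1 : ℝ)).indicator hGm
  have hint : c₀ * L ≤ C * L * η * (C * L) + C * L / (4 * η) * ν.real G + τ * (C * L)
      + c * L / (4 * τ) * M := by
    refine hDE.trans ((norm_integral_le_integral_norm _).trans ?_)
    simp only [norm_mul]
    refine (integral_mono_ae ?_ ?_ hpt).trans ?_
    · refine Integrable.congr (hD.integrable_mul hE).norm (Eventually.of_forall fun x => ?_)
      simp
    · exact (((hiD2.const_mul _).add (hiG.const_mul _)).add (hiE2.const_mul _)).add
        (hiD.const_mul _)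
    · have e : ∫ x, (C * L * η * ‖D x‖ ^ 2 + C * L / (4 * η) * G.indicator 1 x
          + τ * ‖E x‖ ^ 2 + c * L / (4 * τ) * ‖D x‖) ∂ν =
          C * L * η * (∫ x, ‖D x‖ ^ 2 ∂ν) + C * L / (4 * η) * ν.real G
          + τ * (∫ x, ‖E x‖ ^ 2 ∂ν) + c * L / (4 * τ) * ∫ x, ‖D x‖ ∂ν := by
        have i2 : Integrable (fun x => C * L * η * ‖D x‖ ^ 2 +
            C * L / (4 * η) * G.indicator 1 x) ν := (hiD2.const_mul _).add (hiG.const_mul _)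
        have i3 : Integrable (fun x => C * L * η * ‖D x‖ ^ 2 +
            C * L / (4 * η) * G.indicator 1 x + τ * ‖E x‖ ^ 2) ν := i2.add (hiE2.const_mul _)
        rw [integral_add i3 (hiD.const_mul _), integral_add i2 (hiE2.const_mul _),
          integral_add (hiD2.const_mul _) (hiG.const_mul _), integral_const_mul,
          integral_const_mul, integral_const_mul, integral_const_mul, integral_indicator_one hGm]
      rw [e]
      gcongr
  have e1 : C * L * η * (C * L) = c₀ * L / 4 := by rw [hη]; field_simp
  have e2 : τ * (C * L) = c₀ * L / 8 := by rw [hτ]; field_simp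
  have e3 : c * L / (4 * τ) * M = c₀ * L / 8 := by rw [hτ, hc]; field_simp; norm_num
  have e4 : C * L / (4 * η) * ν.real G = C ^ 3 * L ^ 2 / c₀ * ν.real G := by
    rw [hη]; field_simp
  rw [e1, e2, e3, e4] at hint
  have h5 : c₀ * L / 2 ≤ C ^ 3 * L ^ 2 / c₀ * ν.real G := by linarith
  rw [div_div, div_le_iff₀ (by positivity)]
  rw [div_mul_eq_mul_div, le_div_iff₀ hc₀] at h5
  have h6 : L * (c₀ ^ 2) ≤ L * (ν.real G * (2 * C ^ 3 * L)) := by nlinarith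
  exact le_of_mul_le_mul_left h6 hL

/-- The dyadic levels below `x` sum up to at most `2 * x`. -/
theorem sum_two_pow_le_of_bound (J : ℕ) {x : ℝ} (hx : 0 ≤ x) :
    ∑ j ∈ Finset.range J, (if (2 : ℝ) ^ j ≤ x then (2 : ℝ) ^ j else 0) ≤ 2 * x := by
  suffices h : ∑ j ∈ Finset.range J, (if (2 : ℝ) ^ j ≤ x then (2 : ℝ) ^ j else 0) ≤
      min (2 ^ J) (2 * x) from h.trans (min_le_right _ _)
  induction J with
  | zero => simp [hx]
  | succ J ih =>
    rw [Finset.sum_range_succ, pow_succ]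
    split_ifs with h
    · have h1 := ih.trans (min_le_left _ _)
      exact le_min (by linarith) (by linarith)
    · rw [add_zero]
      refine ih.trans (le_min ((min_le_left _ _).trans ?_) (min_le_right _ _))
      have : (0 : ℝ) < 2 ^ J := by positivity
      linarith

/-- Functions bounded in `L¹` cannot have all differences `s (n + L) - s n` of size `L` on sets of
measure of order `1 / L`: on average over `n`, every dyadic level `2 ^ j` would contribute a fixed
amount to `∫ ‖s n‖`. -/
theorem false_of_differences_large {α : Type*} [MeasurableSpace α] {ν : Measure α}
    [IsFiniteMeasure ν] {s : ℕ → α → ℂ} {M c c' : ℝ} (hc : 0 < c) (hc' : 0 < c')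
    (hs : ∀ n, Integrable (s n) ν) (hsm : ∀ n, StronglyMeasurable (s n))
    (hM : ∀ n, ∫ x, ‖s n x‖ ∂ν ≤ M)
    (hd : ∀ n L : ℕ, 0 < L → c' / L ≤ ν.real {x | c * L ≤ ‖s (n + L) x - s n x‖}) : False := by
  set A : ℕ → ℕ → Set α := fun n L => {x | c * L / 2 ≤ ‖s n x‖} with hA
  have hAm : ∀ n L, MeasurableSet (A n L) := fun n L =>
    measurableSet_le measurable_const (hsm n).norm.measurable
  have h1 : ∀ n L : ℕ, 0 < L → c' / L ≤ ν.real (A n L) + ν.real (A (n + L) L) := by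
    intro n L hL
    refine (hd n L hL).trans ((measureReal_mono (s₂ := A n L ∪ A (n + L) L) ?_).trans
      (measureReal_union_le _ _))
    intro x hx
    by_contra hx'
    simp only [hA, Set.mem_union, Set.mem_ofPred_eq, not_or, not_le] at hx' hx
    have := norm_sub_le (s (n + L) x) (s n x)
    linarith
  have h2 : ∀ n J : ℕ, ∑ j ∈ Finset.range J, (2 : ℝ) ^ j * ν.real (A n (2 ^ j)) ≤ 4 * M / c := by
    intro n J
    have e : ∀ j, (2 : ℝ) ^ j * ν.real (A n (2 ^ j)) =
        ∫ x, (2 : ℝ) ^ j * (A n (2 ^ j)).indicator 1 x ∂ν := by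
      intro j
      rw [integral_const_mul, integral_indicator_one (hAm _ _)]
    have hi : ∀ j, Integrable (fun x => (2 : ℝ) ^ j * (A n (2 ^ j)).indicator 1 x) ν :=
      fun j => ((integrable_const (1 : ℝ)).indicator (hAm _ _)).const_mul _
    simp_rw [e]
    rw [← integral_finsetSum _ fun j _ => hi j]
    calc ∫ x, ∑ j ∈ Finset.range J, (2 : ℝ) ^ j * (A n (2 ^ j)).indicator 1 x ∂ν
        ≤ ∫ x, 4 / c * ‖s n x‖ ∂ν := by
          refine integral_mono (integrable_finsetSum _ fun j _ => hi j)
            ((hs n).norm.const_mul _) fun x => ?_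
          have h3 := sum_two_pow_le_of_bound J (x := 2 * ‖s n x‖ / c) (by positivity)
          have e2 : 2 * (2 * ‖s n x‖ / c) = 4 / c * ‖s n x‖ := by ring
          rw [e2] at h3
          refine le_trans (Finset.sum_le_sum fun j _ => ?_) h3
          by_cases hx : x ∈ A n (2 ^ j)
          · rw [Set.indicator_of_mem hx, if_pos]
            · simp
            · simp only [hA, Set.mem_ofPred_eq] at hx
              push_cast at hx
              rw [le_div_iff₀ hc]
              linarith
          · rw [Set.indicator_of_notMem hx, mul_zero]
            positivity
      _ = 4 / c * ∫ x, ‖s n x‖ ∂ν := integral_const_mul _ _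
      _ ≤ 4 / c * M := by gcongr; exact hM n
      _ = 4 * M / c := by ring
  -- for every `j < J` the average over `n < 2 * 2 ^ J` of `2 ^ j * ν (A n (2 ^ j))` is at least
  -- `c' / 4`, whereas by `h2` the sum over `j` of these averages is bounded independently of `J`
  obtain ⟨J, hJ⟩ := exists_nat_gt (16 * M / (c * c'))
  set N := 2 ^ J with hN
  have hNpos : (0 : ℝ) < N := by positivity
  have h3 : ∀ j ∈ Finset.range J, (N : ℝ) * c' ≤
      2 * ∑ n ∈ Finset.range (2 * N), (2 : ℝ) ^ j * ν.real (A n (2 ^ j)) := by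
    intro j hj
    have hjN : 2 ^ j ≤ N := Nat.pow_le_pow_right (by norm_num) (Finset.mem_range.1 hj).le
    have h4 : ∑ n ∈ Finset.range N, c' / ((2 ^ j : ℕ) : ℝ) ≤
        ∑ n ∈ Finset.range N, (ν.real (A n (2 ^ j)) + ν.real (A (n + 2 ^ j) (2 ^ j))) :=
      Finset.sum_le_sum fun n _ => h1 n _ (by positivity)
    rw [Finset.sum_const, Finset.card_range, nsmul_eq_mul, Finset.sum_add_distrib] at h4
    have h5 : ∑ n ∈ Finset.range N, ν.real (A n (2 ^ j)) ≤
        ∑ n ∈ Finset.range (2 * N), ν.real (A n (2 ^ j)) :=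
      Finset.sum_le_sum_of_subset_of_nonneg (by gcongr; omega) fun _ _ _ => measureReal_nonneg
    have h6 : ∑ n ∈ Finset.range N, ν.real (A (n + 2 ^ j) (2 ^ j)) ≤
        ∑ n ∈ Finset.range (2 * N), ν.real (A n (2 ^ j)) := by
      have e3 := Finset.sum_map (Finset.range N) (addRightEmbedding (2 ^ j))
        (fun n => ν.real (A n (2 ^ j)))
      simp only [addRightEmbedding_apply] at e3
      rw [← e3]
      refine Finset.sum_le_sum_of_subset_of_nonneg (fun n hn => ?_) fun _ _ _ => measureReal_nonneg
      obtain ⟨m, hm, rfl⟩ := Finset.mem_map.1 hn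
      have := Finset.mem_range.1 hm
      simp only [addRightEmbedding_apply, Finset.mem_range]
      omega
    rw [← Finset.mul_sum]
    have h7 : (N : ℝ) * (c' / ((2 ^ j : ℕ) : ℝ)) ≤
        2 * ∑ n ∈ Finset.range (2 * N), ν.real (A n (2 ^ j)) := by linarith
    push_cast at h7
    have h8 : (0 : ℝ) < 2 ^ j := by positivity
    rw [mul_div_assoc', div_le_iff₀ h8] at h7
    linarith
  have h9 := Finset.sum_le_sum h3
  rw [Finset.sum_const, Finset.card_range, nsmul_eq_mul, ← Finset.mul_sum, Finset.sum_comm] at h9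
  have h10 : ∑ n ∈ Finset.range (2 * N), ∑ j ∈ Finset.range J, (2 : ℝ) ^ j * ν.real (A n (2 ^ j))
      ≤ ∑ n ∈ Finset.range (2 * N), 4 * M / c := Finset.sum_le_sum fun n _ => h2 n J
  rw [Finset.sum_const, Finset.card_range, nsmul_eq_mul] at h10
  push_cast at h10
  have h11 : (N : ℝ) * (J * c') ≤ N * (16 * M / c) := by
    have e : (N : ℝ) * (16 * M / c) = 2 * (2 * N * (4 * M / c)) := by ring
    rw [e]
    linarith
  have h12 := le_of_mul_le_mul_left h11 hNpos
  rw [div_lt_iff₀ (by positivity)] at hJ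
  rw [le_div_iff₀ hc] at h12
  linarith

/-! ### The dual system of the sampling functionals -/

theorem memLp_bandMeasure_of_continuous {σ : ℝ} {f : ℝ → ℂ} (hf : Continuous f) (p : ENNReal) :
    MemLp f p (bandMeasure σ) := by
  obtain ⟨C, hC⟩ := (isCompact_Icc (a := -σ) (b := σ)).exists_bound_of_continuousOn hf.continuousOn
  exact MemLp.of_bound hf.aestronglyMeasurable C
    ((ae_restrict_iff' measurableSet_Icc).2 (Eventually.of_forall hC))

/-- The reproducing kernel of `PW^2_π` at `w`: its value at `w` is its squared norm over `2π`,
and this squared norm is of order `e^{2π|Im w|} / (1 + |Im w|)`. -/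
theorem exists_reproducing (w : ℂ) :
    ∃ g : Lp ℂ 2 (bandMeasure Real.pi),
      fourierSynthesis Real.pi g w = ((‖g‖ ^ 2 / (2 * Real.pi) : ℝ) : ℂ) ∧
      Real.exp (-2) * Real.exp (2 * Real.pi * |w.im|) / (1 + |w.im|) ≤ ‖g‖ ^ 2 := by
  set k : ℝ → ℂ := fun ω => (starRingEnd ℂ) (Complex.exp (Complex.I * (ω : ℂ) * w)) with hk
  have hkc : Continuous k := by
    rw [hk]
    exact Complex.continuous_conj.comp (by fun_prop)
  have hkm : MemLp k 2 (bandMeasure Real.pi) := memLp_bandMeasure_of_continuous hkc 2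
  have hk2 : ∀ ω : ℝ, ‖k ω‖ ^ 2 = Real.exp (-(2 * (ω * w.im))) := by
    intro ω
    simp only [hk, Complex.norm_conj, norm_exp_I_mul, ← Real.exp_nat_mul]
    congr 1
    push_cast
    ring
  have hnorm : ‖hkm.toLp k‖ ^ 2 = ∫ ω in Set.Icc (-Real.pi) Real.pi,
      Real.exp (-(2 * (ω * w.im))) := by
    rw [norm_sq_eq_integral_Lp]
    refine integral_congr_ae ?_
    filter_upwards [hkm.coeFn_toLp] with ω hω
    rw [hω, hk2]
  refine ⟨hkm.toLp k, ?_, ?_⟩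
  · rw [fourierSynthesis_toLp, hnorm]
    unfold fourierSynthesis
    have e : ∀ ω : ℝ, k ω * Complex.exp (Complex.I * (ω : ℂ) * w) =
        ((Real.exp (-(2 * (ω * w.im))) : ℝ) : ℂ) := by
      intro ω
      rw [← hk2]
      simp only [hk, Complex.norm_conj]
      rw [mul_comm, Complex.mul_conj, Complex.normSq_eq_norm_sq]
    simp_rw [e]
    rw [integral_complex_ofReal]
    push_cast
    ring
  · rw [hnorm]
    set a : ℝ := 1 / (1 + |w.im|) with ha
    have hapos : 0 < a := by positivity
    have ha1 : a ≤ 1 := by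
      rw [ha, div_le_one (by positivity)]
      linarith [abs_nonneg w.im]
    have hay : a * |w.im| ≤ 1 := by
      rw [ha, div_mul_eq_mul_div, one_mul, div_le_one (by positivity)]
      linarith
    have hpi := Real.pi_gt_three
    -- the exponential is largest at the end of the band opposite to the sign of `Im w`
    obtain ⟨p, hp, hpe⟩ : ∃ p : ℝ, Set.Icc p (p + a) ⊆ Set.Icc (-Real.pi) Real.pi ∧
        ∀ ω ∈ Set.Icc p (p + a), 2 * Real.pi * |w.im| - 2 ≤ -(2 * (ω * w.im)) := by
      rcases le_total 0 w.im with h | h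
      · refine ⟨-Real.pi, Set.Icc_subset_Icc le_rfl (by linarith), fun ω hω => ?_⟩
        rw [abs_of_nonneg h] at hay ⊢
        nlinarith [hω.2, mul_le_mul_of_nonneg_right hω.2 h]
      · refine ⟨Real.pi - a, Set.Icc_subset_Icc (by linarith) (by linarith), fun ω hω => ?_⟩
        rw [abs_of_nonpos h] at hay ⊢
        nlinarith [hω.1, mul_le_mul_of_nonneg_right hω.1 (neg_nonneg.2 h)]
    have hcont : Continuous fun ω : ℝ => Real.exp (-(2 * (ω * w.im))) := by fun_prop
    have hint : IntegrableOn (fun ω : ℝ => Real.exp (-(2 * (ω * w.im))))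
        (Set.Icc (-Real.pi) Real.pi) := hcont.continuousOn.integrableOn_compact isCompact_Icc
    calc Real.exp (-2) * Real.exp (2 * Real.pi * |w.im|) / (1 + |w.im|)
        = ∫ ω in Set.Icc p (p + a), Real.exp (2 * Real.pi * |w.im| - 2) := by
          rw [setIntegral_const, Real.volume_real_Icc_of_le (by linarith), smul_eq_mul,
            sub_eq_add_neg (2 * Real.pi * |w.im|), Real.exp_add, ha]
          ring
      _ ≤ ∫ ω in Set.Icc p (p + a), Real.exp (-(2 * (ω * w.im))) :=
          setIntegral_mono_on (integrableOn_const measure_Icc_lt_top.ne) (hint.mono_set hp) measurableSet_Icc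
            fun ω hω => Real.exp_le_exp.2 (hpe ω hω)
      _ ≤ _ := setIntegral_mono_set hint (Eventually.of_forall fun ω => (Real.exp_pos _).le)
          (Eventually.of_forall hp)

section Sampling

variable {Λ : ℤ → ℂ} {T : Lp ℂ 2 (bandMeasure Real.pi) ≃L[ℂ] lp (fun _ : ℤ => ℂ) 2}

theorem norm_fourierSynthesis_sample_le (hT : ∀ g n, T g n = fourierSynthesis Real.pi g (Λ n))
    (g : Lp ℂ 2 (bandMeasure Real.pi)) (n : ℤ) :
    ‖fourierSynthesis Real.pi g (Λ n)‖ ≤ ‖T.toContinuousLinearMap‖ * ‖g‖ := by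
  rw [← hT]
  exact (lp.norm_apply_le_norm (by norm_num) _ _).trans
    (T.toContinuousLinearMap.le_opNorm g)

/-- A sampling sequence lies in a horizontal strip, since point evaluations are uniformly bounded
on it. -/
theorem exists_im_bound (hT : ∀ g n, T g n = fourierSynthesis Real.pi g (Λ n)) :
    ∃ B : ℝ, 0 < B ∧ ∀ n, |(Λ n).im| ≤ B := by
  set K := ‖T.toContinuousLinearMap‖ with hK
  have hpi := Real.pi_gt_three
  refine ⟨(2 * Real.pi * K) ^ 2 * Real.exp 2 + 1, by positivity, fun n => ?_⟩
  obtain ⟨g, h1, h2⟩ := exists_reproducing (Λ n)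
  have h3 := norm_fourierSynthesis_sample_le hT g n
  rw [h1, Complex.norm_real, Real.norm_eq_abs, abs_of_nonneg (by positivity), ← hK] at h3
  set y := |(Λ n).im| with hy
  have hy0 : 0 ≤ y := abs_nonneg _
  have hgpos : 0 < ‖g‖ := by
    have : 0 < ‖g‖ ^ 2 := lt_of_lt_of_le (by positivity) h2
    exact norm_pos_iff.2 fun h => by simp [h] at this
  have h4 : ‖g‖ ≤ 2 * Real.pi * K := by
    rw [div_le_iff₀ (by positivity), sq] at h3
    have : ‖g‖ * ‖g‖ ≤ (2 * Real.pi * K) * ‖g‖ := by linarith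
    exact le_of_mul_le_mul_right this hgpos
  have h5 : ‖g‖ ^ 2 ≤ (2 * Real.pi * K) ^ 2 := by gcongr
  have h6 : (1 + y) ^ 2 ≤ Real.exp (2 * Real.pi * y) := by
    have h7 : 1 + y ≤ Real.exp y := by linarith [Real.add_one_le_exp y]
    calc (1 + y) ^ 2 ≤ Real.exp y ^ 2 := by gcongr
      _ = Real.exp (2 * y) := by rw [← Real.exp_nat_mul]; norm_num
      _ ≤ Real.exp (2 * Real.pi * y) := by
        apply Real.exp_le_exp.2
        nlinarith
  have h7 : Real.exp (-2) * (1 + y) ≤ (2 * Real.pi * K) ^ 2 := by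
    refine le_trans ?_ (h2.trans h5)
    rw [le_div_iff₀ (by positivity)]
    nlinarith [Real.exp_pos (-2)]
  rw [Real.exp_neg, inv_mul_le_iff₀ (Real.exp_pos 2)] at h7
  linarith

/-- The spectrum of the function in `PW^2_π` that takes the value `1` at `Λ n` and vanishes at the
other points of the sequence. -/
noncomputable def dualSpectrum
    (T : Lp ℂ 2 (bandMeasure Real.pi) ≃L[ℂ] lp (fun _ : ℤ => ℂ) 2) (n : ℤ) :
    Lp ℂ 2 (bandMeasure Real.pi) :=
  T.symm (lp.single 2 n 1)

theorem fourierSynthesis_dualSpectrum (hT : ∀ g n, T g n = fourierSynthesis Real.pi g (Λ n))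
    (n m : ℤ) :
    fourierSynthesis Real.pi (dualSpectrum T n) (Λ m) = if m = n then 1 else 0 := by
  rw [← hT, dualSpectrum, ContinuousLinearEquiv.apply_symm_apply, lp.single_apply]
  split_ifs with h
  · subst h; simp
  · simp [h]

theorem norm_sq_sum_single (I : Finset ℤ) :
    ‖∑ n ∈ I, (lp.single 2 n 1 : lp (fun _ : ℤ => ℂ) 2)‖ ^ 2 = I.card := by
  have h := lp.norm_sum_single (E := fun _ : ℤ => ℂ) (p := 2) (by norm_num) (fun _ => (1 : ℂ)) I
  simp only [ENNReal.toReal_ofNat, Real.rpow_two, norm_one, one_pow, Finset.sum_const,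
    nsmul_eq_mul, mul_one] at h
  exact h

theorem norm_sq_sum_dualSpectrum_le (I : Finset ℤ) :
    ‖∑ n ∈ I, dualSpectrum T n‖ ^ 2 ≤
      ‖T.symm.toContinuousLinearMap‖ ^ 2 * I.card := by
  rw [← norm_sq_sum_single I, ← mul_pow]
  gcongr
  simp only [dualSpectrum]
  rw [← map_sum]
  exact T.symm.toContinuousLinearMap.le_opNorm _

/-- The exponentials at a sampling sequence form a Bessel system: this is the boundedness of the
adjoint of the sampling operator. -/
theorem integral_norm_sq_sum_exp_le (hT : ∀ g n, T g n = fourierSynthesis Real.pi g (Λ n))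
    (I : Finset ℤ) :
    ∫ ω, ‖∑ n ∈ I, Complex.exp (Complex.I * (ω : ℂ) * Λ n)‖ ^ 2 ∂(bandMeasure Real.pi) ≤
      (2 * Real.pi * ‖T.toContinuousLinearMap‖) ^ 2 * I.card := by
  set E : ℝ → ℂ := fun ω => ∑ n ∈ I, Complex.exp (Complex.I * (ω : ℂ) * Λ n) with hE
  have hEc : Continuous E := by fun_prop
  have hcE : Continuous fun ω => (starRingEnd ℂ) (E ω) := Complex.continuous_conj.comp hEc
  have hum : MemLp (fun ω => (starRingEnd ℂ) (E ω)) 2 (bandMeasure Real.pi) :=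
    memLp_bandMeasure_of_continuous hcE 2
  set u := hum.toLp _ with hu
  have hu2 : ‖u‖ ^ 2 = ∫ ω, ‖E ω‖ ^ 2 ∂(bandMeasure Real.pi) := by
    rw [norm_sq_eq_integral_Lp]
    refine integral_congr_ae ?_
    filter_upwards [hum.coeFn_toLp] with ω hω
    rw [hω, Complex.norm_conj]
  have h1 : ((‖u‖ ^ 2 : ℝ) : ℂ) = 2 * Real.pi * ∑ n ∈ I, T u n := by
    rw [hu2, ← integral_complex_ofReal]
    have e : ∀ n, 2 * (Real.pi : ℂ) * T u n =
        ∫ ω, (starRingEnd ℂ) (E ω) * Complex.exp (Complex.I * (ω : ℂ) * Λ n)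
          ∂(bandMeasure Real.pi) := by
      intro n
      rw [hT, fourierSynthesis_toLp]
      unfold fourierSynthesis
      rw [← mul_assoc, mul_one_div_cancel (by simp [Real.pi_ne_zero]), one_mul]
    rw [Finset.mul_sum, Finset.sum_congr rfl fun n _ => e n, ← integral_finsetSum]
    · refine integral_congr_ae (Eventually.of_forall fun ω => ?_)
      simp only
      rw [← Finset.mul_sum, mul_comm, Complex.mul_conj, Complex.normSq_eq_norm_sq]
    · exact fun n _ => integrable_mul_exp (hum.integrable (by norm_num)) _
  set K := ‖T.toContinuousLinearMap‖ with hK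
  have h2 : ‖∑ n ∈ I, T u n‖ ≤ Real.sqrt I.card * (K * ‖u‖) := by
    have h4 : ∑ n ∈ I, T u n =
        inner ℂ (∑ n ∈ I, (lp.single 2 n 1 : lp (fun _ : ℤ => ℂ) 2)) (T u) := by
      rw [sum_inner]
      refine Finset.sum_congr rfl fun n _ => ?_
      rw [lp.inner_single_left]
      simp
    rw [h4]
    refine (norm_inner_le_norm _ _).trans ?_
    have h5 : ‖∑ n ∈ I, (lp.single 2 n 1 : lp (fun _ : ℤ => ℂ) 2)‖ = Real.sqrt I.card := by
      rw [← norm_sq_sum_single I, Real.sqrt_sq (norm_nonneg _)]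
    rw [h5]
    gcongr
    exact T.toContinuousLinearMap.le_opNorm u
  have h6 : ‖u‖ ^ 2 ≤ 2 * Real.pi * (Real.sqrt I.card * (K * ‖u‖)) := by
    have := congrArg norm h1
    rw [Complex.norm_real, Real.norm_eq_abs, abs_of_nonneg (by positivity)] at this
    rw [this]
    simp only [norm_mul, Complex.norm_ofNat, Complex.norm_real, Real.norm_eq_abs,
      abs_of_pos Real.pi_pos]
    gcongr
  rw [← hu2]
  have hpi := Real.pi_pos
  rcases eq_or_ne ‖u‖ 0 with h0 | h0
  · rw [h0, zero_pow two_ne_zero]; positivity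
  have hupos : 0 < ‖u‖ := lt_of_le_of_ne (norm_nonneg _) (Ne.symm h0)
  have h7 : ‖u‖ ≤ 2 * Real.pi * K * Real.sqrt I.card := by
    refine le_of_mul_le_mul_right ?_ hupos
    nlinarith
  calc ‖u‖ ^ 2 ≤ (2 * Real.pi * K * Real.sqrt I.card) ^ 2 := by gcongr
    _ = _ := by rw [mul_pow, Real.sq_sqrt (Nat.cast_nonneg _)]

/-- The `L¹` norms of the partial sums of the dual spectra are unbounded. The sum `D` of the dual
spectra over a set `I` of `2 * L` indices is tested against `E = ∑_{m ∈ I} e^{iωλₘ}`: by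
biorthogonality `∫ D E = 2π |I|`, both squared norms are of order `L`, and `|E|` is at most of order
`L` because the sequence lies in a strip. So the differences of the partial sums satisfy the
assumption of `false_of_differences_large`. -/
theorem not_exists_bound_integral_norm_sum_dualSpectrum
    (hT : ∀ g n, T g n = fourierSynthesis Real.pi g (Λ n)) :
    ¬ ∃ M : ℝ, ∀ N : ℕ, ∫ ω, ‖(∑ n ∈ Finset.Icc (-(N : ℤ)) N, dualSpectrum T n :
      Lp ℂ 2 (bandMeasure Real.pi)) ω‖ ∂(bandMeasure Real.pi) ≤ M := by
  rintro ⟨M, hM⟩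
  have hpi := Real.pi_pos
  obtain ⟨B, hB, hBΛ⟩ := exists_im_bound hT
  set S : ℕ → Lp ℂ 2 (bandMeasure Real.pi) := fun N =>
    ∑ n ∈ Finset.Icc (-(N : ℤ)) N, dualSpectrum T n with hS
  have hSi : ∀ n, Integrable (S n) (bandMeasure Real.pi) := fun n => integrable_Lp_two _
  have hM0 : 0 ≤ M := (integral_nonneg fun ω => norm_nonneg _).trans (hM 0)
  set K := ‖T.toContinuousLinearMap‖ with hK
  set K' := ‖T.symm.toContinuousLinearMap‖ with hK'
  set C := 2 * (Real.exp (Real.pi * B) + (2 * Real.pi * K) ^ 2 + K' ^ 2) with hC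
  have hCpos : 0 < C := by positivity
  refine false_of_differences_large (s := fun n => S n)
    (c := (4 * Real.pi) ^ 2 / (16 * (2 * M + 1) * C)) (c' := (4 * Real.pi) ^ 2 / (2 * C ^ 3))
    (by positivity) (by positivity) hSi (fun n => Lp.stronglyMeasurable _) hM ?_
  intro n L hL
  set I : Finset ℤ := Finset.Icc (-((n + L : ℕ) : ℤ)) ((n + L : ℕ) : ℤ) \ Finset.Icc (-(n : ℤ)) n
    with hI
  have hsub : Finset.Icc (-(n : ℤ)) n ⊆ Finset.Icc (-((n + L : ℕ) : ℤ)) ((n + L : ℕ) : ℤ) :=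
    Finset.Icc_subset_Icc (by push_cast; omega) (by push_cast; omega)
  have hcard : I.card = 2 * L := by
    rw [hI, Finset.card_sdiff_of_subset hsub, Int.card_Icc, Int.card_Icc]
    omega
  have hcardR : (I.card : ℝ) = 2 * L := by rw [hcard]; push_cast; ring
  have hLpos : (0 : ℝ) < L := by exact_mod_cast hL
  have hdiff : S (n + L) - S n = ∑ k ∈ I, dualSpectrum T k := by
    rw [hS, hI, Finset.sum_sdiff_eq_sub hsub]
  have hae : (fun ω => S (n + L) ω - S n ω) =ᵐ[bandMeasure Real.pi]
      (∑ k ∈ I, dualSpectrum T k : Lp ℂ 2 (bandMeasure Real.pi)) := by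
    rw [← hdiff]
    exact (Lp.coeFn_sub _ _).symm
  set E : ℝ → ℂ := fun ω => ∑ m ∈ I, Complex.exp (Complex.I * (ω : ℂ) * Λ m) with hE
  have hEc : Continuous E := by fun_prop
  refine measureReal_large_ge (E := E) hCpos (by positivity) (by positivity) hLpos
    ((Lp.memLp _).sub (Lp.memLp _)) ?_ ((Lp.stronglyMeasurable _).sub (Lp.stronglyMeasurable _))
    ?_ ?_ ?_ ?_ ?_
  · exact memLp_bandMeasure_of_continuous hEc 2
  · refine (ae_restrict_iff' measurableSet_Icc).2 (Eventually.of_forall fun ω hω => ?_)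
    calc ‖E ω‖ ≤ ∑ m ∈ I, Real.exp (Real.pi * B) := by
          refine norm_sum_le_of_le _ fun m _ => (norm_exp_I_mul_le hω _).trans ?_
          apply Real.exp_le_exp.2
          gcongr
          exact hBΛ m
      _ = 2 * Real.exp (Real.pi * B) * L := by
          rw [Finset.sum_const, nsmul_eq_mul, hcardR]; ring
      _ ≤ C * L := by
          gcongr
          rw [hC]
          nlinarith [sq_nonneg (2 * Real.pi * K), sq_nonneg K']
  · refine (integral_norm_sq_sum_exp_le hT I).trans ?_
    rw [hcardR, ← hK, hC]
    nlinarith [mul_nonneg hLpos.le (sq_nonneg K'), mul_pos hLpos (Real.exp_pos (Real.pi * B))]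
  · have e : ∫ ω, ‖S (n + L) ω - S n ω‖ ^ 2 ∂(bandMeasure Real.pi) =
        ‖∑ k ∈ I, dualSpectrum T k‖ ^ 2 := by
      rw [norm_sq_eq_integral_Lp]
      exact integral_congr_ae (hae.mono fun ω hω => by simp only at hω ⊢; rw [hω])
    rw [e]
    refine (norm_sq_sum_dualSpectrum_le I).trans ?_
    rw [hcardR, ← hK', hC]
    nlinarith [mul_nonneg hLpos.le (sq_nonneg (2 * Real.pi * K)),
      mul_pos hLpos (Real.exp_pos (Real.pi * B))]
  · calc ∫ ω, ‖S (n + L) ω - S n ω‖ ∂(bandMeasure Real.pi)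
        ≤ ∫ ω, (‖S (n + L) ω‖ + ‖S n ω‖) ∂(bandMeasure Real.pi) :=
          integral_mono ((hSi _).sub (hSi _)).norm ((hSi _).norm.add (hSi _).norm)
            fun ω => norm_sub_le _ _
      _ = (∫ ω, ‖S (n + L) ω‖ ∂(bandMeasure Real.pi)) + ∫ ω, ‖S n ω‖ ∂(bandMeasure Real.pi) :=
          integral_add (hSi _).norm (hSi _).norm
      _ ≤ 2 * M + 1 := by linarith [hM (n + L), hM n]
  · have e : ∫ ω, (S (n + L) ω - S n ω) * E ω ∂(bandMeasure Real.pi) =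
        2 * Real.pi * I.card := by
      have e1 : ∫ ω, (S (n + L) ω - S n ω) * E ω ∂(bandMeasure Real.pi) =
          ∫ ω, ∑ m ∈ I, (∑ k ∈ I, dualSpectrum T k : Lp ℂ 2 (bandMeasure Real.pi)) ω *
            Complex.exp (Complex.I * (ω : ℂ) * Λ m) ∂(bandMeasure Real.pi) := by
        refine integral_congr_ae (hae.mono fun ω hω => ?_)
        simp only at hω ⊢
        rw [hω, hE, Finset.mul_sum]
      rw [e1, integral_finsetSum _ fun m _ => integrable_mul_exp (integrable_Lp_two _) _]
      have e2 : ∀ m ∈ I, ∫ ω, (∑ k ∈ I, dualSpectrum T k : Lp ℂ 2 (bandMeasure Real.pi)) ω *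
            Complex.exp (Complex.I * (ω : ℂ) * Λ m) ∂(bandMeasure Real.pi) = 2 * Real.pi := by
        intro m hm
        have e3 : fourierSynthesis Real.pi
            (∑ k ∈ I, dualSpectrum T k : Lp ℂ 2 (bandMeasure Real.pi)) (Λ m) = 1 := by
          rw [← evalSpectrum_apply, map_sum]
          simp only [evalSpectrum_apply, fourierSynthesis_dualSpectrum hT]
          rw [Finset.sum_ite_eq I m, if_pos hm]
        unfold fourierSynthesis at e3
        have hpi' : (Real.pi : ℂ) ≠ 0 := by exact_mod_cast Real.pi_ne_zero
        rw [one_div, inv_mul_eq_one₀ (by simp [hpi'])] at e3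
        exact e3.symm
      rw [Finset.sum_congr rfl e2, Finset.sum_const, nsmul_eq_mul]
      ring
    rw [e]
    have e4 : (2 * (Real.pi : ℂ) * I.card) = ((2 * Real.pi * I.card : ℝ) : ℂ) := by push_cast; ring
    rw [e4, Complex.norm_real, Real.norm_eq_abs, abs_of_nonneg (by positivity), hcardR]
    linarith

end Sampling

/-! ### Growth of the generating function -/

section GeneratingFunction

variable {Λ : ℤ → ℂ} {T : Lp ℂ 2 (bandMeasure Real.pi) ≃L[ℂ] lp (fun _ : ℤ => ℂ) 2}

/-- The function `(z - λ₀) f₀(z)`, where `f₀ ∈ PW^2_π` is `1` at `λ₀` and vanishes at the other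
points of the sequence. It is the generating function up to a constant factor. -/
noncomputable def canonicalFunction (Λ : ℤ → ℂ)
    (T : Lp ℂ 2 (bandMeasure Real.pi) ≃L[ℂ] lp (fun _ : ℤ => ℂ) 2) (z : ℂ) : ℂ :=
  (z - Λ 0) * fourierSynthesis Real.pi (dualSpectrum T 0) z

theorem eq_zero_of_samples (hT : ∀ g n, T g n = fourierSynthesis Real.pi g (Λ n))
    {g : Lp ℂ 2 (bandMeasure Real.pi)} (h : ∀ n, fourierSynthesis Real.pi g (Λ n) = 0) : g = 0 := by
  rw [← T.map_eq_zero_iff]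
  ext n
  rw [hT, h n]
  rfl

theorem injective_of_sampling (hT : ∀ g n, T g n = fourierSynthesis Real.pi g (Λ n)) :
    Function.Injective Λ := by
  intro n m h
  by_contra hnm
  have h1 := fourierSynthesis_dualSpectrum hT n n
  have h2 := fourierSynthesis_dualSpectrum hT n m
  rw [if_pos rfl] at h1
  rw [if_neg (Ne.symm hnm), ← h, h1] at h2
  exact one_ne_zero h2

theorem differentiable_canonicalFunction : Differentiable ℂ (canonicalFunction Λ T) :=
  (differentiable_id.sub_const _).mul (differentiable_fourierSynthesis (integrable_Lp_two _))

theorem canonicalFunction_apply_sample (hT : ∀ g n, T g n = fourierSynthesis Real.pi g (Λ n))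
    (n : ℤ) : canonicalFunction Λ T (Λ n) = 0 := by
  rw [canonicalFunction, fourierSynthesis_dualSpectrum hT]
  split_ifs with h
  · rw [h, sub_self, zero_mul]
  · rw [mul_zero]

theorem canonicalFunction_ne_zero_fun (hT : ∀ g n, T g n = fourierSynthesis Real.pi g (Λ n)) :
    ∃ z, canonicalFunction Λ T z ≠ 0 := by
  by_contra! h
  have h1 : HasDerivAt (canonicalFunction Λ T)
      (1 * fourierSynthesis Real.pi (dualSpectrum T 0) (Λ 0) +
        (Λ 0 - Λ 0) * deriv (fourierSynthesis Real.pi (dualSpectrum T 0)) (Λ 0)) (Λ 0) :=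
    ((hasDerivAt_id (Λ 0)).sub_const (Λ 0)).mul
      (differentiable_fourierSynthesis (integrable_Lp_two _) (Λ 0)).hasDerivAt
  have h2 : canonicalFunction Λ T = fun _ => 0 := funext h
  rw [h2] at h1
  have h3 := h1.unique (hasDerivAt_const _ _)
  rw [fourierSynthesis_dualSpectrum hT, if_pos rfl, sub_self, zero_mul] at h3
  norm_num at h3

/-- Division in `PW^2_π` by a linear factor, with the spectrum as an element of `L²`. -/
theorem exists_Lp_div_sub {σ : ℝ} (g : Lp ℂ 2 (bandMeasure σ)) {μ : ℂ}
    (h0 : fourierSynthesis σ g μ = 0) :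
    ∃ h : Lp ℂ 2 (bandMeasure σ),
      ∀ z, (z - μ) * fourierSynthesis σ h z = fourierSynthesis σ g z := by
  obtain ⟨h, hm, hh⟩ := exists_fourierSynthesis_div_sub (Lp.memLp g) h0
  exact ⟨hm.toLp h, fun z => by rw [fourierSynthesis_toLp, hh]⟩

theorem canonicalFunction_ne_zero (hT : ∀ g n, T g n = fourierSynthesis Real.pi g (Λ n))
    {w : ℂ} (hw : ∀ n, w ≠ Λ n) : canonicalFunction Λ T w ≠ 0 := by
  intro h
  have h0 : fourierSynthesis Real.pi (dualSpectrum T 0) w = 0 :=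
    (mul_eq_zero.1 h).resolve_left (sub_ne_zero.2 (hw 0))
  obtain ⟨k, hk⟩ := exists_Lp_div_sub _ h0
  -- `(z - λ₀) f₀(z) / (z - w)` is in `PW^2_π` and vanishes on the whole sequence
  set q := dualSpectrum T 0 + (w - Λ 0) • k with hq
  have hqz : ∀ z, (z - w) * fourierSynthesis Real.pi q z = canonicalFunction Λ T z := by
    intro z
    rw [hq, ← evalSpectrum_apply, map_add, map_smul, evalSpectrum_apply, evalSpectrum_apply,
      canonicalFunction, smul_eq_mul]
    linear_combination (w - Λ 0) * hk z
  have hq0 : q = 0 := by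
    refine eq_zero_of_samples hT fun n => ?_
    have := hqz (Λ n)
    rw [canonicalFunction_apply_sample hT] at this
    exact (mul_eq_zero.1 this).resolve_left (sub_ne_zero.2 (Ne.symm (hw n)))
  obtain ⟨z, hz⟩ := canonicalFunction_ne_zero_fun hT
  apply hz
  rw [← hqz, hq0, ← evalSpectrum_apply, map_zero, mul_zero]

/-- The zeros of the generating function are simple, and dividing out one of them gives a multiple
of the corresponding interpolating function. -/
theorem exists_canonicalFunction_eq (hT : ∀ g n, T g n = fourierSynthesis Real.pi g (Λ n))
    (n : ℤ) : ∃ c : ℂ, c ≠ 0 ∧ ∀ z, canonicalFunction Λ T z =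
      (z - Λ n) * (c * fourierSynthesis Real.pi (dualSpectrum T n) z) := by
  obtain ⟨q, hq⟩ : ∃ q : Lp ℂ 2 (bandMeasure Real.pi),
      ∀ z, canonicalFunction Λ T z = (z - Λ n) * fourierSynthesis Real.pi q z := by
    rcases eq_or_ne n 0 with rfl | hn
    · exact ⟨dualSpectrum T 0, fun z => rfl⟩
    · have h0 : fourierSynthesis Real.pi (dualSpectrum T 0) (Λ n) = 0 := by
        rw [fourierSynthesis_dualSpectrum hT, if_neg hn]
      obtain ⟨k, hk⟩ := exists_Lp_div_sub _ h0
      refine ⟨dualSpectrum T 0 + (Λ n - Λ 0) • k, fun z => ?_⟩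
      rw [← evalSpectrum_apply, map_add, map_smul, evalSpectrum_apply, evalSpectrum_apply,
        canonicalFunction, smul_eq_mul]
      linear_combination -(Λ n - Λ 0) * hk z
  have hqn : q = fourierSynthesis Real.pi q (Λ n) • dualSpectrum T n := by
    rw [← sub_eq_zero]
    refine eq_zero_of_samples hT fun m => ?_
    rw [← evalSpectrum_apply, map_sub, map_smul, evalSpectrum_apply, evalSpectrum_apply,
      fourierSynthesis_dualSpectrum hT, smul_eq_mul]
    split_ifs with h
    · rw [h, mul_one, sub_self]
    · rw [mul_zero, sub_zero]
      have := hq (Λ m)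
      rw [canonicalFunction_apply_sample hT, eq_comm] at this
      exact (mul_eq_zero.1 this).resolve_left
        (sub_ne_zero.2 fun h' => h (injective_of_sampling hT h'))
  have hfs : ∀ z, fourierSynthesis Real.pi q z =
      fourierSynthesis Real.pi q (Λ n) * fourierSynthesis Real.pi (dualSpectrum T n) z := by
    intro z
    conv_lhs => rw [hqn]
    rw [← evalSpectrum_apply, map_smul, evalSpectrum_apply, smul_eq_mul]
  refine ⟨fourierSynthesis Real.pi q (Λ n), fun h0 => ?_, fun z => by rw [hq z, hfs z]⟩
  obtain ⟨z, hz⟩ := canonicalFunction_ne_zero_fun hT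
  apply hz
  rw [hq, hfs, h0, zero_mul, mul_zero]

theorem exists_canonicalFunction_upper :
    ∃ C : ℝ, 0 < C ∧ ∀ w, ‖canonicalFunction Λ T w‖ ≤
      C * (1 + ‖w‖) * Real.exp (Real.pi * |w.im|) := by
  refine ⟨(1 + ‖Λ 0‖) * (Real.sqrt (2 * |Real.pi|) * ‖dualSpectrum T 0‖ + 1), by positivity,
    fun w => ?_⟩
  rw [canonicalFunction, norm_mul]
  have h1 : ‖w - Λ 0‖ ≤ (1 + ‖Λ 0‖) * (1 + ‖w‖) := by
    have := norm_sub_le w (Λ 0)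
    nlinarith [norm_nonneg w, norm_nonneg (Λ 0), mul_nonneg (norm_nonneg w) (norm_nonneg (Λ 0))]
  have h2 := norm_fourierSynthesis_Lp_le (dualSpectrum T 0) w
  have h3 : ‖fourierSynthesis Real.pi (dualSpectrum T 0) w‖ ≤
      (Real.sqrt (2 * |Real.pi|) * ‖dualSpectrum T 0‖ + 1) * Real.exp (Real.pi * |w.im|) := by
    nlinarith [Real.exp_pos (Real.pi * |w.im|)]
  calc _ ≤ ((1 + ‖Λ 0‖) * (1 + ‖w‖)) * ((Real.sqrt (2 * |Real.pi|) * ‖dualSpectrum T 0‖ + 1) *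
        Real.exp (Real.pi * |w.im|)) := by gcongr
    _ = _ := by ring

/-- The lower bound for the generating function off its zeros. For `f ∈ PW^2_π`, multiplying the
samples of `f` by `(z₀ - λₙ) / (w - λₙ)` gives the samples of a function whose value at `z₀` is
`f(w) φ(z₀) / φ(w)`; the stability of interpolation bounds this value in terms of the norm of `f`,
and `f` is taken to be the reproducing kernel at `w`. -/
theorem exists_canonicalFunction_lower (hT : ∀ g n, T g n = fourierSynthesis Real.pi g (Λ n)) :
    ∃ C : ℝ, 0 < C ∧ ∀ w d, 0 < d → d ≤ 1 → (∀ n, d ≤ ‖w - Λ n‖) →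
      d * Real.exp (Real.pi * |w.im|) ≤ C * (1 + ‖w‖) ^ 2 * ‖canonicalFunction Λ T w‖ := by
  obtain ⟨z₀, hz₀⟩ := canonicalFunction_ne_zero_fun hT
  set K := ‖T.toContinuousLinearMap‖ with hK
  set K' := ‖T.symm.toContinuousLinearMap‖ with hK'
  set Z := Real.sqrt (2 * |Real.pi|) * Real.exp (Real.pi * |z₀.im|) with hZ
  have hZ0 : 0 ≤ Z := by positivity
  have hφ₀ : 0 < ‖canonicalFunction Λ T z₀‖ := norm_pos_iff.2 hz₀
  -- the stability estimate for an arbitrary function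
  have key : ∀ w d, 0 < d → d ≤ 1 → (∀ n, d ≤ ‖w - Λ n‖) → ∀ g : Lp ℂ 2 (bandMeasure Real.pi),
      ‖fourierSynthesis Real.pi g w‖ * ‖canonicalFunction Λ T z₀‖ * d ≤
        ‖canonicalFunction Λ T w‖ * (Z * (K' * K + 1) * ((1 + ‖z₀‖) * (1 + ‖w‖)) * ‖g‖) := by
    intro w d hd hd1 hdist g
    have hw : ∀ n, w ≠ Λ n := by
      rintro n rfl
      have := hdist n
      rw [sub_self, norm_zero] at this
      linarith
    have hφw : canonicalFunction Λ T w ≠ 0 := canonicalFunction_ne_zero hT hw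
    have hbig : 1 ≤ (1 + ‖z₀‖) * (1 + ‖w‖) := by
      nlinarith [norm_nonneg z₀, norm_nonneg w, mul_nonneg (norm_nonneg z₀) (norm_nonneg w)]
    have hKK : 0 ≤ K' * K := by positivity
    rcases eq_or_ne w z₀ with rfl | hwz
    · have h1 := norm_fourierSynthesis_Lp_le g w
      rw [← hZ] at h1
      rw [mul_comm ‖fourierSynthesis Real.pi g w‖, mul_assoc]
      refine mul_le_mul_of_nonneg_left ?_ (norm_nonneg _)
      calc ‖fourierSynthesis Real.pi g w‖ * d ≤ (Z * ‖g‖) * 1 := by gcongr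
        _ ≤ (Z * ‖g‖) * ((K' * K + 1) * ((1 + ‖w‖) * (1 + ‖w‖))) := by
          gcongr
          nlinarith
        _ = Z * (K' * K + 1) * ((1 + ‖w‖) * (1 + ‖w‖)) * ‖g‖ := by ring
    set κ : ℂ := (w - z₀) * fourierSynthesis Real.pi g w / canonicalFunction Λ T w with hκ
    set b := (z₀ - w) • g + (κ * (w - Λ 0)) • dualSpectrum T 0 with hb
    have hbz : ∀ z, fourierSynthesis Real.pi b z = (z₀ - w) * fourierSynthesis Real.pi g z +
        κ * (w - Λ 0) * fourierSynthesis Real.pi (dualSpectrum T 0) z := by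
      intro z
      rw [hb, ← evalSpectrum_apply, map_add, map_smul, map_smul]
      simp only [evalSpectrum_apply, smul_eq_mul]
    have hbw : fourierSynthesis Real.pi b w = 0 := by
      have e : κ * canonicalFunction Λ T w = (w - z₀) * fourierSynthesis Real.pi g w :=
        div_mul_cancel₀ _ hφw
      rw [hbz]
      rw [canonicalFunction] at e
      linear_combination e
    obtain ⟨h, hh⟩ := exists_Lp_div_sub b hbw
    set f := g - κ • dualSpectrum T 0 - h with hf
    have hfz : ∀ z, (w - z) * fourierSynthesis Real.pi f z =
        (z₀ - z) * fourierSynthesis Real.pi g z + κ * canonicalFunction Λ T z := by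
      intro z
      have e1 : fourierSynthesis Real.pi f z = fourierSynthesis Real.pi g z -
          κ * fourierSynthesis Real.pi (dualSpectrum T 0) z - fourierSynthesis Real.pi h z := by
        rw [hf, ← evalSpectrum_apply, map_sub, map_sub, map_smul]
        simp only [evalSpectrum_apply, smul_eq_mul]
      have e2 := hh z
      rw [hbz] at e2
      rw [e1, canonicalFunction]
      linear_combination e2
    have hfz₀ : fourierSynthesis Real.pi f z₀ * canonicalFunction Λ T w =
        fourierSynthesis Real.pi g w * canonicalFunction Λ T z₀ := by
      have e := hfz z₀
      rw [sub_self, zero_mul, zero_add, hκ] at e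
      have hne : w - z₀ ≠ 0 := sub_ne_zero.2 hwz
      have e' : (w - z₀) * (fourierSynthesis Real.pi f z₀ * canonicalFunction Λ T w) =
          (w - z₀) * (fourierSynthesis Real.pi g w * canonicalFunction Λ T z₀) := by
        rw [← mul_assoc, e]
        field_simp
      exact mul_left_cancel₀ hne e'
    set m := (1 + ‖z₀‖) * (1 + ‖w‖) / d with hm
    have hm0 : 0 ≤ m := by positivity
    have hsamples : ∀ n, ‖T f n‖ ≤ ‖((m : ℂ) • T g) n‖ := by
      intro n
      have e := hfz (Λ n)
      rw [canonicalFunction_apply_sample hT, mul_zero, add_zero] at e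
      have hn : 0 < ‖w - Λ n‖ := hd.trans_le (hdist n)
      have e' := congrArg norm e
      rw [norm_mul, norm_mul] at e'
      rw [lp.coeFn_smul, Pi.smul_apply, norm_smul, Complex.norm_real, Real.norm_eq_abs,
        abs_of_nonneg hm0, hT, hT]
      refine le_of_mul_le_mul_left ?_ hn
      rw [e', ← mul_assoc]
      gcongr
      have h1 : ‖z₀ - Λ n‖ ≤ ‖z₀‖ + ‖w‖ + ‖w - Λ n‖ := by
        calc ‖z₀ - Λ n‖ = ‖(z₀ - w) + (w - Λ n)‖ := by rw [sub_add_sub_cancel]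
          _ ≤ ‖z₀ - w‖ + ‖w - Λ n‖ := norm_add_le _ _
          _ ≤ _ := by gcongr; exact norm_sub_le _ _
      rw [hm, mul_div_assoc', le_div_iff₀ hd]
      have h2 := hdist n
      nlinarith [norm_nonneg z₀, norm_nonneg w, mul_nonneg (norm_nonneg z₀) (norm_nonneg w),
        mul_le_mul_of_nonneg_left h2 (norm_nonneg z₀), mul_le_mul_of_nonneg_left h2 (norm_nonneg w),
        mul_nonneg hn.le (mul_nonneg (norm_nonneg z₀) (norm_nonneg w)),
        mul_le_mul_of_nonneg_right hd1 hn.le]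
    have hTf : ‖T f‖ ≤ m * (K * ‖g‖) := by
      refine (lp.norm_mono (by norm_num) hsamples).trans ?_
      rw [norm_smul, Complex.norm_real, Real.norm_eq_abs, abs_of_nonneg hm0]
      gcongr
      exact T.toContinuousLinearMap.le_opNorm g
    have hfn : ‖f‖ ≤ K' * (m * (K * ‖g‖)) := by
      calc ‖f‖ = ‖T.symm (T f)‖ := by rw [T.symm_apply_apply]
        _ ≤ K' * ‖T f‖ := T.symm.toContinuousLinearMap.le_opNorm _
        _ ≤ _ := by gcongr
    have h1 : ‖fourierSynthesis Real.pi f z₀‖ ≤ Z * (K' * (m * (K * ‖g‖))) :=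
      (norm_fourierSynthesis_Lp_le f z₀).trans (by rw [← hZ]; gcongr)
    have h2 := congrArg norm hfz₀
    rw [norm_mul, norm_mul] at h2
    rw [← h2, mul_comm ‖fourierSynthesis Real.pi f z₀‖, mul_assoc]
    refine mul_le_mul_of_nonneg_left ?_ (norm_nonneg _)
    calc ‖fourierSynthesis Real.pi f z₀‖ * d ≤ Z * (K' * (m * (K * ‖g‖))) * d := by gcongr
      _ = Z * (K' * K) * ((1 + ‖z₀‖) * (1 + ‖w‖)) * ‖g‖ := by
        rw [hm]; field_simp
      _ ≤ Z * (K' * K + 1) * ((1 + ‖z₀‖) * (1 + ‖w‖)) * ‖g‖ := by gcongr; linarith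
  refine ⟨Real.exp 1 * (2 * Real.pi * (Z * (K' * K + 1) * (1 + ‖z₀‖)) /
    ‖canonicalFunction Λ T z₀‖) + 1, by positivity, fun w d hd hd1 hdist => ?_⟩
  obtain ⟨g, hg1, hg2⟩ := exists_reproducing w
  have hgpos : 0 < ‖g‖ := by
    have : 0 < ‖g‖ ^ 2 := lt_of_lt_of_le (by positivity) hg2
    exact norm_pos_iff.2 fun h => by simp [h] at this
  have h1 := key w d hd hd1 hdist g
  rw [hg1, Complex.norm_real, Real.norm_eq_abs, abs_of_nonneg (by positivity)] at h1
  set P := ‖canonicalFunction Λ T w‖ with hP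
  set P₀ := ‖canonicalFunction Λ T z₀‖ with hP₀
  set A := Z * (K' * K + 1) with hA
  have hpi := Real.pi_pos
  have h2 : ‖g‖ * d ≤ 2 * Real.pi * (A * (1 + ‖z₀‖)) / P₀ * (1 + ‖w‖) * P := by
    have h3 : ‖g‖ * (‖g‖ * d) ≤ ‖g‖ * (2 * Real.pi * (A * (1 + ‖z₀‖)) / P₀ * (1 + ‖w‖) * P) := by
      have e : ‖g‖ * (2 * Real.pi * (A * (1 + ‖z₀‖)) / P₀ * (1 + ‖w‖) * P) =
        (P * (A * ((1 + ‖z₀‖) * (1 + ‖w‖)) * ‖g‖)) * (2 * Real.pi / P₀) := by ring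
      have e' : ‖g‖ * (‖g‖ * d) = (‖g‖ ^ 2 / (2 * Real.pi) * P₀ * d) * (2 * Real.pi / P₀) := by
        field_simp
      rw [e, e']
      gcongr
    exact le_of_mul_le_mul_left h3 hgpos
  have h4 : Real.exp (Real.pi * |w.im|) ≤ Real.exp 1 * (1 + ‖w‖) * ‖g‖ := by
    have h5 : |w.im| ≤ ‖w‖ := Complex.abs_im_le_norm w
    refine (pow_le_pow_iff_left₀ (by positivity) (by positivity) two_ne_zero).1 ?_
    rw [div_le_iff₀ (by positivity)] at hg2
    have e1 : Real.exp (Real.pi * |w.im|) ^ 2 = Real.exp (2 * Real.pi * |w.im|) := by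
      rw [← Real.exp_nat_mul]; congr 1; push_cast; ring
    have e2 : Real.exp 1 ^ 2 = Real.exp 2 := by
      rw [← Real.exp_nat_mul]; congr 1; norm_num
    rw [e1, mul_pow, mul_pow, e2]
    rw [Real.exp_neg, inv_mul_le_iff₀ (Real.exp_pos 2)] at hg2
    calc Real.exp (2 * Real.pi * |w.im|) ≤ Real.exp 2 * (‖g‖ ^ 2 * (1 + |w.im|)) := hg2
      _ ≤ Real.exp 2 * (‖g‖ ^ 2 * (1 + ‖w‖) ^ 2) := by
        gcongr
        nlinarith [norm_nonneg w]
      _ = _ := by ring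
  calc d * Real.exp (Real.pi * |w.im|) ≤ d * (Real.exp 1 * (1 + ‖w‖) * ‖g‖) := by gcongr
    _ = Real.exp 1 * (1 + ‖w‖) * (‖g‖ * d) := by ring
    _ ≤ Real.exp 1 * (1 + ‖w‖) * (2 * Real.pi * (A * (1 + ‖z₀‖)) / P₀ * (1 + ‖w‖) * P) := by gcongr
    _ = (Real.exp 1 * (2 * Real.pi * (A * (1 + ‖z₀‖)) / P₀)) * (1 + ‖w‖) ^ 2 * P := by ring
    _ ≤ _ := by gcongr; linarith

end GeneratingFunction

/-! ### Density of the sampling points -/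

section Zeros

variable {Λ : ℤ → ℂ} {T : Lp ℂ 2 (bandMeasure Real.pi) ≃L[ℂ] lp (fun _ : ℤ => ℂ) 2}

/-- The spectrum of a function of bandwidth `ε` concentrated at the real point `x`. -/
noncomputable def shortBand (ε x : ℝ) : ℝ → ℂ :=
  (Set.Icc (-ε) ε).indicator fun ω => Complex.exp (Complex.I * (ω : ℂ) * (-(x : ℂ)))

theorem norm_shortBand_le (ε x ω : ℝ) : ‖shortBand ε x ω‖ ≤ 1 := by
  refine (norm_indicator_le_norm_self _ _).trans ?_
  rw [norm_exp_I_mul]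
  simp

theorem memLp_shortBand (ε x σ : ℝ) (p : ENNReal) : MemLp (shortBand ε x) p (bandMeasure σ) :=
  MemLp.of_bound ((Continuous.aestronglyMeasurable (by fun_prop)).indicator measurableSet_Icc) 1
    (Eventually.of_forall (norm_shortBand_le ε x))

/-- Near its centre the function with spectrum `shortBand ε x` is approximately `ε / π`. -/
theorem norm_fourierSynthesis_shortBand_sub_le {σ ε x : ℝ} (hε : 0 < ε) (hεσ : ε ≤ σ) {z : ℂ}
    (hz : ε * ‖z - x‖ ≤ 1) :
    ‖fourierSynthesis σ (shortBand ε x) z - ε / Real.pi‖ ≤ 2 * ε * (ε * ‖z - x‖) / Real.pi := by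
  have hpi := Real.pi_pos
  have hsub : Set.Icc (-ε) ε ∩ Set.Icc (-σ) σ = Set.Icc (-ε) ε :=
    Set.inter_eq_left.2 (Set.Icc_subset_Icc (by linarith) (by linarith))
  have e1 : ∫ ω in Set.Icc (-σ) σ, shortBand ε x ω * Complex.exp (Complex.I * (ω : ℂ) * z) =
      ∫ ω in Set.Icc (-ε) ε, Complex.exp (Complex.I * (ω : ℂ) * (z - x)) := by
    have e2 : ∀ ω : ℝ, shortBand ε x ω * Complex.exp (Complex.I * (ω : ℂ) * z) =
        (Set.Icc (-ε) ε).indicator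
          (fun ω : ℝ => Complex.exp (Complex.I * (ω : ℂ) * (z - x))) ω := by
      intro ω
      rw [shortBand]
      by_cases hω : ω ∈ Set.Icc (-ε) ε
      · rw [Set.indicator_of_mem hω, Set.indicator_of_mem hω, ← Complex.exp_add]
        congr 1
        ring
      · rw [Set.indicator_of_notMem hω, Set.indicator_of_notMem hω, zero_mul]
    simp_rw [e2]
    rw [integral_indicator measurableSet_Icc, Measure.restrict_restrict measurableSet_Icc, hsub]
  have hE : Integrable (fun ω : ℝ => Complex.exp (Complex.I * (ω : ℂ) * (z - x)))
      (volume.restrict (Set.Icc (-ε) ε)) :=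
    (Continuous.continuousOn (by fun_prop)).integrableOn_compact isCompact_Icc
  have hpi' : (Real.pi : ℂ) ≠ 0 := by exact_mod_cast hpi.ne'
  have e3 : fourierSynthesis σ (shortBand ε x) z - ε / Real.pi = 1 / (2 * (Real.pi : ℂ)) *
      ∫ ω in Set.Icc (-ε) ε, (Complex.exp (Complex.I * (ω : ℂ) * (z - x)) - 1) := by
    unfold fourierSynthesis
    rw [e1, integral_sub hE (integrable_const _), integral_const, measureReal_restrict_apply_univ,
      Real.volume_real_Icc_of_le (by linarith)]
    generalize (∫ ω in Set.Icc (-ε) ε, Complex.exp (Complex.I * (ω : ℂ) * (z - x))) = J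
    simp only [Complex.real_smul, mul_one]
    push_cast
    field_simp
    ring
  have h1 : ‖(1 / (2 * (Real.pi : ℂ)))‖ = 1 / (2 * Real.pi) := by
    simp [abs_of_pos Real.pi_pos]
  have h2 : ‖∫ ω in Set.Icc (-ε) ε, (Complex.exp (Complex.I * (ω : ℂ) * (z - x)) - 1)‖ ≤
      2 * (ε * ‖z - x‖) * (2 * ε) := by
    refine (norm_setIntegral_le_of_norm_le_const (C := 2 * (ε * ‖z - x‖)) measure_Icc_lt_top
      fun ω hω => ?_).trans ?_
    · have h3 : ‖Complex.I * (ω : ℂ) * (z - x)‖ ≤ ε * ‖z - x‖ := by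
        rw [norm_mul, norm_mul, Complex.norm_I, one_mul, Complex.norm_real, Real.norm_eq_abs]
        gcongr
        exact abs_le.2 hω
      refine (Complex.norm_exp_sub_one_le (h3.trans hz)).trans (by linarith)
    · rw [Real.volume_real_Icc_of_le (by linarith)]
      apply le_of_eq
      ring
  rw [e3, norm_mul, h1]
  calc 1 / (2 * Real.pi) * _ ≤ 1 / (2 * Real.pi) * (2 * (ε * ‖z - x‖) * (2 * ε)) := by gcongr
    _ = _ := by field_simp

/-- Disks of a fixed radius centred on the real line contain a bounded number of points of the
sequence: a function of small bandwidth concentrated at the centre has samples bounded below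
there. -/
theorem exists_card_disk_le (hT : ∀ g n, T g n = fourierSynthesis Real.pi g (Λ n)) (r : ℝ)
    (hr : 0 ≤ r) :
    ∃ K : ℕ, ∀ (x : ℝ) (I : Finset ℤ), (∀ n ∈ I, ‖Λ n - x‖ ≤ r) → I.card ≤ K := by
  set M := ‖T.toContinuousLinearMap‖ with hM
  set ε : ℝ := 1 / (4 * (r + 1)) with hε
  have hεpos : 0 < ε := by positivity
  have hε1 : ε ≤ 1 := by
    rw [hε, div_le_one (by positivity)]
    linarith
  have hεr : ε * r ≤ 1 / 4 := by
    rw [hε, div_mul_eq_mul_div, div_le_div_iff₀ (by positivity) (by norm_num)]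
    linarith
  have hpi := Real.pi_gt_three
  refine ⟨⌈(M ^ 2 * (2 * Real.pi)) / (ε / (2 * Real.pi)) ^ 2⌉₊, fun x I hI => ?_⟩
  set k : ℝ → ℂ := shortBand ε x with hk
  have hkm : MemLp k 2 (bandMeasure Real.pi) := memLp_shortBand ε x Real.pi 2
  have hnorm : ‖hkm.toLp k‖ ^ 2 ≤ 2 * Real.pi := by
    rw [norm_sq_eq_integral_Lp]
    calc ∫ ω, ‖hkm.toLp k ω‖ ^ 2 ∂(bandMeasure Real.pi)
        ≤ ∫ ω, (1 : ℝ) ∂(bandMeasure Real.pi) := by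
          refine integral_mono_of_nonneg (Eventually.of_forall fun _ => by positivity)
            (integrable_const _) ?_
          filter_upwards [hkm.coeFn_toLp] with ω hω
          rw [hω]
          exact pow_le_one₀ (norm_nonneg _) (norm_shortBand_le ε x ω)
      _ = 2 * Real.pi := by
          rw [integral_const, smul_eq_mul, mul_one, measureReal_restrict_apply_univ,
            Real.volume_real_Icc_of_le (by linarith)]
          ring
  have hlow : ∀ n ∈ I, ε / (2 * Real.pi) ≤ ‖T (hkm.toLp k) n‖ := by
    intro n hn
    rw [hT, fourierSynthesis_toLp]
    have h0 : ε * ‖Λ n - x‖ ≤ 1 / 4 := by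
      refine le_trans ?_ hεr
      gcongr
      exact hI n hn
    have h1 := norm_fourierSynthesis_shortBand_sub_le hεpos (show ε ≤ Real.pi by linarith)
      (h0.trans (by norm_num))
    have h2 := norm_sub_norm_le ((ε : ℂ) / Real.pi) (fourierSynthesis Real.pi k (Λ n))
    rw [norm_sub_rev] at h2
    have h3 : ‖(ε : ℂ) / Real.pi‖ = ε / Real.pi := by
      rw [norm_div, Complex.norm_real, Complex.norm_real, Real.norm_eq_abs, Real.norm_eq_abs,
        abs_of_pos hεpos, abs_of_pos Real.pi_pos]
    have h4 : 2 * ε * (ε * ‖Λ n - x‖) / Real.pi ≤ 2 * ε * (1 / 4) / Real.pi := by gcongr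
    have e : ε / (2 * Real.pi) = ε / Real.pi - 2 * ε * (1 / 4) / Real.pi := by
      field_simp
      norm_num
    rw [e]
    linarith
  have hsum : (I.card : ℝ) * (ε / (2 * Real.pi)) ^ 2 ≤ M ^ 2 * (2 * Real.pi) := by
    calc (I.card : ℝ) * (ε / (2 * Real.pi)) ^ 2 = ∑ n ∈ I, (ε / (2 * Real.pi)) ^ 2 := by
          rw [Finset.sum_const, nsmul_eq_mul]
      _ ≤ ∑ n ∈ I, ‖T (hkm.toLp k) n‖ ^ 2 := by
          refine Finset.sum_le_sum fun n hn => ?_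
          have := hlow n hn
          gcongr
      _ ≤ ‖T (hkm.toLp k)‖ ^ 2 := by
          have := lp.sum_rpow_le_norm_rpow (p := 2) (by norm_num) (T (hkm.toLp k)) I
          simpa using this
      _ ≤ (M * ‖hkm.toLp k‖) ^ 2 := by
          gcongr
          exact T.toContinuousLinearMap.le_opNorm _
      _ ≤ M ^ 2 * (2 * Real.pi) := by
          rw [mul_pow]
          gcongr
  rw [← le_div_iff₀ (by positivity)] at hsum
  exact_mod_cast hsum.trans (Nat.le_ceil _)

theorem finite_norm_le (hT : ∀ g n, T g n = fourierSynthesis Real.pi g (Λ n)) (R : ℝ) :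
    {n : ℤ | ‖Λ n‖ ≤ R}.Finite := by
  by_contra hinf
  obtain ⟨K, hK⟩ := exists_card_disk_le hT |R| (abs_nonneg R)
  obtain ⟨I, hI, hc⟩ := Set.Infinite.exists_subset_card_eq hinf (K + 1)
  have := hK 0 I fun n hn => by
    have h1 : ‖Λ n‖ ≤ R := hI hn
    simpa using h1.trans (le_abs_self R)
  omega

/-- Annuli of unit width contain a bounded number of points of the sequence. -/
theorem exists_card_annulus_le (hT : ∀ g n, T g n = fourierSynthesis Real.pi g (Λ n)) :
    ∃ K : ℕ, ∀ (R : ℝ) (I : Finset ℤ), (∀ n ∈ I, R ≤ ‖Λ n‖ ∧ ‖Λ n‖ ≤ R + 1) → I.card ≤ K := by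
  obtain ⟨B, hB, hBΛ⟩ := exists_im_bound hT
  obtain ⟨K, hK⟩ := exists_card_disk_le hT (2 * B + 1) (by positivity)
  refine ⟨K + K, fun R I hI => ?_⟩
  rw [← Finset.card_filter_add_card_filter_not (fun n => 0 ≤ (Λ n).re)]
  have hre : ∀ n ∈ I, R - B ≤ |(Λ n).re| ∧ |(Λ n).re| ≤ R + 1 := by
    intro n hn
    have h1 := Complex.norm_le_abs_re_add_abs_im (Λ n)
    have h2 := Complex.abs_re_le_norm (Λ n)
    have h3 := hI n hn
    have h4 := hBΛ n
    exact ⟨by linarith, by linarith⟩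
  refine add_le_add (hK R _ fun n hn => ?_) (hK (-R) _ fun n hn => ?_)
  · obtain ⟨hnI, h0⟩ := Finset.mem_filter.1 hn
    have h1 := hre n hnI
    rw [abs_of_nonneg h0] at h1
    refine (Complex.norm_le_abs_re_add_abs_im _).trans ?_
    have h2 : |(Λ n - R).re| ≤ B + 1 := by
      simp only [Complex.sub_re, Complex.ofReal_re]
      exact abs_le.2 ⟨by linarith, by linarith⟩
    have h3 : |(Λ n - R).im| ≤ B := by simpa using hBΛ n
    linarith
  · obtain ⟨hnI, h0⟩ := Finset.mem_filter.1 hn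
    have h1 := hre n hnI
    rw [abs_of_neg (not_le.1 h0)] at h1
    refine (Complex.norm_le_abs_re_add_abs_im _).trans ?_
    have h2 : |(Λ n - (-R : ℝ)).re| ≤ B + 1 := by
      simp only [Complex.sub_re, Complex.ofReal_re]
      exact abs_le.2 ⟨by linarith, by linarith⟩
    have h3 : |(Λ n - (-R : ℝ)).im| ≤ B := by simpa using hBΛ n
    linarith

/-- Every interval of unit length contains a radius that keeps a fixed distance from the moduli of
the points of the sequence: of `K + 1` well separated candidates, where `K` bounds the number of
points in the annulus, one is far from all these points. -/
theorem exists_good_radius (hT : ∀ g n, T g n = fourierSynthesis Real.pi g (Λ n)) :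
    ∃ δ : ℝ, 0 < δ ∧ δ ≤ 1 ∧ ∀ R : ℝ, ∃ ρ, R ≤ ρ ∧ ρ ≤ R + 1 ∧ ∀ n, δ ≤ |‖Λ n‖ - ρ| := by
  obtain ⟨K, hK⟩ := exists_card_annulus_le hT
  have hKpos : (0 : ℝ) < K + 1 := by positivity
  set δ : ℝ := 1 / (2 * (K + 1)) with hδ
  have hδpos : 0 < δ := by positivity
  have hδK : 2 * δ * (K + 1) = 1 := by rw [hδ]; field_simp
  refine ⟨δ, hδpos, by nlinarith [(Nat.cast_nonneg K : (0 : ℝ) ≤ K)], fun R => ?_⟩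
  by_contra! hcon
  have hj : ∀ j : Fin (K + 1), R + δ ≤ R + (2 * j + 1) * δ ∧
      R + (2 * j + 1) * δ ≤ R + 1 - δ := by
    intro j
    have h1 : (j : ℝ) + 1 ≤ K + 1 := by exact_mod_cast j.2
    have h0 : (0 : ℝ) ≤ j := Nat.cast_nonneg _
    constructor <;> nlinarith
  choose n hn using fun j : Fin (K + 1) => hcon (R + (2 * j + 1) * δ)
    (by linarith [(hj j).1]) (by linarith [(hj j).2])
  have hinj : Function.Injective n := by
    intro i j hij
    by_contra hne
    have h1 := abs_lt.1 (hn i)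
    have h2 := abs_lt.1 (hn j)
    rw [hij] at h1
    have hne' : (i : ℕ) ≠ j := fun h => hne (Fin.ext h)
    rcases lt_or_gt_of_ne hne' with h | h
    · have h3 : (i : ℝ) + 1 ≤ j := by exact_mod_cast h
      nlinarith
    · have h3 : (j : ℝ) + 1 ≤ i := by exact_mod_cast h
      nlinarith
  have hcard := hK R (Finset.univ.map ⟨n, hinj⟩) (by
    intro m hm
    obtain ⟨j, -, rfl⟩ := Finset.mem_map.1 hm
    have h1 := abs_lt.1 (hn j)
    have h2 := hj j
    simp only [Function.Embedding.coeFn_mk]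
    constructor <;> linarith)
  rw [Finset.card_map, Finset.card_univ, Fintype.card_fin] at hcard
  omega

end Zeros

/-! ### The logarithmic derivative on large circles -/

/-- A zero-free function whose modulus lies between `e^{-K}` and `e^K` on a disk of radius `r` has
logarithmic derivative `O(K / r)` at the centre, by the Borel-Carathéodory theorem applied to its
logarithm. -/
theorem norm_logDeriv_le_of_bounds {F : ℂ → ℂ} {c : ℂ} {r K : ℝ} (hr : 0 < r) (hK : 0 < K)
    (hF : DifferentiableOn ℂ F (Metric.ball c r))
    (hup : ∀ w ∈ Metric.ball c r, ‖F w‖ ≤ Real.exp K)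
    (hlow : ∀ w ∈ Metric.ball c r, Real.exp (-K) ≤ ‖F w‖) :
    ‖logDeriv F c‖ ≤ 8 * K / r := by
  have hne : ∀ w ∈ Metric.ball c r, F w ≠ 0 := fun w hw =>
    norm_pos_iff.1 ((Real.exp_pos _).trans_le (hlow w hw))
  have hc : c ∈ Metric.ball c r := Metric.mem_ball_self hr
  have hq : DifferentiableOn ℂ (fun z => deriv F z / F z) (Metric.ball c r) :=
    (hF.deriv Metric.isOpen_ball).div hF hne
  obtain ⟨G, hG0, hG⟩ := hq.isExactOn_ball.with_val_at c 0
  have hGd : DifferentiableOn ℂ G (Metric.ball c r) := fun w hw =>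
    (hG w hw).differentiableAt.differentiableWithinAt
  have hconst : ∀ w ∈ Metric.ball c r, F w * Complex.exp (-G w) = F c := by
    intro w hw
    have h1 : DifferentiableOn ℂ (fun w => F w * Complex.exp (-G w)) (Metric.ball c r) :=
      hF.mul hGd.neg.cexp
    have h2 : Set.EqOn (deriv fun w => F w * Complex.exp (-G w)) 0 (Metric.ball c r) := by
      intro z hz
      have h3 := ((hF.differentiableAt (Metric.isOpen_ball.mem_nhds hz)).hasDerivAt).mul
        (hG z hz).neg.cexp
      have h5 := hne z hz
      refine h3.deriv.trans ?_
      simp only [Pi.neg_apply, Pi.zero_apply]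
      field_simp
      ring
    have h3 := Metric.isOpen_ball.is_const_of_deriv_eq_zero
      (convex_ball c r).isPreconnected h1 h2 hw hc
    simpa [hG0] using h3
  have hre : ∀ w ∈ Metric.ball c r, (G w).re ≤ 2 * K := by
    intro w hw
    have h1 := congrArg norm (hconst w hw)
    rw [norm_mul, Complex.norm_exp, Complex.neg_re, Real.exp_neg] at h1
    have h2 : ‖F w‖ = ‖F c‖ * Real.exp (G w).re := by
      rw [← h1, inv_mul_cancel_right₀ (Real.exp_pos _).ne']
    have h3 : Real.exp (-K) * Real.exp (G w).re ≤ Real.exp K := by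
      calc _ ≤ ‖F c‖ * Real.exp (G w).re := by gcongr; exact hlow c hc
        _ = ‖F w‖ := h2.symm
        _ ≤ _ := hup w hw
    rw [← Real.exp_add, Real.exp_le_exp] at h3
    linarith
  have hmem : ∀ z ∈ Metric.ball (0 : ℂ) r, c + z ∈ Metric.ball c r := by
    intro z hz
    simpa using hz
  have hGt : DifferentiableOn ℂ (fun z => G (c + z)) (Metric.ball 0 r) :=
    hGd.comp (differentiableOn_id.const_add c) hmem
  have hder : HasDerivAt (fun z => G (c + z)) (logDeriv F c) 0 := by
    have := hG c hc
    have h1 : HasDerivAt G (logDeriv F c) (c + 0) := by simpa [logDeriv] using this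
    exact h1.comp_const_add c 0
  refine hder.le_of_lip' (by positivity) ?_
  filter_upwards [Metric.ball_mem_nhds (0 : ℂ) (half_pos hr)] with z hz
  have hz' : ‖z‖ < r / 2 := mem_ball_zero_iff.1 hz
  have hzr : z ∈ Metric.ball (0 : ℂ) r := mem_ball_zero_iff.2 (by linarith)
  have h1 := Complex.borelCaratheodory_zero (M := 2 * K) (by positivity) hGt
    (fun w hw => hre _ (hmem w hw)) hr hzr (by simpa using hG0)
  simp only [add_zero, hG0, sub_zero]
  refine h1.trans ?_
  rw [div_mul_eq_mul_div, div_le_div_iff₀ (by linarith) hr]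
  nlinarith [mul_nonneg hK.le (norm_nonneg z)]

/-- If `f` is bounded by `P` on the half circle, and by `P / √ρ` at the points of height at least
`√ρ` above the axis, its integral is `O(P / √ρ)`: the remaining arcs have length `O(1 / √ρ)`. -/
theorem norm_integral_half_circle_le {f : ℝ → ℂ} {ρ P : ℝ} (hρ : 1 ≤ ρ)
    (hf : ContinuousOn f (Set.Icc 0 Real.pi))
    (h1 : ∀ θ ∈ Set.Icc 0 Real.pi, ‖f θ‖ ≤ P)
    (h2 : ∀ θ ∈ Set.Icc 0 Real.pi, Real.sqrt ρ ≤ ρ * Real.sin θ → ‖f θ‖ ≤ P / Real.sqrt ρ) :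
    ‖∫ θ in (0 : ℝ)..Real.pi, f θ‖ ≤ 2 * Real.pi * P / Real.sqrt ρ := by
  have hpi := Real.pi_pos
  have hs : 1 ≤ Real.sqrt ρ := Real.one_le_sqrt.2 hρ
  have hspos : 0 < Real.sqrt ρ := by linarith
  have hss : Real.sqrt ρ * Real.sqrt ρ = ρ := Real.mul_self_sqrt (by linarith)
  have hP : 0 ≤ P := (norm_nonneg _).trans (h1 0 ⟨le_rfl, hpi.le⟩)
  set a : ℝ := Real.pi / 2 / Real.sqrt ρ with ha
  have ha0 : 0 ≤ a := by positivity
  have ha1 : a ≤ Real.pi / 2 := by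
    rw [ha]
    exact div_le_self (by positivity) hs
  have hsin : ∀ θ, a ≤ θ → θ ≤ Real.pi / 2 → Real.sqrt ρ ≤ ρ * Real.sin θ := by
    intro θ hθ hθ'
    have h3 := Real.mul_le_sin (ha0.trans hθ) hθ'
    have h4 : 2 / Real.pi * a ≤ 2 / Real.pi * θ := by gcongr
    have h5 : 2 / Real.pi * a = 1 / Real.sqrt ρ := by
      rw [ha]
      field_simp
    calc Real.sqrt ρ = ρ * (1 / Real.sqrt ρ) := by
          rw [mul_one_div, eq_div_iff hspos.ne', hss]
      _ ≤ ρ * Real.sin θ := by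
          gcongr
          linarith
  have hmid : ∀ θ ∈ Set.Icc a (Real.pi - a), Real.sqrt ρ ≤ ρ * Real.sin θ := by
    intro θ hθ
    rcases le_total θ (Real.pi / 2) with h | h
    · exact hsin θ hθ.1 h
    · rw [← Real.sin_pi_sub]
      exact hsin _ (by linarith [hθ.2]) (by linarith)
  have hint : ∀ x y, 0 ≤ x → x ≤ y → y ≤ Real.pi → IntervalIntegrable f volume x y := by
    intro x y hx hxy hy
    refine (hf.mono ?_).intervalIntegrable
    rw [Set.uIcc_of_le hxy]
    exact Set.Icc_subset_Icc hx hy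
  rw [← intervalIntegral.integral_add_adjacent_intervals (hint 0 a le_rfl ha0 (by linarith))
      (hint a Real.pi ha0 (by linarith) le_rfl),
    ← intervalIntegral.integral_add_adjacent_intervals
      (hint a (Real.pi - a) ha0 (by linarith) (by linarith))
      (hint (Real.pi - a) Real.pi (by linarith) (by linarith) le_rfl)]
  have b1 : ‖∫ θ in (0 : ℝ)..a, f θ‖ ≤ P * |a - 0| := by
    refine intervalIntegral.norm_integral_le_of_norm_le_const fun θ hθ => ?_
    rw [Set.uIoc_of_le ha0] at hθ
    exact h1 θ ⟨hθ.1.le, by linarith [hθ.2]⟩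
  have b2 : ‖∫ θ in a..(Real.pi - a), f θ‖ ≤ P / Real.sqrt ρ * |Real.pi - a - a| := by
    refine intervalIntegral.norm_integral_le_of_norm_le_const fun θ hθ => ?_
    rw [Set.uIoc_of_le (by linarith)] at hθ
    exact h2 θ ⟨by linarith [hθ.1], by linarith [hθ.2]⟩ (hmid θ ⟨hθ.1.le, hθ.2⟩)
  have b3 : ‖∫ θ in (Real.pi - a)..Real.pi, f θ‖ ≤ P * |Real.pi - (Real.pi - a)| := by
    refine intervalIntegral.norm_integral_le_of_norm_le_const fun θ hθ => ?_
    rw [Set.uIoc_of_le (by linarith)] at hθ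
    exact h1 θ ⟨by linarith [hθ.1], hθ.2⟩
  rw [sub_zero, abs_of_nonneg ha0] at b1
  rw [abs_of_nonneg (by linarith)] at b2
  rw [sub_sub_cancel, abs_of_nonneg ha0] at b3
  have b4 : P / Real.sqrt ρ * (Real.pi - a - a) ≤ P / Real.sqrt ρ * Real.pi := by
    gcongr
    linarith
  have e : P * a = Real.pi * P / Real.sqrt ρ / 2 := by rw [ha]; ring
  have e' : 2 * Real.pi * P / Real.sqrt ρ = P * a + (P / Real.sqrt ρ * Real.pi + P * a) := by
    rw [e]; ring
  rw [e']
  exact (norm_add_le _ _).trans (add_le_add b1 ((norm_add_le _ _).trans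
    (add_le_add (b2.trans b4) b3)))

section LogarithmicDerivative

variable {Λ : ℤ → ℂ} {T : Lp ℂ 2 (bandMeasure Real.pi) ≃L[ℂ] lp (fun _ : ℤ => ℂ) 2}

/-- The logarithmic derivative is close to `-iπ` in the upper half plane (`s = 1`) and to `iπ` in
the lower one (`s = -1`), away from the zeros: the growth bounds confine the modulus of
`φ(z) e^{iπsz}`, which is free of zeros on the disk, to a range of polynomial size, and
`norm_logDeriv_le_of_bounds` applies. -/
theorem exists_norm_logDeriv_add_le (hT : ∀ g n, T g n = fourierSynthesis Real.pi g (Λ n)) :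
    ∃ C : ℝ, 2 ≤ C ∧ ∀ (s : ℝ) (ζ : ℂ) (r d X : ℝ), (s = 1 ∨ s = -1) → 0 < r → 0 < d → d ≤ 1 →
      (∀ w ∈ Metric.ball ζ r, ∀ n, d ≤ ‖w - Λ n‖) →
      (∀ w ∈ Metric.ball ζ r, |w.im| ≤ s * w.im + 1) →
      (∀ w ∈ Metric.ball ζ r, 1 + ‖w‖ ≤ X) →
      ‖logDeriv (canonicalFunction Λ T) ζ + Complex.I * Real.pi * s‖ ≤
        8 * Real.log (C * X ^ 2 / d) / r := by
  obtain ⟨C₁, hC₁, hup⟩ := exists_canonicalFunction_upper (Λ := Λ) (T := T)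
  obtain ⟨C₂, hC₂, hlow⟩ := exists_canonicalFunction_lower hT
  have hpi := Real.pi_pos
  refine ⟨C₁ * Real.exp Real.pi + C₂ + 2, by
    have := mul_pos hC₁ (Real.exp_pos Real.pi)
    linarith, fun s ζ r d X hs hr hd hd1 hdist him hX => ?_⟩
  set C := C₁ * Real.exp Real.pi + C₂ + 2 with hC
  have hC1 : C₁ * Real.exp Real.pi ≤ C := by linarith
  have hC2 : C₂ ≤ C := by have := mul_pos hC₁ (Real.exp_pos Real.pi); linarith
  have hC3 : 2 ≤ C := by have := mul_pos hC₁ (Real.exp_pos Real.pi); linarith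
  have hζ : ζ ∈ Metric.ball ζ r := Metric.mem_ball_self hr
  have hX1 : 1 ≤ X := by linarith [hX ζ hζ, norm_nonneg ζ]
  have hX2 : 1 ≤ X ^ 2 := one_le_pow₀ hX1
  have hCX : 1 < C * X ^ 2 / d := by
    rw [lt_div_iff₀ hd]
    nlinarith
  set K := Real.log (C * X ^ 2 / d) with hK
  have hKpos : 0 < K := Real.log_pos hCX
  have hexpK : Real.exp K = C * X ^ 2 / d := Real.exp_log (by linarith)
  have hne : ∀ w ∈ Metric.ball ζ r, canonicalFunction Λ T w ≠ 0 := by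
    intro w hw
    refine canonicalFunction_ne_zero hT fun n h => ?_
    have := hdist w hw n
    rw [h, sub_self, norm_zero] at this
    linarith
  have hEd : Differentiable ℂ fun z : ℂ => Complex.exp (Complex.I * Real.pi * s * z) := by fun_prop
  have hEn : ∀ w : ℂ, ‖Complex.exp (Complex.I * Real.pi * s * w)‖ =
      Real.exp (-(Real.pi * (s * w.im))) := by
    intro w
    rw [Complex.norm_exp]
    congr 1
    have e : Complex.I * Real.pi * s * w = ((Real.pi * s : ℝ) : ℂ) * (Complex.I * w) := by
      push_cast; ring
    rw [e, Complex.re_ofReal_mul, Complex.I_mul_re]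
    ring
  have hsle : ∀ w : ℂ, s * w.im ≤ |w.im| := by
    intro w
    rcases hs with rfl | rfl
    · rw [one_mul]; exact le_abs_self _
    · rw [neg_one_mul]; exact neg_le_abs _
  have key := norm_logDeriv_le_of_bounds
    (F := fun z => canonicalFunction Λ T z * Complex.exp (Complex.I * Real.pi * s * z))
    (c := ζ) hr hKpos (differentiable_canonicalFunction.mul hEd).differentiableOn ?_ ?_
  · have e : logDeriv (fun z => canonicalFunction Λ T z *
        Complex.exp (Complex.I * Real.pi * s * z)) ζ =
        logDeriv (canonicalFunction Λ T) ζ + Complex.I * Real.pi * s := by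
      rw [logDeriv_mul (g := fun z : ℂ => Complex.exp (Complex.I * Real.pi * s * z)) ζ (hne ζ hζ)
        (Complex.exp_ne_zero _)
        differentiable_canonicalFunction.differentiableAt hEd.differentiableAt]
      congr 1
      rw [logDeriv_apply]
      have h : HasDerivAt (fun z : ℂ => Complex.exp (Complex.I * Real.pi * s * z))
          (Complex.exp (Complex.I * Real.pi * s * ζ) * (Complex.I * Real.pi * s * 1)) ζ :=
        ((hasDerivAt_id ζ).const_mul _).cexp
      rw [h.deriv, mul_div_cancel_left₀ _ (Complex.exp_ne_zero _), mul_one]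
    rw [e] at key
    exact key
  · intro w hw
    rw [norm_mul, hEn, hexpK]
    calc ‖canonicalFunction Λ T w‖ * Real.exp (-(Real.pi * (s * w.im)))
        ≤ (C₁ * (1 + ‖w‖) * Real.exp (Real.pi * |w.im|)) * Real.exp (-(Real.pi * (s * w.im))) := by
          gcongr; exact hup w
      _ = C₁ * (1 + ‖w‖) * Real.exp (Real.pi * (|w.im| - s * w.im)) := by
          rw [mul_assoc, ← Real.exp_add]
          congr 2
          ring
      _ ≤ C₁ * X * Real.exp (Real.pi * 1) := by
          gcongr
          · exact hX w hw
          · linarith [him w hw]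
      _ = C₁ * Real.exp Real.pi * X := by rw [mul_one]; ring
      _ ≤ C * X ^ 2 := by
          gcongr
          nlinarith
      _ ≤ C * X ^ 2 / d := le_div_self (by positivity) hd hd1
  · intro w hw
    rw [norm_mul, hEn, Real.exp_neg, hexpK, inv_div, div_le_iff₀ (by positivity)]
    have h1 := hlow w d hd hd1 (hdist w hw)
    calc d = d * Real.exp (Real.pi * |w.im|) * Real.exp (-(Real.pi * |w.im|)) := by
          rw [mul_assoc, ← Real.exp_add, add_neg_cancel, Real.exp_zero, mul_one]
      _ ≤ (C₂ * (1 + ‖w‖) ^ 2 * ‖canonicalFunction Λ T w‖) *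
          Real.exp (-(Real.pi * (s * w.im))) := by
          gcongr
          exact hsle w
      _ ≤ (C * X ^ 2 * ‖canonicalFunction Λ T w‖) * Real.exp (-(Real.pi * (s * w.im))) := by
          gcongr
          exact hX w hw
      _ = _ := by ring

/-- The two bounds for the logarithmic derivative on a circle `|ζ| = ρ` that keeps the distance `δ`
from the zeros; the half circle is `θ ↦ s ρ e^{iθ}`, `θ ∈ [0, π]`. They come from disks of radius
`δ / 2` everywhere, and of radius `√ρ / 2` at the points of height at least `√ρ`, where these disks
lie above the strip that contains the sequence. -/
theorem exists_norm_logDeriv_circle_le (hT : ∀ g n, T g n = fourierSynthesis Real.pi g (Λ n))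
    {δ : ℝ} (hδ : 0 < δ) (hδ1 : δ ≤ 1) :
    ∃ A ρ₀ : ℝ, 0 < A ∧ 1 ≤ ρ₀ ∧ ∀ ρ, ρ₀ ≤ ρ → (∀ n, δ ≤ |‖Λ n‖ - ρ|) → ∀ s : ℝ, (s = 1 ∨ s = -1) →
      ∀ θ ∈ Set.Icc 0 Real.pi,
      ‖logDeriv (canonicalFunction Λ T) (s * circleMap 0 ρ θ) + Complex.I * Real.pi * s‖ ≤
        A * (1 + Real.log (ρ + 1)) ∧
      (Real.sqrt ρ ≤ ρ * Real.sin θ →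
        ‖logDeriv (canonicalFunction Λ T) (s * circleMap 0 ρ θ) + Complex.I * Real.pi * s‖ ≤
        A * (1 + Real.log (ρ + 1)) / Real.sqrt ρ) := by
  obtain ⟨C, hC2, hC⟩ := exists_norm_logDeriv_add_le hT
  obtain ⟨B, hB, hBΛ⟩ := exists_im_bound hT
  have hlog8 : 0 ≤ Real.log (8 * C / δ) := by
    apply Real.log_nonneg
    rw [le_div_iff₀ hδ]
    linarith
  refine ⟨16 / δ * (Real.log (8 * C / δ) + 2), (2 * (B + 1)) ^ 2 + 1, by positivity,
    by nlinarith, fun ρ hρ hgood s hs θ hθ => ?_⟩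
  have hρ1 : 1 ≤ ρ := by nlinarith
  have hρpos : 0 < ρ := by linarith
  have hsqrt1 : 1 ≤ Real.sqrt ρ := Real.one_le_sqrt.2 hρ1
  have hsqrtB : 2 * (B + 1) ≤ Real.sqrt ρ := Real.le_sqrt_of_sq_le (by linarith)
  have hsqrtρ : Real.sqrt ρ ≤ ρ := by
    have := Real.mul_self_sqrt hρpos.le
    nlinarith
  set ζ : ℂ := s * circleMap 0 ρ θ with hζ
  have hs2 : |s| = 1 := by rcases hs with rfl | rfl <;> simp
  have hζn : ‖ζ‖ = ρ := by
    rw [hζ, norm_mul, Complex.norm_real, Real.norm_eq_abs, hs2, one_mul, norm_circleMap_zero,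
      abs_of_pos hρpos]
  have hζim : s * ζ.im = ρ * Real.sin θ := by
    have hss : s * s = 1 := by rcases hs with rfl | rfl <;> norm_num
    rw [hζ, Complex.im_ofReal_mul, ← mul_assoc, hss, one_mul]
    simp [circleMap, Complex.exp_im]
  have hsin : 0 ≤ ρ * Real.sin θ := mul_nonneg hρpos.le (Real.sin_nonneg_of_mem_Icc hθ)
  have hball : ∀ r, ∀ w ∈ Metric.ball ζ r, s * ζ.im - r ≤ s * w.im ∧ ‖w‖ ≤ ρ + r := by
    intro r w hw
    have h1 : ‖w - ζ‖ < r := by rw [← dist_eq_norm]; exact Metric.mem_ball.1 hw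
    constructor
    · have h2 : |s * (w.im - ζ.im)| ≤ ‖w - ζ‖ := by
        rw [abs_mul, hs2, one_mul, ← Complex.sub_im]
        exact Complex.abs_im_le_norm _
      have h3 := neg_le_of_abs_le h2
      linarith
    · have := norm_le_norm_add_norm_sub' w ζ
      rw [hζn] at this
      linarith
  have hlogK : Real.log (C * (2 * (ρ + 1)) ^ 2 / (δ / 2)) ≤
      (Real.log (8 * C / δ) + 2) * (1 + Real.log (ρ + 1)) := by
    have e : C * (2 * (ρ + 1)) ^ 2 / (δ / 2) = 8 * C / δ * (ρ + 1) ^ 2 := by field_simp; norm_num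
    rw [e, Real.log_mul (by positivity) (by positivity), Real.log_pow]
    have h1 : 0 ≤ Real.log (ρ + 1) := Real.log_nonneg (by linarith)
    push_cast
    nlinarith [mul_nonneg hlog8 h1]
  have hlog0 : 0 ≤ (Real.log (8 * C / δ) + 2) * (1 + Real.log (ρ + 1)) := by
    have h1 : 0 ≤ Real.log (ρ + 1) := Real.log_nonneg (by linarith)
    positivity
  constructor
  · refine (hC s ζ (δ / 2) (δ / 2) (2 * (ρ + 1)) hs (by positivity) (by positivity) (by linarith)
      ?_ ?_ ?_).trans ?_
    · intro w hw n
      have h1 : ‖w - ζ‖ < δ / 2 := by rw [← dist_eq_norm]; exact Metric.mem_ball.1 hw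
      have h2 : |‖Λ n‖ - ρ| ≤ ‖ζ - Λ n‖ := by
        rw [← hζn, norm_sub_rev]
        exact abs_norm_sub_norm_le _ _
      have h3 := hgood n
      have h4 : ‖ζ - Λ n‖ ≤ ‖w - ζ‖ + ‖w - Λ n‖ := by
        rw [norm_sub_rev w ζ]
        exact norm_sub_le_norm_sub_add_norm_sub _ _ _
      linarith
    · intro w hw
      have h1 := (hball _ w hw).1
      rw [hζim] at h1
      have h2 : |w.im| = |s * w.im| := by rw [abs_mul, hs2, one_mul]
      rw [h2]
      exact abs_le.2 ⟨by linarith, by linarith⟩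
    · intro w hw
      have := (hball _ w hw).2
      linarith
    · rw [div_le_iff₀ (by positivity)]
      have e : 16 / δ * (Real.log (8 * C / δ) + 2) * (1 + Real.log (ρ + 1)) * (δ / 2) =
        8 * ((Real.log (8 * C / δ) + 2) * (1 + Real.log (ρ + 1))) := by field_simp; norm_num
      rw [e]
      gcongr
  · intro hhigh
    have him : ∀ w ∈ Metric.ball ζ (Real.sqrt ρ / 2), Real.sqrt ρ / 2 ≤ s * w.im := by
      intro w hw
      have h1 := (hball _ w hw).1
      rw [hζim] at h1
      linarith
    refine (hC s ζ (Real.sqrt ρ / 2) (δ / 2) (2 * (ρ + 1)) hs (by positivity) (by positivity)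
      (by linarith) ?_ ?_ ?_).trans ?_
    · intro w hw n
      have h1 := him w hw
      have h2 : |(w - Λ n).im| ≤ ‖w - Λ n‖ := Complex.abs_im_le_norm _
      have h3 : s * w.im ≤ |w.im| := by
        calc s * w.im ≤ |s * w.im| := le_abs_self _
          _ = |w.im| := by rw [abs_mul, hs2, one_mul]
      have h4 : |w.im| - |(Λ n).im| ≤ |(w - Λ n).im| := by
        rw [Complex.sub_im]
        exact abs_sub_abs_le_abs_sub _ _
      linarith [hBΛ n]
    · intro w hw
      have h1 := him w hw
      have h2 : |w.im| = |s * w.im| := by rw [abs_mul, hs2, one_mul]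
      rw [h2, abs_of_nonneg (by linarith)]
      linarith
    · intro w hw
      have := (hball _ w hw).2
      linarith
    · rw [div_le_div_iff₀ (by positivity) (by positivity)]
      have h5 : 16 * ((Real.log (8 * C / δ) + 2) * (1 + Real.log (ρ + 1))) ≤
          16 / δ * (Real.log (8 * C / δ) + 2) * (1 + Real.log (ρ + 1)) := by
        have : 16 ≤ 16 / δ := le_div_self (by norm_num) hδ hδ1
        rw [mul_assoc]
        gcongr
      nlinarith

/-- The Cauchy transform of the logarithmic derivative over large circles avoiding the zeros tends
to zero, locally uniformly: its limits `-iπ` and `iπ` on the two half circles cancel. -/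
theorem exists_norm_circleIntegral_logDeriv_le
    (hT : ∀ g n, T g n = fourierSynthesis Real.pi g (Λ n))
    {δ : ℝ} (hδ : 0 < δ) (hδ1 : δ ≤ 1) {r₀ ε : ℝ} (hr₀ : 0 ≤ r₀) (hε : 0 < ε) :
    ∃ ρ₀ : ℝ, ∀ ρ, ρ₀ ≤ ρ → (∀ n, δ ≤ |‖Λ n‖ - ρ|) → ∀ z : ℂ, ‖z‖ ≤ r₀ →
      ‖∮ ζ in C(0, ρ), (ζ - z)⁻¹ * logDeriv (canonicalFunction Λ T) ζ‖ ≤ ε := by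
  obtain ⟨A, ρ₁, hA, hρ₁, hbound⟩ := exists_norm_logDeriv_circle_le hT hδ hδ1
  have hpi := Real.pi_pos
  set P : ℝ → ℝ := fun ρ => (2 * A + 2 * Real.pi * r₀) * (1 + Real.log (ρ + 1)) with hP
  have hlim : Tendsto (fun ρ : ℝ => 4 * Real.pi * P ρ / Real.sqrt ρ) atTop (𝓝 0) := by
    have h1 : Tendsto (fun ρ : ℝ => Real.log (ρ + 1) / Real.sqrt ρ) atTop (𝓝 0) := by
      have h2 : Tendsto (fun x : ℝ => Real.log x / x ^ (1 / 2 : ℝ)) atTop (𝓝 0) :=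
        (isLittleO_log_rpow_atTop (by norm_num)).tendsto_div_nhds_zero
      have h3 := (h2.comp (tendsto_atTop_add_const_right atTop (1 : ℝ) tendsto_id)).mul_const
        (2 : ℝ)
      rw [zero_mul] at h3
      refine squeeze_zero' ?_ ?_ h3
      · filter_upwards [eventually_ge_atTop 1] with ρ hρ
        have := Real.log_nonneg (show (1 : ℝ) ≤ ρ + 1 by linarith)
        positivity
      · filter_upwards [eventually_ge_atTop 1] with ρ hρ
        have h4 := Real.log_nonneg (show (1 : ℝ) ≤ ρ + 1 by linarith)
        simp only [Function.comp_apply, id]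
        rw [← Real.sqrt_eq_rpow, div_mul_eq_mul_div,
          div_le_div_iff₀ (Real.sqrt_pos.2 (by linarith)) (Real.sqrt_pos.2 (by linarith))]
        have h5 : Real.sqrt (ρ + 1) ≤ 2 * Real.sqrt ρ := by
          rw [Real.sqrt_le_left (by positivity), mul_pow, Real.sq_sqrt (by linarith)]
          linarith
        nlinarith [mul_le_mul_of_nonneg_left h5 h4]
    have h2 : Tendsto (fun ρ : ℝ => 1 / Real.sqrt ρ) atTop (𝓝 0) := by
      simp only [one_div]
      exact Real.tendsto_sqrt_atTop.inv_tendsto_atTop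
    have h3 := (h2.add h1).const_mul (4 * Real.pi * (2 * A + 2 * Real.pi * r₀))
    rw [add_zero, mul_zero] at h3
    refine h3.congr fun ρ => ?_
    rw [hP]
    ring
  obtain ⟨ρ₂, hρ₂⟩ := eventually_atTop.1 (hlim.eventually_le_const hε)
  refine ⟨max (max ρ₁ ρ₂) (max (2 * r₀ + 1) 1), fun ρ hρ hgood z hz => ?_⟩
  have hρA : ρ₁ ≤ ρ := (le_max_left _ _).trans ((le_max_left _ _).trans hρ)
  have hρB : ρ₂ ≤ ρ := (le_max_right _ _).trans ((le_max_left _ _).trans hρ)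
  have hρC : 2 * r₀ + 1 ≤ ρ := (le_max_left _ _).trans ((le_max_right _ _).trans hρ)
  have hρ1 : 1 ≤ ρ := (le_max_right _ _).trans ((le_max_right _ _).trans hρ)
  have hρpos : 0 < ρ := by linarith
  refine le_trans ?_ (hρ₂ ρ hρB)
  set Q := logDeriv (canonicalFunction Λ T) with hQ
  have hsn : ∀ s : ℝ, (s = 1 ∨ s = -1) → ∀ θ, ‖(s : ℂ) * circleMap 0 ρ θ‖ = ρ := by
    intro s hs θ
    rw [norm_mul, Complex.norm_real, norm_circleMap_zero, abs_of_pos hρpos]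
    rcases hs with rfl | rfl <;> simp
  have hφne : ∀ ζ : ℂ, ‖ζ‖ = ρ → canonicalFunction Λ T ζ ≠ 0 := by
    intro ζ hζ
    refine canonicalFunction_ne_zero hT fun n h => ?_
    have := hgood n
    rw [← h, hζ, sub_self, abs_zero] at this
    linarith
  have hden : ∀ ζ : ℂ, ‖ζ‖ = ρ → ρ / 2 ≤ ‖ζ - z‖ := by
    intro ζ hζ
    have := norm_sub_norm_le ζ z
    rw [hζ] at this
    linarith
  set f : ℝ → ℝ → ℂ := fun s θ => Q (s * circleMap 0 ρ θ) *
    (s * circleMap 0 ρ θ / (s * circleMap 0 ρ θ - z)) + Complex.I * Real.pi * s with hf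
  have hQc : ∀ s : ℝ, (s = 1 ∨ s = -1) → Continuous fun θ : ℝ => Q (s * circleMap 0 ρ θ) *
      (s * circleMap 0 ρ θ / (s * circleMap 0 ρ θ - z)) := by
    intro s hs
    have hcm : Continuous fun θ : ℝ => (s : ℂ) * circleMap 0 ρ θ :=
      continuous_const.mul (continuous_circleMap 0 ρ)
    have h1 : Continuous (deriv (canonicalFunction Λ T)) :=
      (differentiable_canonicalFunction.contDiff (n := 1)).continuous_deriv le_rfl
    have h2 : Continuous fun θ : ℝ => Q (s * circleMap 0 ρ θ) := by
      simp only [hQ, logDeriv_apply]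
      exact (h1.comp hcm).div (differentiable_canonicalFunction.continuous.comp hcm)
        fun θ => hφne _ (hsn s hs θ)
    refine h2.mul (hcm.div (hcm.sub continuous_const) fun θ => ?_)
    have := hden _ (hsn s hs θ)
    exact norm_pos_iff.1 (by linarith)
  have hhalf : ∀ s : ℝ, (s = 1 ∨ s = -1) →
      ‖∫ θ in (0 : ℝ)..Real.pi, f s θ‖ ≤ 2 * Real.pi * P ρ / Real.sqrt ρ := by
    intro s hs
    have hs2 : |s| = 1 := by rcases hs with rfl | rfl <;> simp
    have hL : 1 ≤ 1 + Real.log (ρ + 1) := by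
      have := Real.log_nonneg (show (1 : ℝ) ≤ ρ + 1 by linarith)
      linarith
    have hsqrt1 : 1 ≤ Real.sqrt ρ := Real.one_le_sqrt.2 hρ1
    have hsqrtρ : Real.sqrt ρ ≤ ρ := by
      have := Real.mul_self_sqrt hρpos.le
      nlinarith
    have hfn : ∀ θ, ‖f s θ‖ ≤ 2 * ‖Q (s * circleMap 0 ρ θ) + Complex.I * Real.pi * s‖ +
        2 * Real.pi * r₀ / ρ := by
      intro θ
      set ζ : ℂ := s * circleMap 0 ρ θ with hζ
      have hζn : ‖ζ‖ = ρ := hsn s hs θ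
      have hd := hden ζ hζn
      have hdpos : 0 < ‖ζ - z‖ := by linarith
      have hne : ζ - z ≠ 0 := norm_pos_iff.1 hdpos
      have e : f s θ = (Q ζ + Complex.I * Real.pi * s) * (ζ / (ζ - z)) +
          Complex.I * Real.pi * s * (-z / (ζ - z)) := by
        simp only [hf, ← hζ]
        field_simp
        ring
      rw [e]
      refine (norm_add_le _ _).trans (add_le_add ?_ ?_)
      · rw [norm_mul, mul_comm]
        gcongr
        rw [norm_div, div_le_iff₀ hdpos, hζn]
        linarith
      · have h1 : ‖Complex.I * Real.pi * (s : ℂ)‖ = Real.pi := by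
          simp [hs2, abs_of_pos hpi]
        rw [norm_mul, h1, norm_div, norm_neg, mul_div_assoc']
        rw [div_le_div_iff₀ hdpos hρpos]
        have h2 : Real.pi * ‖z‖ * ρ ≤ Real.pi * r₀ * ρ := by gcongr
        have h3 : Real.pi * r₀ * ρ ≤ Real.pi * r₀ * (2 * ‖ζ - z‖) := by
          gcongr
          linarith
        linarith
    refine norm_integral_half_circle_le hρ1 ((hQc s hs).add continuous_const).continuousOn ?_ ?_
    · intro θ hθ
      have h1 := (hbound ρ hρA hgood s hs θ hθ).1
      have h2 : 2 * Real.pi * r₀ / ρ ≤ 2 * Real.pi * r₀ * (1 + Real.log (ρ + 1)) :=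
        (div_le_self (by positivity) hρ1).trans (le_mul_of_one_le_right (by positivity) hL)
      have h3 := hfn θ
      simp only [hP]
      linarith
    · intro θ hθ hhigh
      have h1 := (hbound ρ hρA hgood s hs θ hθ).2 hhigh
      have h2 : 2 * Real.pi * r₀ / ρ ≤ 2 * Real.pi * r₀ * (1 + Real.log (ρ + 1)) / Real.sqrt ρ := by
        have h4 : 2 * Real.pi * r₀ ≤ 2 * Real.pi * r₀ * (1 + Real.log (ρ + 1)) :=
          le_mul_of_one_le_right (by positivity) hL
        exact div_le_div₀ (by positivity) h4 (by linarith) hsqrtρ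
      have h3 := hfn θ
      have e : P ρ / Real.sqrt ρ = 2 * (A * (1 + Real.log (ρ + 1)) / Real.sqrt ρ) +
          2 * Real.pi * r₀ * (1 + Real.log (ρ + 1)) / Real.sqrt ρ := by
        rw [hP]
        ring
      rw [e]
      linarith
  -- parametrize the two half circles by `θ ↦ ± ρ e^{iθ}`, `θ ∈ [0, π]`
  have hsplit : (∮ ζ in C(0, ρ), (ζ - z)⁻¹ * Q ζ) =
      Complex.I * ((∫ θ in (0 : ℝ)..Real.pi, f 1 θ) + ∫ θ in (0 : ℝ)..Real.pi, f (-1) θ) := by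
    set q : ℝ → ℂ := fun θ => Q (circleMap 0 ρ θ) * (circleMap 0 ρ θ / (circleMap 0 ρ θ - z))
      with hq
    have hqc : Continuous q := by simpa using hQc 1 (Or.inl rfl)
    have e1 : (∮ ζ in C(0, ρ), (ζ - z)⁻¹ * Q ζ) =
        Complex.I * ∫ θ in (0 : ℝ)..(2 * Real.pi), q θ := by
      rw [circleIntegral, ← intervalIntegral.integral_const_mul]
      refine intervalIntegral.integral_congr fun θ _ => ?_
      simp only [deriv_circleMap, smul_eq_mul, hq]
      ring
    have e2 : ∫ θ in Real.pi..(2 * Real.pi), q θ =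
        ∫ θ in (0 : ℝ)..Real.pi, q (θ + Real.pi) := by
      rw [intervalIntegral.integral_comp_add_right]
      congr 1 <;> ring
    have e3 : ∀ θ, q (θ + Real.pi) = Q ((-1 : ℝ) * circleMap 0 ρ θ) *
        ((-1 : ℝ) * circleMap 0 ρ θ / ((-1 : ℝ) * circleMap 0 ρ θ - z)) := by
      intro θ
      have h : circleMap 0 ρ (θ + Real.pi) = ((-1 : ℝ) : ℂ) * circleMap 0 ρ θ := by
        simp only [circleMap, zero_add]
        push_cast
        rw [add_mul, Complex.exp_add, Complex.exp_pi_mul_I]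
        ring
      simp only [hq, h]
    have i1 : IntervalIntegrable q volume 0 Real.pi := hqc.intervalIntegrable _ _
    have i2 : IntervalIntegrable (fun θ => q (θ + Real.pi)) volume 0 Real.pi :=
      (hqc.comp (continuous_id.add continuous_const)).intervalIntegrable _ _
    have e4 : ∫ θ in (0 : ℝ)..Real.pi, f 1 θ =
        (∫ θ in (0 : ℝ)..Real.pi, q θ) + Complex.I * Real.pi * Real.pi := by
      have e5 : ∀ θ, f 1 θ = q θ + Complex.I * Real.pi := by
        intro θ
        simp [hf, hq]
      simp_rw [e5]
      rw [intervalIntegral.integral_add i1 intervalIntegrable_const,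
        intervalIntegral.integral_const, sub_zero, Complex.real_smul]
      ring
    have e5 : ∫ θ in (0 : ℝ)..Real.pi, f (-1) θ =
        (∫ θ in (0 : ℝ)..Real.pi, q (θ + Real.pi)) - Complex.I * Real.pi * Real.pi := by
      have e6 : ∀ θ, f (-1) θ = q (θ + Real.pi) + -(Complex.I * Real.pi) := by
        intro θ
        rw [e3]
        simp [hf]
      simp_rw [e6]
      rw [intervalIntegral.integral_add i2 intervalIntegrable_const,
        intervalIntegral.integral_const, sub_zero, Complex.real_smul]
      ring
    rw [e1, ← intervalIntegral.integral_add_adjacent_intervals i1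
      (hqc.intervalIntegrable Real.pi (2 * Real.pi)), e2, e4, e5]
    ring
  rw [hsplit, norm_mul, Complex.norm_I, one_mul]
  have h1 := hhalf 1 (Or.inl rfl)
  have h2 := hhalf (-1) (Or.inr rfl)
  have e : 4 * Real.pi * P ρ / Real.sqrt ρ =
      2 * Real.pi * P ρ / Real.sqrt ρ + 2 * Real.pi * P ρ / Real.sqrt ρ := by ring
  rw [e]
  exact (norm_add_le _ _).trans (add_le_add h1 h2)

end LogarithmicDerivative

/-! ### Convergence of the product -/

theorem circleIntegral_sub_inv_mul_sub_inv_eq_zero {ρ : ℝ} {a z : ℂ}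
    (ha : a ∈ Metric.ball (0 : ℂ) ρ) (hz : z ∈ Metric.ball (0 : ℂ) ρ) :
    (∮ ζ in C(0, ρ), (ζ - z)⁻¹ * (ζ - a)⁻¹) = 0 := by
  have hρ : 0 ≤ ρ := (dist_nonneg.trans_lt (Metric.mem_ball.1 ha)).le
  have hne : ∀ b ∈ Metric.ball (0 : ℂ) ρ, ∀ ζ ∈ Metric.sphere (0 : ℂ) ρ, ζ - b ≠ 0 := by
    intro b hb ζ hζ h
    rw [sub_eq_zero.1 h] at hζ
    rw [Metric.mem_sphere] at hζ
    rw [Metric.mem_ball, hζ] at hb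
    exact lt_irrefl _ hb
  have hci : ∀ b ∈ Metric.ball (0 : ℂ) ρ, CircleIntegrable (fun ζ => (ζ - b)⁻¹) 0 ρ := by
    intro b hb
    refine ContinuousOn.circleIntegrable hρ ?_
    exact (continuousOn_id.sub continuousOn_const).inv₀ (hne b hb)
  rcases eq_or_ne z a with rfl | hza
  · have e : ∀ ζ : ℂ, (ζ - z)⁻¹ * (ζ - z)⁻¹ = (ζ - z) ^ (-2 : ℤ) := by
      intro ζ
      rw [zpow_neg, ← mul_inv]
      norm_cast
      rw [sq]
    simp_rw [e]
    exact circleIntegral.integral_sub_zpow_of_ne (by norm_num) _ _ _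
  · have hza' : z - a ≠ 0 := sub_ne_zero.2 hza
    have e : Set.EqOn (fun ζ : ℂ => (ζ - z)⁻¹ * (ζ - a)⁻¹)
        (fun ζ => (z - a)⁻¹ * ((ζ - z)⁻¹ - (ζ - a)⁻¹)) (Metric.sphere 0 ρ) := by
      intro ζ hζ
      have h1 := hne z hz ζ hζ
      have h2 := hne a ha ζ hζ
      simp only
      field_simp
      ring
    rw [circleIntegral.integral_congr hρ e, circleIntegral.integral_const_mul,
      circleIntegral.integral_sub (hci z hz) (hci a ha),
      circleIntegral.integral_sub_inv_of_mem_ball hz, circleIntegral.integral_sub_inv_of_mem_ball ha,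
      sub_self, mul_zero]

/-- An entire function with small logarithmic derivative on a disk is nearly constant there. -/
theorem norm_sub_le_of_norm_logDeriv_le {k : ℂ → ℂ} {r ε : ℝ} (hk : Differentiable ℂ k)
    (hr : 0 ≤ r) (hε : 0 < ε) (hne : ∀ z, ‖z‖ ≤ r → k z ≠ 0)
    (h : ∀ z, ‖z‖ ≤ r → ‖logDeriv k z‖ ≤ ε) {z : ℂ} (hz : ‖z‖ ≤ r) :
    ‖k z - k 0‖ ≤ ‖k 0‖ * (Real.exp (ε * (r + 1)) - 1) := by
  set K := ε * (r + 1) with hK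
  have hKpos : 0 < K := by positivity
  have hder : ∀ t : ℝ, HasDerivAt (fun t : ℝ => k (t * z) - k 0) (deriv k (t * z) * z) t := by
    intro t
    have h1 : HasDerivAt (fun w : ℂ => k (w * z)) (deriv k (t * z) * z) (t : ℂ) := by
      have := (hk (t * z)).hasDerivAt.comp (t : ℂ) ((hasDerivAt_id (t : ℂ)).mul_const z)
      rwa [one_mul] at this
    exact h1.comp_ofReal.sub_const _
  have hmem : ∀ t : ℝ, t ∈ Set.Ico (0 : ℝ) 1 → ‖(t : ℂ) * z‖ ≤ r := by
    intro t ht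
    rw [norm_mul, Complex.norm_real, Real.norm_eq_abs, abs_of_nonneg ht.1]
    exact (mul_le_of_le_one_left (norm_nonneg _) ht.2.le).trans hz
  have key := norm_le_gronwallBound_of_norm_deriv_right_le
    (f := fun t : ℝ => k (t * z) - k 0) (f' := fun t => deriv k (t * z) * z)
    (δ := 0) (K := K) (ε := K * ‖k 0‖) (a := 0) (b := 1)
    (fun t _ => (hder t).continuousAt.continuousWithinAt)
    (fun t _ => (hder t).hasDerivWithinAt) (by simp) (fun t ht => ?_) 1 (by simp)
  · rw [gronwallBound_of_K_ne_0 hKpos.ne', sub_zero] at key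
    simp only at key
    rw [mul_one, zero_mul, zero_add,
      mul_div_cancel_left₀ _ hKpos.ne'] at key
    simpa using key
  · have h1 := h _ (hmem t ht)
    rw [logDeriv_apply, norm_div, div_le_iff₀ (norm_pos_iff.2 (hne _ (hmem t ht)))] at h1
    have h2 : ‖k (t * z)‖ ≤ ‖k (t * z) - k 0‖ + ‖k 0‖ := norm_le_norm_sub_add _ _
    rw [norm_mul]
    calc ‖deriv k (t * z)‖ * ‖z‖ ≤ (ε * ‖k (t * z)‖) * (r + 1) := by
          gcongr
          linarith
      _ = K * ‖k (t * z)‖ := by rw [hK]; ring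
      _ ≤ K * (‖k (t * z) - k 0‖ + ‖k 0‖) := by gcongr
      _ = _ := by ring

section Product

variable {Λ : ℤ → ℂ} {T : Lp ℂ 2 (bandMeasure Real.pi) ≃L[ℂ] lp (fun _ : ℤ => ℂ) 2}

/-- Dividing out finitely many zeros; the quotient vanishes only at the remaining points of the
sequence because the zeros are simple. -/
theorem exists_canonicalFunction_factor (hT : ∀ g n, T g n = fourierSynthesis Real.pi g (Λ n))
    (S : Finset ℤ) :
    ∃ h : ℂ → ℂ, Differentiable ℂ h ∧
      (∀ z, canonicalFunction Λ T z = (∏ n ∈ S, (z - Λ n)) * h z) ∧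
      ∀ z, h z = 0 → ∃ n, n ∉ S ∧ z = Λ n := by
  classical
  induction S using Finset.induction_on with
  | empty =>
    refine ⟨canonicalFunction Λ T, differentiable_canonicalFunction, fun z => by simp,
      fun z hz => ?_⟩
    by_contra! hcon
    exact canonicalFunction_ne_zero hT (fun n => hcon n (Finset.notMem_empty n)) hz
  | insert a S ha ih =>
    obtain ⟨h, hd, hfac, hzero⟩ := ih
    have hprod : ∏ n ∈ S, (Λ a - Λ n) ≠ 0 := by
      refine Finset.prod_ne_zero_iff.2 fun n hn h0 => ha ?_
      rwa [injective_of_sampling hT (sub_eq_zero.1 h0)]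
    have hha : h (Λ a) = 0 := by
      have := hfac (Λ a)
      rw [canonicalFunction_apply_sample hT, eq_comm] at this
      exact (mul_eq_zero.1 this).resolve_left hprod
    have hdd : Differentiable ℂ (dslope h (Λ a)) := by
      rw [← differentiableOn_univ]
      exact (Complex.differentiableOn_dslope univ_mem).2 hd.differentiableOn
    have hdiv : ∀ z, h z = (z - Λ a) * dslope h (Λ a) z := by
      intro z
      have := sub_smul_dslope h (Λ a) z
      rw [hha, sub_zero, smul_eq_mul] at this
      exact this.symm
    have hfac' : ∀ z, canonicalFunction Λ T z =
        (∏ n ∈ insert a S, (z - Λ n)) * dslope h (Λ a) z := by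
      intro z
      rw [hfac, hdiv, Finset.prod_insert ha]
      ring
    refine ⟨dslope h (Λ a), hdd, hfac', fun z hz => ?_⟩
    obtain ⟨n, hn, rfl⟩ := hzero z (by rw [hdiv, hz, mul_zero])
    refine ⟨n, fun hmem => ?_, rfl⟩
    rcases Finset.mem_insert.1 hmem with rfl | h'
    swap
    · exact hn h'
    -- a double zero at `Λ n` would make `φ(z) / (z - Λ n)` vanish there
    obtain ⟨c, hc, hcf⟩ := exists_canonicalFunction_eq hT n
    have hcont1 : Continuous fun z => (∏ m ∈ S, (z - Λ m)) * dslope h (Λ n) z :=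
      (continuous_finsetProd _ fun m _ => continuous_id.sub continuous_const).mul hdd.continuous
    have hcont2 : Continuous fun z => c * fourierSynthesis Real.pi (dualSpectrum T n) z :=
      continuous_const.mul (differentiable_fourierSynthesis (integrable_Lp_two _)).continuous
    have heq := Continuous.ext_on (dense_compl_singleton (Λ n)) hcont1 hcont2 (fun z hz' => by
      have hne : z - Λ n ≠ 0 := sub_ne_zero.2 hz'
      refine mul_left_cancel₀ hne ?_
      rw [← hcf, hfac', Finset.prod_insert ha, mul_assoc])
    have h1 := congrFun heq (Λ n)
    simp only [hz, mul_zero, fourierSynthesis_dualSpectrum hT, if_true, mul_one] at h1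
    exact hc h1.symm

/-- The indices of the points of modulus less than `R`. -/
noncomputable def indicesBelow (hT : ∀ g n, T g n = fourierSynthesis Real.pi g (Λ n)) (R : ℝ) :
    Finset ℤ := by
  classical
  exact (finite_norm_le hT R).toFinset.filter fun n => ‖Λ n‖ < R

theorem mem_indicesBelow (hT : ∀ g n, T g n = fourierSynthesis Real.pi g (Λ n)) {R : ℝ} {n : ℤ} :
    n ∈ indicesBelow hT R ↔ ‖Λ n‖ < R := by
  simp only [indicesBelow, Finset.mem_filter, Set.Finite.mem_toFinset, Set.mem_ofPred_eq,
    and_iff_right_iff_imp]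
  exact le_of_lt

open Classical in
theorem generatingProduct_eq (hT : ∀ g n, T g n = fourierSynthesis Real.pi g (Λ n)) (R : ℝ)
    (z : ℂ) :
    generatingProduct Λ R z = z ^ (if ∃ n, Λ n = 0 then 1 else 0 : ℕ) *
      ∏ n ∈ (indicesBelow hT R).filter (fun n => Λ n ≠ 0), (1 - z / Λ n) := by
  rw [generatingProduct]
  congr 1
  have : {n : ℤ | ‖Λ n‖ < R ∧ Λ n ≠ 0} = ↑((indicesBelow hT R).filter (fun n => Λ n ≠ 0)) := by
    ext n
    simp [mem_indicesBelow hT]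
  rw [this, finprod_mem_coe_finset]

/-- The generating function is the truncated product times an entire function without zeros of
modulus less than `R`, whose value at the origin does not depend on `R`. -/
theorem exists_canonicalFunction_eq_mul_generatingProduct
    (hT : ∀ g n, T g n = fourierSynthesis Real.pi g (Λ n)) :
    ∃ c : ℂ, c ≠ 0 ∧ ∀ R : ℝ, 0 < R → ∃ k : ℂ → ℂ, Differentiable ℂ k ∧ k 0 = c ∧
      (∀ z, canonicalFunction Λ T z = k z * generatingProduct Λ R z) ∧
      (∀ z, k z = 0 → ∃ n, R ≤ ‖Λ n‖ ∧ z = Λ n) ∧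
      ∀ ζ, k ζ ≠ 0 → (∀ n, ζ ≠ Λ n) → logDeriv (canonicalFunction Λ T) ζ =
        ∑ n ∈ indicesBelow hT R, (ζ - Λ n)⁻¹ + logDeriv k ζ := by
  classical
  have main : ∀ R : ℝ, 0 < R → ∃ k : ℂ → ℂ, Differentiable ℂ k ∧
      k 0 = (if ∃ n, Λ n = 0 then deriv (canonicalFunction Λ T) 0 else canonicalFunction Λ T 0) ∧
      (∀ z, canonicalFunction Λ T z = k z * generatingProduct Λ R z) ∧
      (∀ z, k z = 0 → ∃ n, R ≤ ‖Λ n‖ ∧ z = Λ n) ∧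
      ∀ ζ, k ζ ≠ 0 → (∀ n, ζ ≠ Λ n) → logDeriv (canonicalFunction Λ T) ζ =
        ∑ n ∈ indicesBelow hT R, (ζ - Λ n)⁻¹ + logDeriv k ζ := by
    intro R hR
    obtain ⟨h, hd, hfac, hzero⟩ := exists_canonicalFunction_factor hT (indicesBelow hT R)
    set S := (indicesBelow hT R).filter (fun n => Λ n ≠ 0) with hS
    set A : ℂ := ∏ n ∈ S, (-Λ n) with hA
    have hA0 : A ≠ 0 := Finset.prod_ne_zero_iff.2 fun n hn =>
      neg_ne_zero.2 (Finset.mem_filter.1 hn).2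
    have hsplit : ∀ z, ∏ n ∈ indicesBelow hT R, (z - Λ n) = A * generatingProduct Λ R z := by
      intro z
      have h0 : ∏ n ∈ (indicesBelow hT R).filter (fun n => ¬ Λ n ≠ 0), (z - Λ n) =
          z ^ (if ∃ n, Λ n = 0 then 1 else 0 : ℕ) := by
        split_ifs with hex
        · obtain ⟨m, hm⟩ := hex
          have : (indicesBelow hT R).filter (fun n => ¬ Λ n ≠ 0) = {m} := by
            ext n
            simp only [Finset.mem_filter, mem_indicesBelow hT, not_not, Finset.mem_singleton]
            constructor
            · rintro ⟨-, hn⟩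
              exact injective_of_sampling hT (hn.trans hm.symm)
            · rintro rfl
              exact ⟨by rw [hm, norm_zero]; exact hR, hm⟩
          rw [this, Finset.prod_singleton, hm, sub_zero, pow_one]
        · have : (indicesBelow hT R).filter (fun n => ¬ Λ n ≠ 0) = ∅ := by
            refine Finset.filter_eq_empty_iff.2 fun n _ hn => hex ⟨n, not_not.1 hn⟩
          rw [this, Finset.prod_empty, pow_zero]
      rw [← Finset.prod_filter_mul_prod_filter_not (indicesBelow hT R) (fun n => Λ n ≠ 0), h0,
        generatingProduct_eq hT, ← hS, mul_left_comm, hA, ← Finset.prod_mul_distrib, mul_comm]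
      congr 1
      refine Finset.prod_congr rfl fun n hn => ?_
      have hn0 : Λ n ≠ 0 := (Finset.mem_filter.1 hn).2
      field_simp
      ring
    have hfac' : ∀ z, canonicalFunction Λ T z = A * h z * generatingProduct Λ R z := by
      intro z
      rw [hfac, hsplit]
      ring
    refine ⟨fun z => A * h z, hd.const_mul A, ?_, hfac', fun z hz => ?_, fun ζ hζ hζΛ => ?_⟩
    · set p : ℂ → ℂ := fun z => ∏ n ∈ S, (1 - z / Λ n) with hp
      have hp0 : p 0 = 1 := by simp [hp]
      split_ifs with hex
      · have hpd : Differentiable ℂ p := by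
          refine Differentiable.fun_finsetProd fun n _ => ?_
          fun_prop
        have e : canonicalFunction Λ T = fun z => z * (A * h z * p z) := by
          funext z
          rw [hfac' z, generatingProduct_eq hT, if_pos hex, pow_one]
          ring
        have h1 : HasDerivAt (canonicalFunction Λ T)
            (1 * (A * h 0 * p 0) + 0 * deriv (fun z => A * h z * p z) 0) 0 := by
          rw [e]
          exact (hasDerivAt_id (0 : ℂ)).mul (((hd.const_mul A).mul hpd) 0).hasDerivAt
        rw [h1.deriv, hp0]
        ring
      · rw [hfac' 0, generatingProduct_eq hT, if_neg hex, pow_zero, one_mul]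
        change A * h 0 = A * h 0 * p 0
        rw [hp0, mul_one]
    · obtain ⟨n, hn, rfl⟩ := hzero z ((mul_eq_zero.1 hz).resolve_left hA0)
      exact ⟨n, not_lt.1 fun hlt => hn ((mem_indicesBelow hT).2 hlt), rfl⟩
    · have hh : h ζ ≠ 0 := fun h0 => hζ (by simp [h0])
      have e : canonicalFunction Λ T = fun z => (∏ n ∈ indicesBelow hT R, (z - Λ n)) * h z :=
        funext hfac
      have hne : ∀ n, ζ - Λ n ≠ 0 := fun n => sub_ne_zero.2 (hζΛ n)
      have hPd : DifferentiableAt ℂ (fun z => ∏ n ∈ indicesBelow hT R, (z - Λ n)) ζ := by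
        refine DifferentiableAt.fun_finsetProd fun n _ => ?_
        fun_prop
      rw [e, logDeriv_mul (f := fun z => ∏ n ∈ indicesBelow hT R, (z - Λ n)) ζ
        (Finset.prod_ne_zero_iff.2 fun n _ => hne n) hh hPd (hd ζ),
        logDeriv_const_mul ζ A hA0]
      congr 1
      rw [logDeriv_prod (f := fun n z => z - Λ n) (fun n _ => hne n) (fun n _ => by fun_prop)]
      refine Finset.sum_congr rfl fun n _ => ?_
      rw [logDeriv_apply, deriv_sub_const, deriv_id'', one_div]
  refine ⟨_, ?_, main⟩
  obtain ⟨k, -, hk0, -, hkz, -⟩ := main 1 one_pos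
  rw [← hk0]
  intro h0
  obtain ⟨n, hn, hn0⟩ := hkz 0 h0
  rw [← hn0, norm_zero] at hn
  linarith

/-- The truncated products converge along radii that keep a fixed distance from the moduli of the
zeros. The quotient `k` of `canonicalFunction` by the product has, inside the circle, the Cauchy
integral of the logarithmic derivative of `canonicalFunction` as its logarithmic derivative, since
the terms `1 / (ζ - Λ n)` contribute nothing to this integral. So `k` is nearly constant. -/
theorem exists_forall_good_radius_near (hT : ∀ g n, T g n = fourierSynthesis Real.pi g (Λ n))
    {δ : ℝ} (hδ : 0 < δ) (hδ1 : δ ≤ 1) :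
    ∃ c : ℂ, c ≠ 0 ∧ ∀ z : ℂ, ∀ ε : ℝ, 0 < ε → ∃ ρ₀ : ℝ, ∀ ρ, ρ₀ ≤ ρ →
      (∀ n, δ ≤ |‖Λ n‖ - ρ|) → ∃ u : ℂ, ‖u - c‖ ≤ ε ∧ u ≠ 0 ∧
        canonicalFunction Λ T z = u * generatingProduct Λ ρ z := by
  obtain ⟨c, hc, hmain⟩ := exists_canonicalFunction_eq_mul_generatingProduct hT
  refine ⟨c, hc, fun z ε hε => ?_⟩
  -- `η` is small enough for `|c| (e^{η (|z| + 1)} - 1) ≤ ε`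
  obtain ⟨η, hη, hηε⟩ : ∃ η : ℝ, 0 < η ∧ ‖c‖ * (Real.exp (η * (‖z‖ + 1)) - 1) ≤ ε := by
    have hcont : Continuous fun η : ℝ => ‖c‖ * (Real.exp (η * (‖z‖ + 1)) - 1) := by fun_prop
    have h0 : Tendsto (fun η : ℝ => ‖c‖ * (Real.exp (η * (‖z‖ + 1)) - 1)) (𝓝[>] 0) (𝓝 0) := by
      have := hcont.tendsto 0
      simp only [zero_mul, Real.exp_zero, sub_self, mul_zero] at this
      exact this.mono_left nhdsWithin_le_nhds
    obtain ⟨η, h1, h2⟩ := ((h0.eventually_le_const hε).and self_mem_nhdsWithin).exists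
    exact ⟨η, h2, h1⟩
  obtain ⟨ρ₀, hρ₀⟩ := exists_norm_circleIntegral_logDeriv_le hT hδ hδ1 (norm_nonneg z)
    (show 0 < 2 * Real.pi * η by positivity)
  refine ⟨max ρ₀ (‖z‖ + 1), fun ρ hρ hgood => ?_⟩
  have hρz : ‖z‖ + 1 ≤ ρ := (le_max_right _ _).trans hρ
  have hρpos : 0 < ρ := by linarith [norm_nonneg z]
  obtain ⟨k, hkd, hk0, hkfac, hkz, hklog⟩ := hmain ρ hρpos
  have hgood' : ∀ n, ‖Λ n‖ ≠ ρ := by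
    intro n h
    have := hgood n
    rw [h, sub_self, abs_zero] at this
    linarith
  have hkne : ∀ w, ‖w‖ ≤ ρ → k w ≠ 0 := by
    intro w hw h0
    obtain ⟨n, hn, rfl⟩ := hkz w h0
    exact hgood' n (le_antisymm hw hn)
  have hlog : ∀ w, ‖w‖ ≤ ‖z‖ → ‖logDeriv k w‖ ≤ η := by
    intro w hw
    have hwρ : w ∈ Metric.ball (0 : ℂ) ρ := mem_ball_zero_iff.2 (by linarith)
    have hkl : DifferentiableOn ℂ (logDeriv k) (Metric.closedBall 0 ρ) := by
      intro x hx
      have hkx := hkne x (by simpa using hx)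
      have h1 : DifferentiableAt ℂ (deriv k) x :=
        (hkd.analyticAt x).deriv.differentiableAt
      exact (h1.div (hkd x) hkx).differentiableWithinAt
    have hcauchy := hkl.circleIntegral_sub_inv_smul hwρ
    have hsphere : ∀ b ∈ Metric.ball (0 : ℂ) ρ, ∀ ζ ∈ Metric.sphere (0 : ℂ) ρ, ζ - b ≠ 0 := by
      intro b hb ζ hζ h
      rw [sub_eq_zero.1 h] at hζ
      rw [Metric.mem_sphere] at hζ
      rw [Metric.mem_ball, hζ] at hb
      exact lt_irrefl _ hb
    have hinv : ∀ b ∈ Metric.ball (0 : ℂ) ρ,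
        ContinuousOn (fun ζ : ℂ => (ζ - b)⁻¹) (Metric.sphere 0 ρ) := fun b hb =>
      (continuousOn_id.sub continuousOn_const).inv₀ (hsphere b hb)
    have hin : ∀ n ∈ indicesBelow hT ρ, Λ n ∈ Metric.ball (0 : ℂ) ρ := fun n hn =>
      mem_ball_zero_iff.2 ((mem_indicesBelow hT).1 hn)
    have heq : (∮ ζ in C(0, ρ), (ζ - w)⁻¹ * logDeriv (canonicalFunction Λ T) ζ) =
        2 * Real.pi * Complex.I * logDeriv k w := by
      have e1 : Set.EqOn (fun ζ => (ζ - w)⁻¹ * logDeriv (canonicalFunction Λ T) ζ)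
          (fun ζ => ∑ n ∈ indicesBelow hT ρ, (ζ - w)⁻¹ * (ζ - Λ n)⁻¹ +
            (ζ - w)⁻¹ • logDeriv k ζ) (Metric.sphere 0 ρ) := by
        intro ζ hζ
        have hζn : ‖ζ‖ = ρ := by simpa using hζ
        simp only
        rw [hklog ζ (hkne ζ hζn.le) fun n h => hgood' n (h ▸ hζn), mul_add, Finset.mul_sum,
          smul_eq_mul]
      rw [circleIntegral.integral_congr hρpos.le e1, circleIntegral.integral_add,
        circleIntegral.integral_fun_sum, hcauchy, Finset.sum_eq_zero, zero_add, smul_eq_mul]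
      · exact fun n hn => circleIntegral_sub_inv_mul_sub_inv_eq_zero (hin n hn) hwρ
      · exact fun n hn =>
          ContinuousOn.circleIntegrable hρpos.le ((hinv w hwρ).mul (hinv _ (hin n hn)))
      · exact ContinuousOn.circleIntegrable hρpos.le (continuousOn_finsetSum _ fun n hn =>
          (hinv w hwρ).mul (hinv _ (hin n hn)))
      · exact ContinuousOn.circleIntegrable hρpos.le ((hinv w hwρ).smul
          (hkl.continuousOn.mono Metric.sphere_subset_closedBall))
    have h1 := hρ₀ ρ ((le_max_left _ _).trans hρ) hgood w hw
    rw [heq, norm_mul] at h1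
    have h2 : ‖2 * (Real.pi : ℂ) * Complex.I‖ = 2 * Real.pi := by
      simp [abs_of_pos Real.pi_pos]
    rw [h2] at h1
    exact le_of_mul_le_mul_left h1 (by positivity)
  refine ⟨k z, ?_, hkne z (by linarith), hkfac z⟩
  have := norm_sub_le_of_norm_logDeriv_le hkd (norm_nonneg z) hη
    (fun w hw => hkne w (by linarith)) hlog le_rfl
  rw [hk0] at this
  exact this.trans hηε

/-- The truncated products converge to a constant multiple of `canonicalFunction`. A general radius
`R` is compared with a radius in `[R, R + 1]` that avoids the zeros. -/
theorem exists_tendsto_generatingProduct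
    (hT : ∀ g n, T g n = fourierSynthesis Real.pi g (Λ n)) :
    ∃ c : ℂ, c ≠ 0 ∧ ∀ z : ℂ, Tendsto (fun R : ℝ => generatingProduct Λ R z) atTop
      (𝓝 (c * canonicalFunction Λ T z)) := by
  classical
  obtain ⟨δ, hδ, hδ1, hgood⟩ := exists_good_radius hT
  obtain ⟨c, hc, hnear⟩ := exists_forall_good_radius_near hT hδ hδ1
  obtain ⟨K, hK⟩ := exists_card_annulus_le hT
  choose ρ hρ1 hρ2 hρ3 using hgood
  refine ⟨c⁻¹, inv_ne_zero hc, fun z => ?_⟩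
  have hρtop : Tendsto ρ atTop atTop := tendsto_atTop_mono hρ1 tendsto_id
  have hgoodlim : Tendsto (fun R => generatingProduct Λ (ρ R) z) atTop
      (𝓝 (c⁻¹ * canonicalFunction Λ T z)) := by
    have hu : ∃ u : ℝ → ℂ, Tendsto u atTop (𝓝 c) ∧ ∀ᶠ R in atTop,
        u R ≠ 0 ∧ canonicalFunction Λ T z = u R * generatingProduct Λ (ρ R) z := by
      by_cases hφ : canonicalFunction Λ T z = 0
      · refine ⟨fun _ => c, tendsto_const_nhds, ?_⟩
        obtain ⟨ρ₀, h⟩ := hnear z 1 one_pos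
        filter_upwards [hρtop.eventually_ge_atTop ρ₀] with R hR
        obtain ⟨u, -, hu0, hu⟩ := h _ hR (hρ3 R)
        refine ⟨hc, ?_⟩
        rw [hφ] at hu ⊢
        rw [(mul_eq_zero.1 hu.symm).resolve_left hu0, mul_zero]
      · refine ⟨fun R => canonicalFunction Λ T z / generatingProduct Λ (ρ R) z, ?_, ?_⟩
        · rw [Metric.tendsto_nhds]
          intro ε hε
          obtain ⟨ρ₀, h⟩ := hnear z (ε / 2) (half_pos hε)
          filter_upwards [hρtop.eventually_ge_atTop ρ₀] with R hR
          obtain ⟨u, hu1, hu0, hu⟩ := h _ hR (hρ3 R)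
          have hg : generatingProduct Λ (ρ R) z ≠ 0 := fun h0 => hφ (by rw [hu, h0, mul_zero])
          rw [hu, mul_div_cancel_right₀ _ hg, dist_eq_norm]
          linarith
        · obtain ⟨ρ₀, h⟩ := hnear z 1 one_pos
          filter_upwards [hρtop.eventually_ge_atTop ρ₀] with R hR
          obtain ⟨u, -, hu0, hu⟩ := h _ hR (hρ3 R)
          have hg : generatingProduct Λ (ρ R) z ≠ 0 := fun h0 => hφ (by rw [hu, h0, mul_zero])
          exact ⟨div_ne_zero hφ hg, (div_mul_cancel₀ _ hg).symm⟩
    obtain ⟨u, hulim, hu⟩ := hu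
    refine ((hulim.inv₀ hc).mul_const (canonicalFunction Λ T z)).congr' ?_
    filter_upwards [hu] with R hR
    rw [hR.2, inv_mul_cancel_left₀ hR.1]
  -- the finitely many factors with `R ≤ |Λ n| < ρ R` tend to one
  set D : ℝ → ℂ := fun R =>
    ∏ n ∈ indicesBelow hT (ρ R) \ indicesBelow hT R, (1 - z / Λ n) with hD
  have hfac : ∀ᶠ R in atTop, generatingProduct Λ (ρ R) z = D R * generatingProduct Λ R z := by
    filter_upwards [eventually_gt_atTop 0] with R hR
    rw [generatingProduct_eq hT, generatingProduct_eq hT, mul_left_comm]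
    congr 1
    have hsub : (indicesBelow hT R).filter (fun n => Λ n ≠ 0) ⊆
        (indicesBelow hT (ρ R)).filter (fun n => Λ n ≠ 0) := by
      refine Finset.filter_subset_filter _ fun n hn => ?_
      rw [mem_indicesBelow hT] at hn ⊢
      exact hn.trans_le (hρ1 R)
    rw [← Finset.prod_sdiff hsub]
    congr 1
    refine Finset.prod_congr ?_ fun _ _ => rfl
    ext n
    simp only [Finset.mem_sdiff, Finset.mem_filter, mem_indicesBelow hT]
    constructor
    · rintro ⟨⟨h1, h2⟩, h3⟩
      exact ⟨h1, fun h4 => h3 ⟨h4, h2⟩⟩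
    · rintro ⟨h1, h2⟩
      refine ⟨⟨h1, fun h0 => h2 ?_⟩, fun h4 => h2 h4.1⟩
      rw [h0, norm_zero]
      exact hR
  have hDlim : Tendsto D atTop (𝓝 1) := by
    have h1 : Tendsto (fun R : ℝ => Real.exp (K * (‖z‖ / R)) - 1) atTop (𝓝 0) := by
      have h2 : Tendsto (fun R : ℝ => (K : ℝ) * (‖z‖ / R)) atTop (𝓝 0) := by
        simpa using (tendsto_const_nhds (x := ‖z‖)).div_atTop tendsto_id |>.const_mul (K : ℝ)
      have h3 := (Real.continuous_exp.tendsto 0).comp h2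
      rw [Real.exp_zero] at h3
      simpa using h3.sub_const 1
    rw [tendsto_iff_norm_sub_tendsto_zero]
    refine squeeze_zero' (Eventually.of_forall fun _ => norm_nonneg _) ?_ h1
    filter_upwards [eventually_gt_atTop 0] with R hR
    have hmem : ∀ n ∈ indicesBelow hT (ρ R) \ indicesBelow hT R,
        R ≤ ‖Λ n‖ ∧ ‖Λ n‖ ≤ R + 1 := by
      intro n hn
      rw [Finset.mem_sdiff, mem_indicesBelow hT, mem_indicesBelow hT, not_lt] at hn
      exact ⟨hn.2, hn.1.le.trans (hρ2 R)⟩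
    have h2 := Finset.norm_prod_one_add_sub_one_le
      (indicesBelow hT (ρ R) \ indicesBelow hT R) (fun n => -(z / Λ n))
    simp only [← sub_eq_add_neg] at h2
    refine h2.trans ?_
    gcongr
    calc ∑ n ∈ indicesBelow hT (ρ R) \ indicesBelow hT R, ‖-(z / Λ n)‖
        ≤ ∑ n ∈ indicesBelow hT (ρ R) \ indicesBelow hT R, ‖z‖ / R := by
          refine Finset.sum_le_sum fun n hn => ?_
          rw [norm_neg, norm_div]
          gcongr
          exact (hmem n hn).1
      _ ≤ K * (‖z‖ / R) := by
          rw [Finset.sum_const, nsmul_eq_mul]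
          gcongr
          exact hK R _ hmem
  have hquot := hgoodlim.div hDlim one_ne_zero
  rw [div_one] at hquot
  refine hquot.congr' ?_
  filter_upwards [hfac, hDlim.eventually_ne one_ne_zero] with R h1 h2
  rw [Pi.div_apply, h1, mul_div_cancel_left₀ _ h2]

end Product

/-! ### The interpolation kernels -/

section Kernels

variable {Λ : ℤ → ℂ} {T : Lp ℂ 2 (bandMeasure Real.pi) ≃L[ℂ] lp (fun _ : ℤ => ℂ) 2}

theorem tendsto_generatingProduct (hT : ∀ g n, T g n = fourierSynthesis Real.pi g (Λ n)) (z : ℂ) :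
    Tendsto (fun R : ℝ => generatingProduct Λ R z) atTop (𝓝 (generatingFunction Λ z)) := by
  obtain ⟨c, -, h⟩ := exists_tendsto_generatingProduct hT
  exact tendsto_nhds_limUnder ⟨_, h z⟩

/-- The normalisation in the definition of the interpolation kernels makes them the dual system of
the sampling functionals. -/
theorem interpolationKernel_eq (hT : ∀ g n, T g n = fourierSynthesis Real.pi g (Λ n)) (n : ℤ)
    (z : ℂ) :
    interpolationKernel Λ n z = fourierSynthesis Real.pi (dualSpectrum T n) z := by
  obtain ⟨c, hc, h⟩ := exists_tendsto_generatingProduct hT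
  obtain ⟨d, hd, hcan⟩ := exists_canonicalFunction_eq hT n
  set q : ℂ → ℂ := fourierSynthesis Real.pi (dualSpectrum T n) with hq
  have hqd : Differentiable ℂ q := differentiable_fourierSynthesis (integrable_Lp_two _)
  have hq1 : q (Λ n) = 1 := by
    rw [hq, fourierSynthesis_dualSpectrum hT, if_pos rfl]
  have hG : generatingFunction Λ = fun w => (w - Λ n) * (c * d * q w) := by
    funext w
    rw [generatingFunction, (h w).limUnder_eq, hcan]
    ring
  have hder : HasDerivAt (generatingFunction Λ) (c * d) (Λ n) := by
    rw [hG]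
    have h1 := ((hasDerivAt_id (Λ n)).sub_const (Λ n)).fun_mul
      ((hqd (Λ n)).hasDerivAt.const_mul (c * d))
    simpa [hq1] using h1
  unfold interpolationKernel
  rw [hder.deriv]
  rcases eq_or_ne z (Λ n) with rfl | hz
  · rw [dslope_same, hder.deriv, hq1, div_self (mul_ne_zero hc hd)]
  · have hz' : z - Λ n ≠ 0 := sub_ne_zero.2 hz
    rw [dslope_of_ne _ hz, slope_def_field, hG]
    field_simp
    ring

theorem isSpectrum_interpolationKernel
    (hT : ∀ g n, T g n = fourierSynthesis Real.pi g (Λ n)) (n : ℤ) :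
    IsSpectrum 1 Real.pi (interpolationKernel Λ n) (dualSpectrum T n) :=
  ⟨memLp_one_iff_integrable.2 (integrable_Lp_two _), interpolationKernel_eq hT n⟩

end Kernels

/-! ### Multipliers as stable time-invariant systems -/

section Multipliers

variable {σ : ℝ}

/-- Spectra are unique up to null sets. -/
theorem IsSpectrum.ae_eq {f : ℂ → ℂ} {g h : ℝ → ℂ} (hg : IsSpectrum 1 σ f g)
    (hh : IsSpectrum 1 σ f h) : g =ᵐ[bandMeasure σ] h := by
  have hgi := memLp_one_iff_integrable.1 hg.1
  have hhi := memLp_one_iff_integrable.1 hh.1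
  have h0 := ae_eq_zero_of_fourierSynthesis_eq_zero (hgi.add (hhi.smul (-1 : ℂ))) fun z => by
    rw [fourierSynthesis_add hgi (hhi.smul (-1 : ℂ)), fourierSynthesis_smul, ← hg.2, ← hh.2]
    ring
  filter_upwards [h0] with ω hω
  simp only [Pi.add_apply, Pi.smul_apply, smul_eq_mul, Pi.zero_apply] at hω
  linear_combination hω

theorem ae_norm_le_norm_Lp_top (m : Lp ℂ ⊤ (bandMeasure σ)) :
    ∀ᵐ ω ∂(bandMeasure σ), ‖m ω‖ ≤ ‖m‖ := by
  filter_upwards [ae_le_eLpNormEssSup (f := m) (μ := bandMeasure σ)] with ω hω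
  rw [← eLpNorm_exponent_top, ← Lp.enorm_def] at hω
  exact enorm_le_iff_norm_le.1 hω

theorem memLp_one_mul (m : Lp ℂ ⊤ (bandMeasure σ)) {g : ℝ → ℂ} (hg : MemLp g 1 (bandMeasure σ)) :
    MemLp (fun ω => m ω * g ω) 1 (bandMeasure σ) :=
  hg.mul (Lp.memLp m)

/-- The operator on `PW^1_σ` that multiplies spectra by the bounded function `m`. The spectrum of
each function is picked by choice; `multiplier_apply` shows that the choice does not matter. -/
noncomputable def multiplier (m : Lp ℂ ⊤ (bandMeasure σ)) :
    PaleyWiener 1 σ →ₗ[ℂ] PaleyWiener 1 σ where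
  toFun f := ⟨fourierSynthesis σ fun ω => m ω * f.2.choose ω,
    ⟨_, memLp_one_mul m f.2.choose_spec.1, fun _ => rfl⟩⟩
  map_add' f g := by
    have hf := f.2.choose_spec
    have hg := g.2.choose_spec
    have hs : IsSpectrum 1 σ (f + g : PaleyWiener 1 σ) (f.2.choose + g.2.choose) := by
      refine ⟨hf.1.add hg.1, fun z => ?_⟩
      rw [fourierSynthesis_add (memLp_one_iff_integrable.1 hf.1)
        (memLp_one_iff_integrable.1 hg.1), ← hf.2, ← hg.2]
      rfl
    ext z
    change fourierSynthesis σ _ z = fourierSynthesis σ _ z + fourierSynthesis σ _ z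
    rw [← fourierSynthesis_add (memLp_one_iff_integrable.1 (memLp_one_mul m hf.1))
        (memLp_one_iff_integrable.1 (memLp_one_mul m hg.1))]
    refine fourierSynthesis_congr ?_ z
    filter_upwards [(f + g).2.choose_spec.ae_eq hs] with ω hω
    rw [hω]
    simp [mul_add]
  map_smul' c f := by
    have hf := f.2.choose_spec
    have hs : IsSpectrum 1 σ (c • f : PaleyWiener 1 σ) (c • f.2.choose) := by
      refine ⟨hf.1.const_smul c, fun z => ?_⟩
      rw [fourierSynthesis_smul, ← hf.2]
      rfl
    ext z
    change fourierSynthesis σ _ z = c * fourierSynthesis σ _ z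
    rw [← fourierSynthesis_smul]
    refine fourierSynthesis_congr ?_ z
    filter_upwards [(c • f).2.choose_spec.ae_eq hs] with ω hω
    rw [hω]
    simp [mul_left_comm]

theorem isSpectrum_multiplier (m : Lp ℂ ⊤ (bandMeasure σ)) {f : PaleyWiener 1 σ} {g : ℝ → ℂ}
    (hg : IsSpectrum 1 σ f g) : IsSpectrum 1 σ (multiplier m f) fun ω => m ω * g ω := by
  refine ⟨memLp_one_mul m hg.1, fun z => fourierSynthesis_congr ?_ z⟩
  filter_upwards [f.2.choose_spec.ae_eq hg] with ω hω
  rw [hω]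

theorem multiplier_apply (m : Lp ℂ ⊤ (bandMeasure σ)) {f : PaleyWiener 1 σ} {g : ℝ → ℂ}
    (hg : IsSpectrum 1 σ f g) (z : ℂ) :
    (multiplier m f : ℂ → ℂ) z = fourierSynthesis σ (fun ω => m ω * g ω) z :=
  (isSpectrum_multiplier m hg).2 z

theorem pwNorm_eq {f : PaleyWiener 1 σ} {g : ℝ → ℂ} (hg : IsSpectrum 1 σ f g) :
    pwNorm 1 σ f = (eLpNorm g 1 ((ENNReal.ofReal (2 * σ))⁻¹ • bandMeasure σ)).toReal := by
  have : Nonempty {g : ℝ → ℂ // IsSpectrum 1 σ (f : ℂ → ℂ) g} := ⟨⟨g, hg⟩⟩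
  have h : ∀ k : {g : ℝ → ℂ // IsSpectrum 1 σ (f : ℂ → ℂ) g},
      (eLpNorm k.1 1 ((ENNReal.ofReal (2 * σ))⁻¹ • bandMeasure σ)).toReal =
        (eLpNorm g 1 ((ENNReal.ofReal (2 * σ))⁻¹ • bandMeasure σ)).toReal := fun k => by
    rw [eLpNorm_congr_ae (Measure.ae_smul_measure (k.2.ae_eq hg) _)]
  unfold pwNorm
  simp_rw [h]
  exact ciInf_const

/-- Multipliers are bounded by the supremum norm of their symbol. -/
theorem pwNorm_multiplier_le (hσ : 0 < σ) (m : Lp ℂ ⊤ (bandMeasure σ)) (f : PaleyWiener 1 σ) :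
    pwNorm 1 σ (multiplier m f) ≤ ‖m‖ * pwNorm 1 σ f := by
  obtain ⟨g, hg⟩ := f.2
  rw [pwNorm_eq hg, pwNorm_eq (isSpectrum_multiplier m hg)]
  have hc : (ENNReal.ofReal (2 * σ))⁻¹ ≠ ⊤ := by
    rw [Ne, ENNReal.inv_eq_top, ENNReal.ofReal_eq_zero]
    linarith
  have h1 : eLpNorm (fun ω => m ω * g ω) 1 ((ENNReal.ofReal (2 * σ))⁻¹ • bandMeasure σ) ≤
      ENNReal.ofReal ‖m‖ * eLpNorm g 1 ((ENNReal.ofReal (2 * σ))⁻¹ • bandMeasure σ) := by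
    refine eLpNorm_le_mul_eLpNorm_of_ae_le_mul (Measure.ae_smul_measure ?_ _) 1
    filter_upwards [ae_norm_le_norm_Lp_top m] with ω hω
    rw [norm_mul]
    gcongr
  have h2 := ENNReal.toReal_mono
    (ENNReal.mul_ne_top ENNReal.ofReal_ne_top (hg.1.smul_measure hc).eLpNorm_ne_top) h1
  rwa [ENNReal.toReal_mul, ENNReal.toReal_ofReal (norm_nonneg _)] at h2

theorem isSpectrum_pwTranslate (a : ℝ) {f : PaleyWiener 1 σ} {g : ℝ → ℂ}
    (hg : IsSpectrum 1 σ f g) :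
    IsSpectrum 1 σ (pwTranslate 1 σ a f)
      fun ω => Complex.exp (Complex.I * (ω : ℂ) * (-(a : ℂ))) * g ω := by
  refine ⟨?_, fun z => ?_⟩
  · refine hg.1.of_le (AEStronglyMeasurable.mul (Continuous.aestronglyMeasurable (by fun_prop))
      hg.1.1) (Eventually.of_forall fun ω => ?_)
    rw [norm_mul, norm_exp_I_mul]
    simp
  · change (f : ℂ → ℂ) (z - a) = _
    rw [hg.2]
    unfold fourierSynthesis
    congr 2
    funext ω
    rw [show Complex.I * (ω : ℂ) * (z - (a : ℂ)) =
      Complex.I * (ω : ℂ) * (-(a : ℂ)) + Complex.I * (ω : ℂ) * z by ring, Complex.exp_add]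
    ring

theorem isStableLTI_multiplier (m : Lp ℂ ⊤ (bandMeasure Real.pi)) :
    IsStableLTI (multiplier m) where
  stable := by
    refine ⟨‖m‖, ?_⟩
    rintro r ⟨f, hf, rfl⟩
    calc _ ≤ ‖m‖ * pwNorm 1 Real.pi f := pwNorm_multiplier_le Real.pi_pos m f
      _ ≤ ‖m‖ * 1 := by gcongr
      _ = ‖m‖ := mul_one _
  time_invariant a f := by
    obtain ⟨g, hg⟩ := f.2
    ext z
    rw [multiplier_apply m (isSpectrum_pwTranslate a hg),
      (isSpectrum_pwTranslate a (isSpectrum_multiplier m hg)).2]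
    congr 1
    funext ω
    ring

end Multipliers

/-! ### Divergence of the sampling series -/

section Divergence

variable {Λ : ℤ → ℂ} {T : Lp ℂ 2 (bandMeasure Real.pi) ≃L[ℂ] lp (fun _ : ℤ => ℂ) 2}

theorem integrable_top_mul_two {σ : ℝ} (m : Lp ℂ ⊤ (bandMeasure σ)) (s : Lp ℂ 2 (bandMeasure σ)) :
    Integrable (fun ω => m ω * s ω) (bandMeasure σ) :=
  memLp_one_iff_integrable.1 (memLp_one_mul m (memLp_one_iff_integrable.2 (integrable_Lp_two s)))

/-- The value at `z` of the function with spectrum `m * s`, as a bilinear form in the multiplier `m`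
and the spectrum `s`. -/
noncomputable def multiplierPairing (σ : ℝ) (z : ℂ) :
    Lp ℂ ⊤ (bandMeasure σ) →ₗ[ℂ] Lp ℂ 2 (bandMeasure σ) →ₗ[ℂ] ℂ :=
  LinearMap.mk₂ ℂ (fun m s => fourierSynthesis σ (fun ω => m ω * s ω) z)
    (fun m m' s => by
      rw [← fourierSynthesis_add (integrable_top_mul_two m s) (integrable_top_mul_two m' s)]
      refine fourierSynthesis_congr ?_ z
      filter_upwards [Lp.coeFn_add m m'] with ω hω
      change (m + m') ω * s ω = m ω * s ω + m' ω * s ω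
      rw [hω, Pi.add_apply, add_mul])
    (fun c m s => by
      rw [smul_eq_mul, ← fourierSynthesis_smul]
      refine fourierSynthesis_congr ?_ z
      filter_upwards [Lp.coeFn_smul c m] with ω hω
      simp [hω, mul_assoc])
    (fun m s s' => by
      rw [← fourierSynthesis_add (integrable_top_mul_two m s) (integrable_top_mul_two m s')]
      refine fourierSynthesis_congr ?_ z
      filter_upwards [Lp.coeFn_add s s'] with ω hω
      change m ω * (s + s') ω = m ω * s ω + m ω * s' ω
      rw [hω, Pi.add_apply, mul_add])
    (fun c m s => by
      rw [smul_eq_mul, ← fourierSynthesis_smul]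
      refine fourierSynthesis_congr ?_ z
      filter_upwards [Lp.coeFn_smul c s] with ω hω
      simp [hω, mul_left_comm])

theorem multiplierPairing_apply (σ : ℝ) (z : ℂ) (m : Lp ℂ ⊤ (bandMeasure σ))
    (s : Lp ℂ 2 (bandMeasure σ)) :
    multiplierPairing σ z m s = fourierSynthesis σ (fun ω => m ω * s ω) z := rfl

theorem norm_multiplierPairing_le (σ : ℝ) (z : ℂ) (m : Lp ℂ ⊤ (bandMeasure σ))
    (s : Lp ℂ 2 (bandMeasure σ)) :
    ‖multiplierPairing σ z m s‖ ≤
      (Real.exp (σ * |z.im|) * ∫ ω, ‖s ω‖ ∂(bandMeasure σ)) * ‖m‖ := by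
  rw [multiplierPairing_apply, mul_assoc, mul_comm _ ‖m‖, ← integral_const_mul]
  refine (norm_fourierSynthesis_le (integrable_top_mul_two m s) z).trans ?_
  refine mul_le_mul_of_nonneg_left ?_ (Real.exp_pos _).le
  refine integral_mono_ae (integrable_top_mul_two m s).norm
    ((integrable_Lp_two s).norm.const_mul _) ?_
  filter_upwards [ae_norm_le_norm_Lp_top m] with ω hω
  rw [norm_mul]
  gcongr

/-- At a real point the pairing attains the `L¹` norm of the spectrum, up to the factor `1 / (2π)`,
on the unit ball of multipliers. -/
theorem exists_multiplierPairing_eq (σ t : ℝ) (s : Lp ℂ 2 (bandMeasure σ)) :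
    ∃ m : Lp ℂ ⊤ (bandMeasure σ), ‖m‖ ≤ 1 ∧ ‖multiplierPairing σ t m s‖ =
      1 / (2 * Real.pi) * ∫ ω, ‖s ω‖ ∂(bandMeasure σ) := by
  set u : ℝ → ℂ := fun ω => s ω * Complex.exp (Complex.I * (ω : ℂ) * (t : ℂ)) with hu
  have hus : ∀ ω, ‖u ω‖ = ‖s ω‖ := fun ω => by
    rw [hu]
    simp [norm_exp_I_mul]
  have hum : StronglyMeasurable u :=
    (Lp.stronglyMeasurable s).mul (Continuous.stronglyMeasurable (by fun_prop))
  -- the conjugate phase of `u`; at the zeros of `u` it is `0 / 0 = 0`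
  set k : ℝ → ℂ := fun ω => star (u ω) / (‖u ω‖ : ℂ) with hk
  have hkm : Measurable k := by
    have h1 := hum.measurable
    have h2 : Measurable fun ω => star (u ω) := continuous_star.measurable.comp h1
    exact h2.div (Complex.measurable_ofReal.comp h1.norm)
  have hk1 : ∀ ω, ‖k ω‖ ≤ 1 := fun ω => by
    rw [hk]
    simp only [norm_div, norm_star, Complex.norm_real, norm_norm]
    exact div_self_le_one _
  have hkL : MemLp k ⊤ (bandMeasure σ) :=
    MemLp.of_bound hkm.aestronglyMeasurable 1 (Eventually.of_forall hk1)
  refine ⟨hkL.toLp k, ?_, ?_⟩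
  · have := Lp.norm_le_of_ae_bound (f := hkL.toLp k) zero_le_one
      (by filter_upwards [hkL.coeFn_toLp] with ω hω; rw [hω]; exact hk1 ω)
    simpa using this
  · have h1 : ∀ ω, k ω * s ω * Complex.exp (Complex.I * (ω : ℂ) * (t : ℂ)) = (‖s ω‖ : ℂ) := by
      intro ω
      rw [mul_assoc, ← hus]
      change star (u ω) / (‖u ω‖ : ℂ) * u ω = _
      rcases eq_or_ne (u ω) 0 with h0 | h0
      · simp [h0]
      · have h2 : (‖u ω‖ : ℂ) ≠ 0 := by simpa using h0
        have h3 : star (u ω) * u ω = (‖u ω‖ : ℂ) ^ 2 := Complex.conj_mul' (u ω)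
        rw [div_mul_eq_mul_div, h3]
        field_simp
    have h2 : fourierSynthesis σ (fun ω => hkL.toLp k ω * s ω) t =
        fourierSynthesis σ (fun ω => k ω * s ω) t := by
      refine fourierSynthesis_congr ?_ _
      filter_upwards [hkL.coeFn_toLp] with ω hω
      rw [hω]
    rw [multiplierPairing_apply, h2]
    unfold fourierSynthesis
    simp_rw [h1]
    rw [integral_complex_ofReal, norm_mul, Complex.norm_real, Real.norm_of_nonneg
      (integral_nonneg fun ω => norm_nonneg _)]
    simp [abs_of_pos Real.pi_pos]

/-- By the uniform boundedness principle, some multiplier maps the interpolation kernels to functions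
whose values at `t` have unbounded partial sums. -/
theorem exists_multiplier_sum_unbounded
    (hT : ∀ g n, T g n = fourierSynthesis Real.pi g (Λ n)) (t : ℝ) :
    ∃ m : Lp ℂ ⊤ (bandMeasure Real.pi), ¬ ∃ M : ℝ, ∀ N : ℕ,
      ‖∑ n ∈ Finset.Icc (-(N : ℤ)) N, multiplierPairing Real.pi t m (dualSpectrum T n)‖ ≤ M := by
  by_contra! hcon
  set ℓ : ℕ → Lp ℂ ⊤ (bandMeasure Real.pi) →L[ℂ] ℂ := fun N =>
    LinearMap.mkContinuous
      ((multiplierPairing Real.pi t).flip (∑ n ∈ Finset.Icc (-(N : ℤ)) N, dualSpectrum T n)) _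
      (fun m => norm_multiplierPairing_le Real.pi t m _) with hℓ
  have hℓ' : ∀ N m, ℓ N m = multiplierPairing Real.pi t m
    (∑ n ∈ Finset.Icc (-(N : ℤ)) N, dualSpectrum T n) := fun N m => rfl
  obtain ⟨C, hC⟩ := banach_steinhaus (g := ℓ) fun m => by
    obtain ⟨M, hM⟩ := hcon m
    exact ⟨M, fun N => by rw [hℓ', map_sum]; exact hM N⟩
  refine not_exists_bound_integral_norm_sum_dualSpectrum hT ⟨2 * Real.pi * C, fun N => ?_⟩
  obtain ⟨m, hm, he⟩ := exists_multiplierPairing_eq Real.pi t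
    (∑ n ∈ Finset.Icc (-(N : ℤ)) N, dualSpectrum T n)
  have h1 : ‖ℓ N m‖ ≤ C :=
    ((ℓ N).le_of_opNorm_le (hC N) m).trans
      (mul_le_of_le_one_right ((norm_nonneg _).trans (hC N)) hm)
  rw [hℓ', he, one_div, inv_mul_le_iff₀ (by have := Real.pi_pos; positivity)] at h1
  exact h1

/-- The evaluation `g ↦ f(z)`, where `f` has the spectrum `g ∈ L¹([-σ, σ])`. -/
noncomputable def evalSpectrumOne (σ : ℝ) (z : ℂ) : Lp ℂ 1 (bandMeasure σ) →L[ℂ] ℂ :=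
  LinearMap.mkContinuous
    { toFun := fun g => fourierSynthesis σ g z
      map_add' := fun g h => by
        rw [fourierSynthesis_congr (Lp.coeFn_add g h),
          fourierSynthesis_add (L1.integrable_coeFn g) (L1.integrable_coeFn h)]
      map_smul' := fun c g => by
        rw [fourierSynthesis_congr (Lp.coeFn_smul c g), fourierSynthesis_smul]
        rfl }
    (Real.exp (σ * |z.im|)) fun g => by
      rw [L1.norm_eq_integral_norm g]
      exact norm_fourierSynthesis_le (L1.integrable_coeFn g) z

theorem evalSpectrumOne_apply (σ : ℝ) (z : ℂ) (g : Lp ℂ 1 (bandMeasure σ)) :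
    evalSpectrumOne σ z g = fourierSynthesis σ g z := rfl

theorem norm_toLp_shortBand_le {ε σ : ℝ} (hε : 0 < ε) (x : ℝ) :
    ‖(memLp_shortBand ε x σ 1).toLp (shortBand ε x)‖ ≤ 2 * ε := by
  rw [L1.norm_eq_integral_norm ((memLp_shortBand ε x σ 1).toLp (shortBand ε x))]
  have h1 : ∫ ω, ‖(memLp_shortBand ε x σ 1).toLp (shortBand ε x) ω‖ ∂(bandMeasure σ) =
      ∫ ω in Set.Icc (-ε) ε, ‖shortBand ε x ω‖ ∂(bandMeasure σ) := by
    rw [← integral_indicator (f := fun ω => ‖shortBand ε x ω‖) measurableSet_Icc]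
    refine integral_congr_ae ?_
    filter_upwards [(memLp_shortBand ε x σ 1).coeFn_toLp] with ω hω
    rw [hω]
    by_cases h : ω ∈ Set.Icc (-ε) ε
    · rw [Set.indicator_of_mem h]
    · rw [Set.indicator_of_notMem h, shortBand, Set.indicator_of_notMem h, norm_zero]
  have hle : (bandMeasure σ).restrict (Set.Icc (-ε) ε) ≤ volume.restrict (Set.Icc (-ε) ε) :=
    Measure.restrict_mono le_rfl Measure.restrict_le_self
  have hi : Integrable (fun ω => ‖shortBand ε x ω‖) (volume.restrict (Set.Icc (-ε) ε)) :=
    (memLp_one_iff_integrable.1 (memLp_shortBand ε x ε 1)).norm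
  rw [h1]
  calc ∫ ω in Set.Icc (-ε) ε, ‖shortBand ε x ω‖ ∂(bandMeasure σ)
      ≤ ∫ ω in Set.Icc (-ε) ε, ‖shortBand ε x ω‖ :=
        integral_mono_measure hle (Eventually.of_forall fun _ => norm_nonneg _) hi
    _ ≤ ∫ ω in Set.Icc (-ε) ε, (1 : ℝ) :=
        integral_mono hi (integrable_const _) fun ω => norm_shortBand_le ε x ω
    _ = 2 * ε := by
      rw [integral_const, smul_eq_mul, mul_one, measureReal_restrict_apply_univ,
        Real.volume_real_Icc_of_le (by linarith)]
      ring

/-- If the partial sums of `c` are unbounded, then, for every bandwidth `σ > 0`, so are the sums of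
`f (Λ n) * c n` for some `f ∈ PW^1_σ`. The functions with spectrum `shortBand ε 0`, suitably normalised, tend
to a constant at each point as `ε → 0`, while their norms stay bounded; so a uniform bound for the
sums would be inherited by the partial sums of `c`. -/
theorem exists_spectrum_sum_unbounded {σ : ℝ} (hσ : 0 < σ) {c : ℤ → ℂ}
    (hc : ¬ ∃ M : ℝ, ∀ N : ℕ, ‖∑ n ∈ Finset.Icc (-(N : ℤ)) N, c n‖ ≤ M) (Λ : ℤ → ℂ) :
    ∃ g : Lp ℂ 1 (bandMeasure σ), ¬ ∃ M : ℝ, ∀ N : ℕ,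
      ‖∑ n ∈ Finset.Icc (-(N : ℤ)) N, fourierSynthesis σ g (Λ n) * c n‖ ≤ M := by
  by_contra! hcon
  set ℓ : ℕ → Lp ℂ 1 (bandMeasure σ) →L[ℂ] ℂ := fun N =>
    ∑ n ∈ Finset.Icc (-(N : ℤ)) N, c n • evalSpectrumOne σ (Λ n) with hℓ
  have hℓ' : ∀ N g, ℓ N g = ∑ n ∈ Finset.Icc (-(N : ℤ)) N, fourierSynthesis σ g (Λ n) * c n := by
    intro N g
    rw [hℓ]
    simp [evalSpectrumOne_apply, mul_comm]
  obtain ⟨C, hC⟩ := banach_steinhaus (g := ℓ) fun g => by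
    obtain ⟨M, hM⟩ := hcon g
    exact ⟨M, fun N => by rw [hℓ']; exact hM N⟩
  have hpi := Real.pi_pos
  refine hc ⟨2 * Real.pi * C, fun N => ?_⟩
  set I := Finset.Icc (-(N : ℤ)) N with hI
  set A : ℝ := ∑ n ∈ I, ‖Λ n‖ * ‖c n‖ with hA
  have key : ∀ᶠ ε : ℝ in 𝓝[>] 0, ‖∑ n ∈ I, c n‖ ≤ 2 * Real.pi * C + 2 * ε * A := by
    have hsmall : ∀ n ∈ I, ∀ᶠ ε : ℝ in 𝓝[>] 0, ε * ‖Λ n‖ ≤ 1 := fun n _ => by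
      have h0 : Tendsto (fun ε : ℝ => ε * ‖Λ n‖) (𝓝[>] 0) (𝓝 (0 * ‖Λ n‖)) :=
        (tendsto_id.mul_const _).mono_left nhdsWithin_le_nhds
      rw [zero_mul] at h0
      exact h0.eventually (ge_mem_nhds zero_lt_one)
    have hσ' : ∀ᶠ ε : ℝ in 𝓝[>] 0, ε ≤ σ :=
      nhdsWithin_le_nhds (ge_mem_nhds hσ)
    filter_upwards [(Filter.eventually_all_finset I).2 hsmall, hσ', self_mem_nhdsWithin]
      with ε h1 h2 (h3 : 0 < ε)
    have hm := memLp_shortBand ε 0 σ 1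
    have h4 : ‖∑ n ∈ I, fourierSynthesis σ (shortBand ε 0) (Λ n) * c n‖ ≤ C * (2 * ε) := by
      have h5 := (ℓ N).le_of_opNorm_le_of_le (hC N)
        (norm_toLp_shortBand_le (σ := σ) h3 0)
      rw [hℓ'] at h5
      simpa only [fourierSynthesis_congr hm.coeFn_toLp] using h5
    have h5 : ‖∑ n ∈ I, (fourierSynthesis σ (shortBand ε 0) (Λ n) - ε / Real.pi) * c n‖ ≤
        2 * ε * ε / Real.pi * A := by
      rw [hA, Finset.mul_sum]
      refine norm_sum_le_of_le _ fun n hn => ?_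
      have h6 := norm_fourierSynthesis_shortBand_sub_le (x := 0) h3 h2 (z := Λ n)
        (by simpa using h1 n hn)
      rw [Complex.ofReal_zero, sub_zero] at h6
      rw [norm_mul]
      calc _ ≤ 2 * ε * (ε * ‖Λ n‖) / Real.pi * ‖c n‖ := by gcongr
        _ = _ := by ring
    have h6 : (ε / Real.pi : ℂ) * ∑ n ∈ I, c n =
        ∑ n ∈ I, fourierSynthesis σ (shortBand ε 0) (Λ n) * c n -
        ∑ n ∈ I, (fourierSynthesis σ (shortBand ε 0) (Λ n) - ε / Real.pi) * c n := by
      rw [Finset.mul_sum, ← Finset.sum_sub_distrib]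
      exact Finset.sum_congr rfl fun n _ => by ring
    have h7 : ε / Real.pi * ‖∑ n ∈ I, c n‖ ≤ C * (2 * ε) + 2 * ε * ε / Real.pi * A := by
      have h8 : ‖(ε / Real.pi : ℂ)‖ = ε / Real.pi := by
        rw [norm_div, Complex.norm_real, Complex.norm_real, Real.norm_of_nonneg h3.le,
          Real.norm_of_nonneg hpi.le]
      rw [← h8, ← norm_mul, h6]
      exact (norm_sub_le _ _).trans (add_le_add h4 h5)
    have h9 : ε / Real.pi * ‖∑ n ∈ I, c n‖ ≤ ε / Real.pi * (2 * Real.pi * C + 2 * ε * A) := by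
      refine h7.trans (le_of_eq ?_)
      field_simp
    exact le_of_mul_le_mul_left h9 (by positivity)
  have hlim : Tendsto (fun ε : ℝ => 2 * Real.pi * C + 2 * ε * A) (𝓝[>] 0)
      (𝓝 (2 * Real.pi * C + 2 * 0 * A)) :=
    (((tendsto_id.const_mul 2).mul_const A).const_add _).mono_left nhdsWithin_le_nhds
  simpa using ge_of_tendsto hlim key

/-- A sequence without an upper bound has upper limit `⊤`. -/
theorem limsup_coe_eq_top {a : ℕ → ℝ} (ha : ¬ ∃ M : ℝ, ∀ N, a N ≤ M) :
    limsup (fun N => (a N : EReal)) atTop = ⊤ := by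
  by_contra h
  obtain ⟨C, hC, -⟩ := EReal.lt_iff_exists_real_btwn.1 (lt_top_iff_ne_top.2 h)
  have h1 : ∀ᶠ N in atTop, a N ≤ C := by
    filter_upwards [eventually_lt_of_limsup_lt hC] with N hN
    exact (EReal.coe_lt_coe_iff.1 hN).le
  have h2 : IsBoundedUnder (· ≤ ·) atTop a := ⟨C, h1⟩
  obtain ⟨M, hM⟩ := h2.bddAbove_range
  exact ha ⟨M, fun N => hM ⟨N, rfl⟩⟩

end Divergence

theorem theorem14 (Λ : ℤ → ℂ) (hΛ : IsCompleteInterpolating Λ) (t : ℝ) :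
    (∀ z : ℂ, Tendsto (fun R : ℝ => generatingProduct Λ R z) atTop
      (𝓝 (generatingFunction Λ z))) ∧
    ∃ hφ : ∀ n : ℤ, interpolationKernel Λ n ∈ PaleyWiener 1 Real.pi,
    ∃ H : PaleyWiener 1 Real.pi →ₗ[ℂ] PaleyWiener 1 Real.pi, IsStableLTI H ∧
      ∀ β : ℝ, 0 < β → β < 1 → ∃ f ∈ PaleyWiener 1 (β * Real.pi),
        limsup (fun N : ℕ =>
          ((‖∑ n ∈ Finset.Icc (-(N : ℤ)) (N : ℤ),
              f (Λ n) * (H ⟨interpolationKernel Λ n, hφ n⟩ : ℂ → ℂ) (t : ℂ)‖ : ℝ) : EReal))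
          atTop = ⊤ := by
  obtain ⟨T, hT⟩ := hΛ.exists_samplingEquiv
  obtain ⟨m, hm⟩ := exists_multiplier_sum_unbounded hT t
  refine ⟨tendsto_generatingProduct hT, fun n => ⟨_, isSpectrum_interpolationKernel hT n⟩,
    multiplier m, isStableLTI_multiplier m, fun β hβ _ => ?_⟩
  obtain ⟨g, hg⟩ := exists_spectrum_sum_unbounded (mul_pos hβ Real.pi_pos) hm Λ
  refine ⟨fourierSynthesis (β * Real.pi) g, ⟨g, Lp.memLp g, fun _ => rfl⟩, limsup_coe_eq_top ?_⟩
  have hval : ∀ n, (multiplier m ⟨interpolationKernel Λ n,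
      ⟨_, isSpectrum_interpolationKernel hT n⟩⟩ : ℂ → ℂ) t =
      multiplierPairing Real.pi t m (dualSpectrum T n) := fun n =>
    multiplier_apply m (f := ⟨_, _, isSpectrum_interpolationKernel hT n⟩)
      (isSpectrum_interpolationKernel hT n) t
  simp_rw [hval]
  exact hg
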